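/- **Theorem (Approximate bounded Hamming distance decider).** There is a quantum algorithm that, given oracle access to two strings $X, Y$ of equal length $m \ge 0$ over the alphabet $\{0,1\}^b$, an integer threshold $k > 0$, and $\epsilon \in (0,1]$, outputs YES ($1$) or NO ($0$) so that * if $\delta_H(X,Y) \le k$, then it outputs YES with probability at least $9/10$; * if $\delta_H(X,Y) > (1+\epsilon)k$, then it outputs NO with probability at least $9/10$; where $\delta_H(X,Y) = |\{i : X_i \ne Y_i\}|$ is the Hamming distance. The algorithm takes $\tilde O\left(1 + \epsilon^{-1}\sqrt{m/k}\right)$ quantum time: there are constants $C$ and $d$ such that for all $m, b, k, \epsilon$ as above the time is at most $$ C\left(1 + \epsilon^{-1}\sqrt{m/k}\right)\bigl(1 + b + \log(1 + m/\epsilon)\bigr)^{d}. $$ Here a quantum algorithm is a family of quantum circuits, one for every choice of $m, b, k, \epsilon$ (the same for all $X, Y$), whose description can be computed by a classical computer from $m$, $b$, $k$ and $\epsilon$ when $\epsilon$ is rational. A circuit starts in the state $|0\cdots0\rangle$ and ends with the measurement of one output qubit. Its gates are Hadamard, $\mathrm{diag}(1, e^{2\pi i/2^r})$ for $r \in \mathbb{N}$,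 NOT, CNOT, Toffoli, and queries $|i\rangle|z\rangle \mapsto |i\rangle|z \oplus S_i\rangle$ with $S \in \{X, Y\}$, $i$ an address of $\lceil \log_2 m\rceil$ bits and $z$ of $b$ bits (a query with $i \ge m$ acts as the identity). Time means circuit size: every gate and every query costs $1$, except that the phase gate with parameter $r$ costs $r+1$. -/

import Mathlib

/-- Elementary gates on a register of qubits labelled by `Q`, with access to two oracles.
An oracle has `a` address wires and `b` data wires; in a query gate the injective map `w` says
which qubits these wires are connected to. -/
inductive QGate (a b : ℕ) (Q : Type) : Type where
  | hadamard (q : Q)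
  | phase (r : ℕ) (q : Q)
  | pauliX (q : Q)
  | cnot (c t : Q) (h : c ≠ t)
  | toffoli (c d t : Q) (hcd : c ≠ d) (hct : c ≠ t) (hdt : d ≠ t)
  | queryX (w : Fin a ⊕ Fin b ↪ Q)
  | queryY (w : Fin a ⊕ Fin b ↪ Q)

/-- State vectors of the register: one complex amplitude for every computational basis state. -/
abbrev QState (Q : Type) : Type := (Q → Bool) → ℂ

section Semantics

variable {a b m : ℕ} {Q : Type} [DecidableEq Q]

/-- The address `∑ᵢ 2ⁱ xᵢ` held by the address wires in the basis state `x`. -/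
def queryAddress (w : Fin a ⊕ Fin b ↪ Q) (x : Q → Bool) : ℕ :=
  ∑ i : Fin a, if x (w (Sum.inl i)) then 2 ^ (i : ℕ) else 0

/-- Action on basis states of a query to the string `S` of `m` symbols of `b` bits each:
`|i⟩|z⟩ ↦ |i⟩|z ⊕ S[i]⟩` for `i < m`, and `|i⟩|z⟩ ↦ |i⟩|z⟩` for an address `i ≥ m`. -/
def queryBasis (S : Fin m → Fin b → Bool) (w : Fin a ⊕ Fin b ↪ Q) (x : Q → Bool) : Q → Bool :=
  fun q => xor (x q)
    (decide (∃ h : queryAddress w x < m, ∃ j : Fin b,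
      w (Sum.inr j) = q ∧ S ⟨queryAddress w x, h⟩ j = true))

/-- The unitary action of a gate on state vectors, when the oracles hold the strings `X` and `Y`.
`phase r` is the gate `diag(1, exp(2πi / 2 ^ r))`. The last five gates are involutive permutations
`f` of the basis states, and send the amplitude function `ψ` to `ψ ∘ f`. -/
noncomputable def QGate.apply (X Y : Fin m → Fin b → Bool) :
    QGate a b Q → QState Q → QState Q
  | .hadamard q, ψ => fun x =>
      (ψ (Function.update x q false) +
        (if x q then -1 else 1) * ψ (Function.update x q true)) / (Real.sqrt 2 : ℂ)
  | .phase r q, ψ => fun x =>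
      (if x q then Complex.exp (2 * Real.pi * Complex.I / 2 ^ r) else 1) * ψ x
  | .pauliX q, ψ => fun x => ψ (Function.update x q (!x q))
  | .cnot c t _, ψ => fun x => ψ (Function.update x t (xor (x t) (x c)))
  | .toffoli c d t _ _ _, ψ => fun x => ψ (Function.update x t (xor (x t) (x c && x d)))
  | .queryX w, ψ => fun x => ψ (queryBasis X w x)
  | .queryY w, ψ => fun x => ψ (queryBasis Y w x)

end Semantics

/-- Every gate and every query costs one unit, except that the phase gate of angle `2π / 2 ^ r` is
charged `r + 1` units, so that precision is not free. -/
def QGate.cost {a b : ℕ} {Q : Type} : QGate a b Q → ℕ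
  | .phase r _ => r + 1
  | _ => 1

/-- A quantum circuit with two oracles: finitely many qubits, a list of gates (the first one is
applied first), and the qubit that is measured at the end. -/
structure OracleCircuit (a b : ℕ) : Type where
  width : ℕ
  gates : List (QGate a b (Fin width))
  out : Fin width

namespace OracleCircuit

variable {a b m : ℕ}

/-- The size of the circuit: the total cost of its gates and queries. -/
def size (c : OracleCircuit a b) : ℕ := (c.gates.map QGate.cost).sum

/-- The state in which the circuit ends when it is started in `|0…0⟩`. -/
noncomputable def finalState (c : OracleCircuit a b) (X Y : Fin m → Fin b → Bool) :
    QState (Fin c.width) :=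
  c.gates.foldl (fun ψ g => g.apply X Y ψ) (fun x => if x = (fun _ => false) then 1 else 0)

/-- The probability that the final measurement of the output qubit, in the computational basis,
gives `v`. -/
noncomputable def outputProb (c : OracleCircuit a b) (X Y : Fin m → Fin b → Bool) (v : Bool) : ℝ :=
  ∑ x : Fin c.width → Bool, if x c.out = v then ‖c.finalState X Y x‖ ^ 2 else 0

end OracleCircuit

/-- The description of a gate by natural numbers: its kind, its parameter, its qubits. -/
def QGate.code {a b n : ℕ} : QGate a b (Fin n) → List ℕ
  | .hadamard q => [0, q]
  | .phase r q => [1, r, q]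
  | .pauliX q => [2, q]
  | .cnot c t _ => [3, c, t]
  | .toffoli c d t _ _ _ => [4, c, d, t]
  | .queryX w => 5 :: (List.ofFn (fun i => (w (Sum.inl i) : ℕ)) ++
      List.ofFn (fun j => (w (Sum.inr j) : ℕ)))
  | .queryY w => 6 :: (List.ofFn (fun i => (w (Sum.inl i) : ℕ)) ++
      List.ofFn (fun j => (w (Sum.inr j) : ℕ)))

/-- The description of a circuit by natural numbers. -/
def OracleCircuit.code {a b : ℕ} (c : OracleCircuit a b) : ℕ × ℕ × List (List ℕ) :=
  (c.width, (c.out : ℕ), c.gates.map QGate.code)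

/-- A quantum algorithm for pairs of strings of length `m` over the alphabet of `b`-bit symbols,
with parameters `k` and `ε`: an oracle circuit for every choice of `m`, `b`, `k`, `ε`, where an
address has `⌈log₂ m⌉` bits. The algorithm is uniform: from `m`, `b`, `k` and a rational `ε = p / q`
a classical computer can compute the circuit. -/
structure QuantumStringAlgorithm : Type where
  circuit : (m b k : ℕ) → (ε : ℝ) → OracleCircuit (Nat.clog 2 m) b
  uniform : Computable (fun v : ℕ × ℕ × ℕ × ℕ × ℕ =>
    (circuit v.1 v.2.1 v.2.2.1 ((v.2.2.2.1 : ℝ) / (v.2.2.2.2 : ℝ))).code)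

/-! The algorithm is a single run of amplitude estimation (quantum counting), followed by a
classical comparison inside the circuit. Pad the positions to `2 ^ a` addresses with `a = ⌈log₂ m⌉`.
A query beyond `m` does nothing, so padded addresses never look different, and the fraction of
differing addresses is `p = δ_H / 2 ^ a = sin² θ`. Starting from the uniform superposition, a Grover
iteration rotates by `2θ`: after `t` of them the marked and unmarked amplitudes are proportional to
`sin ((2t+1)θ)` and `cos ((2t+1)θ)` (`groverAmp_trig`).

A counter of `n` qubits in uniform superposition controls the number `t` of iterations
(`isGroverState_groverPowers`), and its quantum Fourier transform (`semL_qft`) makes the frequency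
visible: the counter reads `y` with probability equal to the mean of two Fejér-type kernels, centred
at `±2 ^ n θ / π` modulo `2 ^ n` (`counterProb_eq_kern`). The kernel decays like `1 / (4 γ²)`, so a
set of readings that stays 11 away from both centres has probability at most `1/10`
(`sum_counterProb_window_le`, `sum_counterProb_outside_le`). The circuit says YES when `y` is within
`s` of `0` modulo `2 ^ n`.

The threshold `s` approximates the centre for the fraction `(k / 2 ^ a)(1 + E/2)`, where `E = 2⁻ʲ ≤
ε`. On either side of the promise gap `√p` differs from the square root of that fraction by at least
a constant times `√(k / 2 ^ a) E`. As sine is 1-Lipschitz, so do the angles (`angle_gap`), and a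
counter with `2 ^ n` of order `ε⁻¹ √(m/k)` resolves them (`threshold_spec`). This is also the number
of Grover iterations; everything else is polylogarithmic. If `m ≤ (1 + E) k`, nothing needs to be
rejected and a constant circuit suffices.

For uniformity `s` must be computable without real arithmetic: doubling an angle acts on `sin²` as
the logistic map, so iterating that map on exact fractions yields the binary expansion of the angle
(`abs_tent_sub_le`). Only computability is claimed here, not efficiency. The circuits are analysed
on wires numbered by `ℕ` and transferred to the official model by `apply_toQGate`. -/

open Finset

/-! ### Circuits on numbered wires -/

/-- A gate on wires numbered by natural numbers: its kind, followed by its parameters. -/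
abbrev WGate : Type := ℕ × ℕ × ℕ × ℕ

/-- A classical assignment of bits to all wires. -/
abbrev WBits : Type := ℕ → Bool

/-- A family of amplitudes, one for every assignment of bits to the wires. -/
abbrev WState : Type := WBits → ℂ

/-- The number in binary on the `k` wires from `B` on, the least significant bit first. -/
def wval (B k : ℕ) (x : WBits) : ℕ := ∑ i ∈ range k, if x (B + i) then 2 ^ i else 0

namespace WGate

def had (q : ℕ) : WGate := (0, q, 0, 0)
def phase (r q : ℕ) : WGate := (1, r, q, 0)
def pauliX (q : ℕ) : WGate := (2, q, 0, 0)
def cnot (c t : ℕ) : WGate := (3, c, t, 0)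
def toffoli (c d t : ℕ) : WGate := (4, c, d, t)
def queryX : WGate := (5, 0, 0, 0)
def queryY : WGate := (6, 0, 0, 0)

/-- The gate only touches wires below `W`, and its wires are distinct. -/
def Valid (a b W : ℕ) : WGate → Prop
  | (0, q, _, _) => q < W
  | (1, _, q, _) => q < W
  | (2, q, _, _) => q < W
  | (3, c, t, _) => c < W ∧ t < W ∧ c ≠ t
  | (4, c, d, t) => c < W ∧ d < W ∧ t < W ∧ c ≠ d ∧ c ≠ t ∧ d ≠ t
  | (5, _, _, _) => a + b ≤ W
  | (6, _, _, _) => a + b ≤ W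
  | _ => False

/-- The gate permutes the computational basis. -/
def Classical (g : WGate) : Prop := 2 ≤ g.1

/-- The query wires: addresses on wires `0, …, a - 1`, data on wires `a, …, a + b - 1`. -/
def queryEmb {a b W : ℕ} (h : a + b ≤ W) : Fin a ⊕ Fin b ↪ Fin W where
  toFun := Sum.elim (fun i => ⟨i, by omega⟩) (fun j => ⟨a + j, by omega⟩)
  inj' := by
    rintro (i | i) (j | j) h <;> simp [Fin.ext_iff] at h ⊢ <;> omega

theorem queryEmb_inl {a b W : ℕ} (h : a + b ≤ W) (i : Fin a) :
    queryEmb h (Sum.inl i : Fin a ⊕ Fin b) = ⟨i, by omega⟩ := rfl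

theorem queryEmb_inr {a b W : ℕ} (h : a + b ≤ W) (j : Fin b) :
    queryEmb h (Sum.inr j : Fin a ⊕ Fin b) = ⟨a + j, by omega⟩ := rfl

/-- The gate on `W + 1` qubits which a valid `WGate` describes. -/
def toQGate (a b W : ℕ) : WGate → QGate a b (Fin (W + 1))
  | (0, q, _, _) => .hadamard (Fin.ofNat _ q)
  | (1, r, q, _) => .phase r (Fin.ofNat _ q)
  | (2, q, _, _) => .pauliX (Fin.ofNat _ q)
  | (3, c, t, _) =>
      if h : Fin.ofNat (W + 1) c ≠ Fin.ofNat (W + 1) t then .cnot _ _ h else .pauliX 0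
  | (4, c, d, t) =>
      if h : Fin.ofNat (W + 1) c ≠ Fin.ofNat (W + 1) d ∧ Fin.ofNat (W + 1) c ≠ Fin.ofNat (W + 1) t ∧
        Fin.ofNat (W + 1) d ≠ Fin.ofNat (W + 1) t
      then .toffoli _ _ _ h.1 h.2.1 h.2.2 else .pauliX 0
  | (5, _, _, _) => if h : a + b ≤ W + 1 then .queryX (queryEmb h) else .pauliX 0
  | (6, _, _, _) => if h : a + b ≤ W + 1 then .queryY (queryEmb h) else .pauliX 0
  | _ => .pauliX 0

/-- The description of a gate by natural numbers. -/
def code (n : ℕ) : WGate → List ℕ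
  | (0, q, _, _) => [0, q]
  | (1, r, q, _) => [1, r, q]
  | (2, q, _, _) => [2, q]
  | (3, c, t, _) => [3, c, t]
  | (4, c, d, t) => [4, c, d, t]
  | (5, _, _, _) => 5 :: List.range n
  | (6, _, _, _) => 6 :: List.range n
  | _ => []

def cost (g : WGate) : ℕ := if g.1 = 1 then g.2.1 + 1 else 1

theorem ofNat_ne {W c t : ℕ} (hc : c < W + 1) (ht : t < W + 1) (h : c ≠ t) :
    Fin.ofNat (W + 1) c ≠ Fin.ofNat (W + 1) t := by
  simp [Fin.ext_iff, Nat.mod_eq_of_lt hc, Nat.mod_eq_of_lt ht, h]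

/-- Case analysis on valid gates. -/
theorem Valid.cases {a b W : ℕ} {P : WGate → Prop} {g : WGate} (hg : Valid a b W g)
    (h0 : ∀ q r s, q < W → P (0, q, r, s)) (h1 : ∀ r q s, q < W → P (1, r, q, s))
    (h2 : ∀ q r s, q < W → P (2, q, r, s))
    (h3 : ∀ c t s, c < W → t < W → c ≠ t → P (3, c, t, s))
    (h4 : ∀ c d t, c < W → d < W → t < W → c ≠ d → c ≠ t → d ≠ t → P (4, c, d, t))
    (h5 : ∀ q r s, a + b ≤ W → P (5, q, r, s)) (h6 : ∀ q r s, a + b ≤ W → P (6, q, r, s)) :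
    P g := by
  obtain ⟨k, p, q, r⟩ := g
  match k, hg with
  | 0, hg => exact h0 _ _ _ hg
  | 1, hg => exact h1 _ _ _ hg
  | 2, hg => exact h2 _ _ _ hg
  | 3, hg => exact h3 _ _ _ hg.1 hg.2.1 hg.2.2
  | 4, hg => exact h4 _ _ _ hg.1 hg.2.1 hg.2.2.1 hg.2.2.2.1 hg.2.2.2.2.1 hg.2.2.2.2.2
  | 5, hg => exact h5 _ _ _ hg
  | 6, hg => exact h6 _ _ _ hg
  | (k + 7), hg => exact absurd hg (by simp [Valid])

theorem code_toQGate {a b W : ℕ} {g : WGate} (hg : Valid a b (W + 1) g) :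
    (toQGate a b W g).code = code (a + b) g := by
  have hr : List.range (a + b) = List.ofFn (fun i : Fin a => (i : ℕ)) ++
      List.ofFn (fun j : Fin b => a + (j : ℕ)) := by
    apply List.ext_getElem
    · simp
    · intro i h1 h2
      simp only [List.getElem_range, List.getElem_append, List.length_ofFn, List.getElem_ofFn]
      split <;> omega
  refine hg.cases (P := fun g => (toQGate a b W g).code = code (a + b) g) ?_ ?_ ?_ ?_ ?_ ?_ ?_
  · intro q _ _ h; simp [toQGate, code, QGate.code, Nat.mod_eq_of_lt h]
  · intro r q _ h; simp [toQGate, code, QGate.code, Nat.mod_eq_of_lt h]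
  · intro q _ _ h; simp [toQGate, code, QGate.code, Nat.mod_eq_of_lt h]
  · intro c t _ hc ht h
    simp only [toQGate, dif_pos (ofNat_ne hc ht h)]
    simp [code, QGate.code, Nat.mod_eq_of_lt hc, Nat.mod_eq_of_lt ht]
  · intro c d t hc hd ht h1 h2 h3
    simp only [toQGate, dif_pos (show _ ∧ _ ∧ _ from
      ⟨ofNat_ne hc hd h1, ofNat_ne hc ht h2, ofNat_ne hd ht h3⟩)]
    simp [code, QGate.code, Nat.mod_eq_of_lt hc, Nat.mod_eq_of_lt hd, Nat.mod_eq_of_lt ht]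
  · intro _ _ _ h
    simp only [toQGate, dif_pos h, code, QGate.code, hr]
    simp [queryEmb_inl, queryEmb_inr]
  · intro _ _ _ h
    simp only [toQGate, dif_pos h, code, QGate.code, hr]
    simp [queryEmb_inl, queryEmb_inr]

theorem cost_toQGate {a b W : ℕ} {g : WGate} (hg : Valid a b (W + 1) g) :
    (toQGate a b W g).cost = cost g := by
  refine hg.cases (P := fun g => (toQGate a b W g).cost = cost g) ?_ ?_ ?_ ?_ ?_ ?_ ?_
  · intros; simp [toQGate, cost, QGate.cost]
  · intros; simp [toQGate, cost, QGate.cost]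
  · intros; simp [toQGate, cost, QGate.cost]
  · intro c t _ hc ht h
    simp [toQGate, dif_pos (ofNat_ne hc ht h), cost, QGate.cost, -Fin.ofNat_eq_cast]
  · intro c d t hc hd ht h1 h2 h3
    simp only [toQGate, dif_pos (show _ ∧ _ ∧ _ from
      ⟨ofNat_ne hc hd h1, ofNat_ne hc ht h2, ofNat_ne hd ht h3⟩)]
    simp [cost, QGate.cost]
  · intro _ _ _ h; simp [toQGate, dif_pos h, cost, QGate.cost]
  · intro _ _ _ h; simp [toQGate, dif_pos h, cost, QGate.cost]

section Semantics

variable {m b : ℕ} (a : ℕ) (X Y : Fin m → Fin b → Bool)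

/-- Action of a query to `S` on basis states. -/
def queryMap (S : Fin m → Fin b → Bool) (x : WBits) : WBits := fun q =>
  xor (x q) (decide (∃ h : wval 0 a x < m, ∃ j : Fin b,
    a + (j : ℕ) = q ∧ S ⟨wval 0 a x, h⟩ j = true))

/-- Action of a classical gate on basis states. -/
def act (g : WGate) (x : WBits) : WBits :=
  match g with
  | (2, q, _, _) => Function.update x q (!x q)
  | (3, c, t, _) => Function.update x t (xor (x t) (x c))
  | (4, c, d, t) => Function.update x t (xor (x t) (x c && x d))
  | (5, _, _, _) => queryMap a X x
  | (6, _, _, _) => queryMap a Y x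
  | _ => x

/-- Action of a gate on state vectors. -/
noncomputable def sem (g : WGate) (ψ : WState) : WState :=
  match g with
  | (0, q, _, _) => fun x => (ψ (Function.update x q false) +
      (if x q then -1 else 1) * ψ (Function.update x q true)) / (Real.sqrt 2 : ℂ)
  | (1, r, q, _) => fun x =>
      (if x q then Complex.exp (2 * Real.pi * Complex.I / 2 ^ r) else 1) * ψ x
  | g => fun x => ψ (act a X Y g x)

end Semantics

end WGate

/-- Extension of an assignment of bits to `W` qubits by zeros. -/
def extBits {W : ℕ} (x : Fin W → Bool) : WBits := fun q => if h : q < W then x ⟨q, h⟩ else false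

theorem extBits_update {W : ℕ} (x : Fin (W + 1) → Bool) {q : ℕ} (hq : q < W + 1) (v : Bool) :
    extBits (Function.update x (Fin.ofNat (W + 1) q) v) = Function.update (extBits x) q v := by
  funext p
  by_cases hp : p < W + 1
  · by_cases hpq : p = q
    · subst hpq; simp [extBits, hp, Function.update_apply, Fin.ext_iff, Nat.mod_eq_of_lt]
    · simp [extBits, hp, Fin.ext_iff, Nat.mod_eq_of_lt hq, hpq]
  · have hpq : p ≠ q := by omega
    simp [extBits, hp, hpq]

theorem extBits_apply {W : ℕ} (x : Fin (W + 1) → Bool) {q : ℕ} (hq : q < W + 1) :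
    extBits x q = x (Fin.ofNat (W + 1) q) := by
  simp only [extBits, hq, dif_pos]
  congr 1
  simp [Fin.ext_iff, Nat.mod_eq_of_lt hq]

theorem extBits_injective {W : ℕ} : Function.Injective (extBits (W := W)) := by
  intro x y h
  funext q
  have := congrFun h q
  simpa [extBits] using this

namespace WGate

variable {m b : ℕ} (a : ℕ) (X Y : Fin m → Fin b → Bool)

theorem queryAddress_emb {W : ℕ} (h : a + b ≤ W + 1) (x : Fin (W + 1) → Bool) :
    queryAddress (queryEmb h) x = wval 0 a (extBits x) := by
  unfold queryAddress wval
  rw [Finset.sum_range]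
  refine Finset.sum_congr rfl fun i _ => ?_
  have hi : (i : ℕ) < W + 1 := by omega
  simp only [extBits, queryEmb_inl, zero_add, dif_pos hi]
  rfl

theorem extBits_queryBasis {W : ℕ} (h : a + b ≤ W + 1) (S : Fin m → Fin b → Bool)
    (x : Fin (W + 1) → Bool) :
    extBits (queryBasis S (queryEmb h) x) = queryMap a S (extBits x) := by
  funext q
  unfold queryMap
  by_cases hq : q < W + 1
  · simp only [extBits, hq, dif_pos, queryBasis]
    congr 1
    simp only [queryAddress_emb]
    refine decide_eq_decide.2 ?_
    simp [queryEmb_inr, Fin.ext_iff]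
  · have hq' : extBits x q = false := by simp [extBits, hq]
    rw [hq']
    simp only [extBits, hq, dif_neg, not_false_eq_true]
    symm
    simp only [Bool.false_xor, decide_eq_false_iff_not]
    rintro ⟨_, j, hj, _⟩
    have := j.2
    omega

/-- A valid gate touches only wires below the register size, so it commutes with extension by zeros.
This moves all later arguments from `Fin (W + 1)` to natural wire numbers. -/
theorem apply_toQGate {W : ℕ} {g : WGate} (hg : Valid a b (W + 1) g) (ψ : WState) :
    (toQGate a b W g).apply X Y (fun x => ψ (extBits x)) =
      fun x => sem a X Y g ψ (extBits x) := by
  refine hg.cases (P := fun g => (toQGate a b W g).apply X Y (fun x => ψ (extBits x)) =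
      fun x => sem a X Y g ψ (extBits x)) ?_ ?_ ?_ ?_ ?_ ?_ ?_
  · intro q _ _ h
    simp only [toQGate, QGate.apply, sem, extBits_update _ h, extBits_apply _ h]
  · intro r q _ h
    simp only [toQGate, QGate.apply, sem, extBits_apply _ h]
  · intro q _ _ h
    simp only [toQGate, QGate.apply, sem, act, extBits_update _ h, extBits_apply _ h]
  · intro c t _ hc ht h
    simp only [toQGate, dif_pos (ofNat_ne hc ht h)]
    simp only [QGate.apply, sem, act, extBits_update _ ht, extBits_apply _ ht, extBits_apply _ hc]
  · intro c d t hc hd ht h1 h2 h3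
    simp only [toQGate, dif_pos (show _ ∧ _ ∧ _ from
      ⟨ofNat_ne hc hd h1, ofNat_ne hc ht h2, ofNat_ne hd ht h3⟩)]
    simp only [QGate.apply, sem, act, extBits_update _ ht, extBits_apply _ ht, extBits_apply _ hc,
      extBits_apply _ hd]
  · intro _ _ _ h
    simp only [toQGate, dif_pos h]
    simp only [QGate.apply, sem, act, extBits_queryBasis]
  · intro _ _ _ h
    simp only [toQGate, dif_pos h]
    simp only [QGate.apply, sem, act, extBits_queryBasis]

end WGate

/-! ### Numbers on wires and sums over blocks of wires -/

theorem wval_succ (B k : ℕ) (x : WBits) :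
    wval B (k + 1) x = wval B k x + if x (B + k) then 2 ^ k else 0 := by
  simp [wval, sum_range_succ]

theorem wval_congr {B k : ℕ} {x y : WBits} (h : ∀ i < k, x (B + i) = y (B + i)) :
    wval B k x = wval B k y :=
  sum_congr rfl fun i hi => by rw [h i (mem_range.1 hi)]

theorem wval_update {B k q : ℕ} (x : WBits) (v : Bool) (h : q < B ∨ B + k ≤ q) :
    wval B k (Function.update x q v) = wval B k x :=
  wval_congr fun i hi => by rw [Function.update_of_ne]; omega

theorem wval_lt (B k : ℕ) (x : WBits) : wval B k x < 2 ^ k := by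
  induction k with
  | zero => simp [wval]
  | succ k ih => rw [wval_succ, pow_succ]; split <;> omega

theorem wval_eq_zero {B k : ℕ} {x : WBits} : wval B k x = 0 ↔ ∀ i < k, x (B + i) = false := by
  simp [wval, sum_eq_zero_iff]

/-- The sum of `f` over all assignments that agree with `x` outside the `k` wires from `B` on. -/
def bsum {M : Type*} [AddCommMonoid M] (B : ℕ) : ℕ → (WBits → M) → WBits → M
  | 0, f, x => f x
  | k + 1, f, x => bsum B k f (Function.update x (B + k) false) +
      bsum B k f (Function.update x (B + k) true)

section bsum

variable {M : Type*} [AddCommMonoid M]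

theorem bsum_update {B k q : ℕ} (f : WBits → M) (x : WBits) (v : Bool) (h : q < B ∨ B + k ≤ q) :
    bsum B k f (Function.update x q v) = bsum B k (fun y => f (Function.update y q v)) x := by
  induction k generalizing x with
  | zero => rfl
  | succ k ih =>
    have hq : q ≠ B + k := by omega
    simp only [bsum]
    rw [Function.update_comm hq, Function.update_comm hq, ih _ (by omega), ih _ (by omega)]

theorem bsum_congr {B k : ℕ} {f g : WBits → M} {x : WBits}
    (h : ∀ y, (∀ q, q < B ∨ B + k ≤ q → y q = x q) → f y = g y) : bsum B k f x = bsum B k g x := by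
  induction k generalizing x with
  | zero => exact h x fun _ _ => rfl
  | succ k ih =>
    simp only [bsum]
    congr 1 <;>
    · refine ih fun y hy => h y fun q hq => ?_
      rw [hy q (by omega), Function.update_of_ne (by omega)]

theorem bsum_congr_left {B k : ℕ} {f : WBits → M} {x y : WBits}
    (h : ∀ q, q < B ∨ B + k ≤ q → y q = x q) : bsum B k f y = bsum B k f x := by
  induction k generalizing x y with
  | zero =>
    have : y = x := funext fun q => h q (by omega)
    rw [this]
  | succ k ih =>
    simp only [bsum]
    congr 1 <;>
    · refine ih fun q hq => ?_
      by_cases hk : q = B + k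
      · subst hk; simp
      · rw [Function.update_of_ne hk, Function.update_of_ne hk, h q (by omega)]

theorem bsum_wval (B k : ℕ) (g : ℕ → M) (x : WBits) :
    bsum B k (fun y => g (wval B k y)) x = ∑ v ∈ range (2 ^ k), g v := by
  induction k generalizing g x with
  | zero => simp [bsum, wval]
  | succ k ih =>
    simp only [bsum]
    rw [bsum_update _ _ _ (by omega), bsum_update _ _ _ (by omega)]
    simp only [wval_succ, wval_update _ _ (show B + k < B ∨ B + k ≤ B + k by omega)]
    rw [show (fun y => g (wval B k y + if Function.update y (B + k) false (B + k) = true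
      then 2 ^ k else 0)) = fun y => g (wval B k y) by simp]
    rw [show (fun y => g (wval B k y + if Function.update y (B + k) true (B + k) = true
      then 2 ^ k else 0)) = fun y => (fun v => g (2 ^ k + v)) (wval B k y) by simp [add_comm]]
    rw [ih, ih (fun v => g (2 ^ k + v)), pow_succ, mul_two, sum_range_add]

theorem bsum_append (B k l : ℕ) (f : WBits → M) (x : WBits) :
    bsum B (k + l) f x = bsum (B + k) l (bsum B k f) x := by
  induction l generalizing x with
  | zero => rfl
  | succ l ih =>
    change bsum B (k + l) f _ + bsum B (k + l) f _ = _
    rw [ih, ih, show B + k.add l = B + k + l from (add_assoc B k l).symm]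
    rfl

/-- A sum all of whose terms with a nonzero bit vanish. -/
theorem bsum_eq_single {B k : ℕ} {f : WBits → M} {x : WBits}
    (h : ∀ y i, i < k → y (B + i) = true → f y = 0) (hx : ∀ i < k, x (B + i) = false) :
    bsum B k f x = f x := by
  induction k generalizing x with
  | zero => rfl
  | succ k ih =>
    simp only [bsum]
    have h0 : Function.update x (B + k) false = x := by
      rw [← hx k (by omega), Function.update_eq_self]
    have h1 : bsum B k f (Function.update x (B + k) true) = 0 := by
      rw [bsum_update _ _ _ (by omega)]
      have : (fun y => f (Function.update y (B + k) true)) = fun _ => 0 :=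
        funext fun y => h _ k (by omega) (by simp)
      rw [this]
      clear ih h0 this
      generalize x = z
      induction k generalizing z with
      | zero => rfl
      | succ k ih =>
        simp only [bsum]
        rw [ih (fun y i hi => h y i (by omega)) (fun i hi => hx i (by omega)),
          ih (fun y i hi => h y i (by omega)) (fun i hi => hx i (by omega)), add_zero]
    rw [h0, h1, add_zero, ih (fun y i hi => h y i (by omega)) (fun i hi => hx i (by omega))]

/-- Together with `bsum_append`, this lets a measurement probability be summed separately over
address, data, counter and work wires. -/
theorem sum_extBits (W : ℕ) (f : WBits → M) :
    ∑ x : Fin W → Bool, f (extBits x) = bsum 0 W f (fun _ => false) := by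
  induction W generalizing f with
  | zero =>
    have : ∀ x : Fin 0 → Bool, extBits x = fun _ => false := by
      intro x; funext q; simp [extBits]
    simp [bsum, this]
  | succ W ih =>
    have key : ∀ (v : Bool) (x : Fin W → Bool),
        extBits (Fin.snoc (α := fun _ => Bool) x v) = Function.update (extBits x) W v := by
      intro v x
      funext q
      rcases lt_trichotomy q W with h | h | h
      · rw [Function.update_of_ne h.ne]
        simp [extBits, h, Nat.lt_succ_of_lt h, Fin.snoc]
      · subst h; simp [extBits, Fin.snoc]
      · rw [Function.update_of_ne h.ne']
        simp [extBits, show ¬ q < W by omega, show ¬ q < W + 1 by omega]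
    rw [← (Fin.snocEquiv (fun _ : Fin (W + 1) => Bool)).sum_comp, Fintype.sum_prod_type]
    simp only [Fin.snocEquiv, Equiv.coe_fn_mk, key, Fintype.sum_bool, bsum, zero_add]
    rw [bsum_update _ _ _ (by omega), bsum_update _ _ _ (by omega), ← ih, ← ih, add_comm]

end bsum

theorem bsum_const_mul {R : Type*} [NonUnitalNonAssocSemiring R] (B k : ℕ) (c : R) (f : WBits → R)
    (x : WBits) : bsum B k (fun y => c * f y) x = c * bsum B k f x := by
  induction k generalizing x with
  | zero => rfl
  | succ k ih => simp only [bsum, ih, mul_add]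

/-! ### Linearity, unitarity and reversal of gate lists -/

namespace WGate

variable {m b : ℕ} (a : ℕ) (X Y : Fin m → Fin b → Bool)

theorem queryMap_queryMap (S : Fin m → Fin b → Bool) (x : WBits) :
    queryMap a S (queryMap a S x) = x := by
  have hv : wval 0 a (queryMap a S x) = wval 0 a x := by
    refine wval_congr fun i hi => ?_
    have : ¬ ∃ h : wval 0 a x < m, ∃ j : Fin b, a + (j : ℕ) = 0 + i ∧
        S ⟨wval 0 a x, h⟩ j = true := by
      rintro ⟨_, j, hj, _⟩; omega
    simp only [queryMap, this, decide_false, Bool.xor_false]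
  funext q
  unfold queryMap at hv ⊢
  simp only [hv, Bool.xor_assoc, Bool.xor_self, Bool.xor_false]

theorem act_act {W : ℕ} {g : WGate} (hg : Valid a b W g) (x : WBits) :
    act a X Y g (act a X Y g x) = x := by
  refine hg.cases (P := fun g => act a X Y g (act a X Y g x) = x) ?_ ?_ ?_ ?_ ?_ ?_ ?_
  · intros; rfl
  · intros; rfl
  · intros; simp [act]
  · intro c t _ _ _ h
    simp [act, Function.update_of_ne h]
  · intro c d t _ _ _ _ h1 h2
    simp [act, Function.update_of_ne h1, Function.update_of_ne h2]
  · intros; exact queryMap_queryMap a X x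
  · intros; exact queryMap_queryMap a Y x

theorem act_of_le {W : ℕ} {g : WGate} (hg : Valid a b W g) (x : WBits) {q : ℕ} (hq : W ≤ q) :
    act a X Y g x q = x q := by
  have hquery : ∀ S : Fin m → Fin b → Bool, a + b ≤ W → queryMap a S x q = x q := by
    intro S hW
    have : ¬ ∃ h : wval 0 a x < m, ∃ j : Fin b, a + (j : ℕ) = q ∧ S ⟨wval 0 a x, h⟩ j = true := by
      rintro ⟨_, j, hj, _⟩; omega
    simp only [queryMap, this, decide_false, Bool.xor_false]
  refine hg.cases (P := fun g => act a X Y g x q = x q) ?_ ?_ ?_ ?_ ?_ ?_ ?_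
  · intros; rfl
  · intros; rfl
  · intro p _ _ h; simp only [act]; rw [Function.update_of_ne]; omega
  · intro c t _ _ h _; simp only [act]; rw [Function.update_of_ne]; omega
  · intro c d t _ _ h _ _ _; simp only [act]; rw [Function.update_of_ne]; omega
  · intro _ _ _ h; exact hquery X h
  · intro _ _ _ h; exact hquery Y h

theorem sem_classical {g : WGate} (hg : Classical g) (ψ : WState) :
    sem a X Y g ψ = fun x => ψ (act a X Y g x) := by
  obtain ⟨k, p⟩ := g
  match k, hg with
  | k + 2, _ => rfl

theorem sem_had (q : ℕ) (ψ : WState) (x : WBits) : sem a X Y (had q) ψ x =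
    (ψ (Function.update x q false) + (if x q then -1 else 1) * ψ (Function.update x q true)) /
      (Real.sqrt 2 : ℂ) := rfl

theorem sem_phase (r q : ℕ) (ψ : WState) (x : WBits) : sem a X Y (phase r q) ψ x =
    (if x q then Complex.exp (2 * Real.pi * Complex.I / 2 ^ r) else 1) * ψ x := rfl

theorem sqrt_two_mul_self : (Real.sqrt 2 : ℂ) * (Real.sqrt 2 : ℂ) = 2 := by
  rw [← Complex.ofReal_mul, Real.mul_self_sqrt (by norm_num)]; simp

theorem sqrt_two_ne_zero : (Real.sqrt 2 : ℂ) ≠ 0 := by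
  simp

theorem sem_had_had (q : ℕ) (ψ : WState) :
    sem a X Y (had q) (sem a X Y (had q) ψ) = ψ := by
  funext x
  simp only [sem_had, Function.update_self, Function.update_idem]
  have h := sqrt_two_mul_self
  have h0 := sqrt_two_ne_zero
  have hx : Function.update x q (x q) = x := Function.update_eq_self q x
  rcases hq : x q <;> rw [hq] at hx <;> simp <;> rw [hx] <;> field_simp <;> rw [pow_two, h] <;> ring

/-- A gate is its own inverse unless it is a phase gate. -/
theorem sem_sem {W : ℕ} {g : WGate} (hg : Valid a b W g) (h1 : g.1 ≠ 1) (ψ : WState) :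
    sem a X Y g (sem a X Y g ψ) = ψ := by
  obtain ⟨k, q, p⟩ := g
  match k, h1 with
  | 0, _ => exact sem_had_had a X Y q ψ
  | k + 2, _ =>
    have hc : Classical (k + 2, q, p) := by simp [Classical]
    rw [sem_classical a X Y hc, sem_classical a X Y hc]
    funext x
    exact congrArg ψ (act_act a X Y hg x)

/-- Gates act linearly. -/
theorem sem_lin (g : WGate) (c d : ℂ) (ψ φ : WState) :
    sem a X Y g (fun x => c * ψ x + d * φ x) =
      fun x => c * sem a X Y g ψ x + d * sem a X Y g φ x := by
  obtain ⟨k, q, p⟩ := g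
  funext x
  match k with
  | 0 => simp only [sem]; ring
  | 1 => simp only [sem]; ring
  | k + 2 => rfl

/-- The action of a list of gates on state vectors; the first gate is applied first. -/
noncomputable def semL (L : List WGate) (ψ : WState) : WState :=
  L.foldl (fun ψ g => sem a X Y g ψ) ψ

/-- The action of a list of classical gates on a basis state. -/
def runL (L : List WGate) (x : WBits) : WBits := L.foldl (fun x g => act a X Y g x) x

theorem semL_nil (ψ : WState) : semL a X Y [] ψ = ψ := rfl

theorem semL_cons (g : WGate) (L : List WGate) (ψ : WState) :
    semL a X Y (g :: L) ψ = semL a X Y L (sem a X Y g ψ) := rfl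

theorem semL_append (L L' : List WGate) (ψ : WState) :
    semL a X Y (L ++ L') ψ = semL a X Y L' (semL a X Y L ψ) := by
  simp [semL]

theorem runL_append (L L' : List WGate) (x : WBits) :
    runL a X Y (L ++ L') x = runL a X Y L' (runL a X Y L x) := by
  simp [runL]

theorem runL_cons (g : WGate) (L : List WGate) (x : WBits) :
    runL a X Y (g :: L) x = runL a X Y L (act a X Y g x) := rfl

theorem semL_lin (L : List WGate) (c d : ℂ) (ψ φ : WState) :
    semL a X Y L (fun x => c * ψ x + d * φ x) =
      fun x => c * semL a X Y L ψ x + d * semL a X Y L φ x := by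
  induction L generalizing ψ φ with
  | nil => rfl
  | cons g L ih => rw [semL_cons, sem_lin, ih]; rfl

/-- A classical gate acts by precomposition, which reverses the order of composition; hence the
reversed list pulls `ψ` back along the forward run. -/
theorem semL_reverse_classical {L : List WGate} (hL : ∀ g ∈ L, Classical g) (ψ : WState)
    (x : WBits) : semL a X Y L.reverse ψ x = ψ (runL a X Y L x) := by
  induction L generalizing x with
  | nil => rfl
  | cons g L ih =>
    rw [List.reverse_cons, semL_append, semL_cons, semL_nil, sem_classical a X Y (hL g (by simp)),
      runL_cons, ← ih (fun g hg => hL g (by simp [hg]))]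

theorem semL_reverse {W : ℕ} {L : List WGate} (hL : ∀ g ∈ L, Valid a b W g ∧ g.1 ≠ 1)
    (ψ : WState) : semL a X Y L.reverse (semL a X Y L ψ) = ψ := by
  induction L generalizing ψ with
  | nil => rfl
  | cons g L ih =>
    rw [List.reverse_cons, semL_append, semL_cons, semL_cons, semL_nil,
      ih (fun g hg => hL g (by simp [hg])), sem_sem a X Y (hL g (by simp)).1 (hL g (by simp)).2]

/-- Compute, flip the sign, uncompute: `phase 1` is `diag(1, -1)`, and conjugation by a classical
circuit turns it into a sign given by the computed bit, leaving no garbage on the work wires. -/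
theorem semL_phase_conj {W : ℕ} {L : List WGate} (hL : ∀ g ∈ L, Valid a b W g ∧ Classical g)
    (o : ℕ) (ψ : WState) (x : WBits) :
    semL a X Y (L ++ [phase 1 o] ++ L.reverse) ψ x =
      (if runL a X Y L x o then -1 else 1) * ψ x := by
  have hL' : ∀ g ∈ L, Valid a b W g ∧ g.1 ≠ 1 := fun g hg =>
    ⟨(hL g hg).1, by have := (hL g hg).2; simp only [Classical] at this; omega⟩
  rw [semL_append, semL_append, semL_reverse_classical a X Y (fun g hg => (hL g hg).2),
    semL_cons, semL_nil, sem_phase]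
  congr 1
  · have : Complex.exp (2 * Real.pi * Complex.I / 2 ^ 1) = -1 := by
      rw [← Complex.exp_pi_mul_I]; congr 1; ring
    rw [this]
  · rw [← semL_reverse_classical a X Y (fun g hg => (hL g hg).2) (semL a X Y L ψ),
      semL_reverse a X Y hL']

/-- Classical gates permute the basis states. -/
theorem sum_act {M : Type*} [AddCommMonoid M] {W : ℕ} {g : WGate} (hg : Valid a b W g)
    (f : WBits → M) :
    ∑ x : Fin W → Bool, f (act a X Y g (extBits x)) = ∑ x : Fin W → Bool, f (extBits x) := by
  have key : ∀ x : Fin W → Bool,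
      extBits (fun q : Fin W => act a X Y g (extBits x) q) = act a X Y g (extBits x) := by
    intro x
    funext q
    by_cases hq : q < W
    · simp [extBits, hq]
    · rw [act_of_le a X Y hg _ (by omega)]; simp [extBits, hq]
  have hinv : Function.Involutive (fun (x : Fin W → Bool) (q : Fin W) =>
      act a X Y g (extBits x) q) := by
    intro x
    apply extBits_injective
    rw [key, key, act_act a X Y hg]
  rw [← Equiv.sum_comp (hinv.toPerm _) (fun x => f (extBits x))]
  refine sum_congr rfl fun x _ => ?_
  rw [Function.Involutive.coe_toPerm, key]

theorem sum_flip {M : Type*} [AddCommMonoid M] {W q : ℕ} (hq : q < W) (f : WBits → M) :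
    ∑ x : Fin W → Bool, f (Function.update (extBits x) q (!extBits x q)) =
      ∑ x : Fin W → Bool, f (extBits x) := by
  have hv : Valid 0 0 W (pauliX q) := hq
  exact sum_act 0 (fun _ : Fin 0 => Fin.elim0) (fun _ => Fin.elim0) hv f

/-- Gates are unitary. -/
theorem sum_norm_sem {W : ℕ} {g : WGate} (hg : Valid a b W g) (ψ : WState) :
    ∑ x : Fin W → Bool, ‖sem a X Y g ψ (extBits x)‖ ^ 2 =
      ∑ x : Fin W → Bool, ‖ψ (extBits x)‖ ^ 2 := by
  obtain ⟨k, q, p⟩ := g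
  match k, hg with
  | 0, hq =>
    have hq' : q < W := hq
    -- The Hadamard gate mixes only the two assignments differing at `q`, where its unitarity is the
    -- parallelogram law. Summing over all assignments counts every such pair twice on both sides.
    have key : ∀ y : WBits, ‖sem a X Y (had q) ψ y‖ ^ 2 +
        ‖sem a X Y (had q) ψ (Function.update y q (!y q))‖ ^ 2 =
        ‖ψ y‖ ^ 2 + ‖ψ (Function.update y q (!y q))‖ ^ 2 := by
      intro y
      simp only [sem_had, Function.update_self, Function.update_idem]
      have h2 : ∀ z : ℂ, ‖z / (Real.sqrt 2 : ℂ)‖ ^ 2 = ‖z‖ ^ 2 / 2 := by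
        intro z
        rw [norm_div, div_pow, Complex.norm_real, Real.norm_eq_abs, sq_abs,
          Real.sq_sqrt (by norm_num)]
      have hpar : ∀ z w : ℂ, ‖z + w‖ ^ 2 + ‖z - w‖ ^ 2 = 2 * (‖z‖ ^ 2 + ‖w‖ ^ 2) := by
        intro z w
        have := parallelogram_law_with_norm ℝ z w
        nlinarith [this]
      have hx : Function.update y q (y q) = y := Function.update_eq_self q y
      rcases hy : y q <;> rw [hy] at hx <;> simp only [hx, h2, Bool.not_true, Bool.not_false] <;>
        simp [← sub_eq_add_neg]
      · linarith [hpar (ψ y) (ψ (Function.update y q true))]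
      · linarith [hpar (ψ (Function.update y q false)) (ψ y)]
    have e1 := sum_flip hq' (fun y => ‖sem a X Y (had q) ψ y‖ ^ 2)
    have e2 := sum_flip hq' (fun y => ‖ψ y‖ ^ 2)
    have e3 := sum_congr (s₁ := (univ : Finset (Fin W → Bool))) rfl fun x _ => key (extBits x)
    rw [sum_add_distrib, sum_add_distrib] at e3
    change ∑ x : Fin W → Bool, ‖sem a X Y (had q) ψ (extBits x)‖ ^ 2 = _
    linarith
  | 1, _ =>
    refine sum_congr rfl fun x _ => ?_
    have : ‖Complex.exp (2 * Real.pi * Complex.I / 2 ^ q)‖ = 1 := by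
      rw [show (2 * Real.pi * Complex.I / 2 ^ q : ℂ) = ((2 * Real.pi / 2 ^ q : ℝ) : ℂ) * Complex.I
        by push_cast; ring]
      exact Complex.norm_exp_ofReal_mul_I _
    simp only [sem, norm_mul]
    split <;> simp [this]
  | k + 2, hg =>
    rw [sem_classical a X Y (by simp [Classical])]
    exact sum_act a X Y hg (fun x => ‖ψ x‖ ^ 2)

theorem sum_norm_semL {W : ℕ} {L : List WGate} (hL : ∀ g ∈ L, Valid a b W g) (ψ : WState) :
    ∑ x : Fin W → Bool, ‖semL a X Y L ψ (extBits x)‖ ^ 2 =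
      ∑ x : Fin W → Bool, ‖ψ (extBits x)‖ ^ 2 := by
  induction L generalizing ψ with
  | nil => rfl
  | cons g L ih =>
    rw [semL_cons, ih (fun g hg => hL g (by simp [hg])), sum_norm_sem a X Y (hL g (by simp))]

/-- Measurement after a classical circuit. -/
theorem sum_norm_runL {W : ℕ} {L : List WGate} (hL : ∀ g ∈ L, Valid a b W g ∧ Classical g)
    (ψ : WState) (P : WBits → Prop) [DecidablePred P] :
    ∑ x : Fin W → Bool, (if P (extBits x) then ‖semL a X Y L ψ (extBits x)‖ ^ 2 else 0) =
      ∑ x : Fin W → Bool, if P (runL a X Y L (extBits x)) then ‖ψ (extBits x)‖ ^ 2 else 0 := by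
  induction L generalizing ψ with
  | nil => rfl
  | cons g L ih =>
    have hg := hL g (by simp)
    rw [semL_cons, ih (fun g hg => hL g (by simp [hg])), sem_classical a X Y hg.2,
      ← sum_act a X Y hg.1 (fun x => if P (runL a X Y L x) then ‖ψ (act a X Y g x)‖ ^ 2 else 0)]
    refine sum_congr rfl fun x _ => ?_
    rw [act_act a X Y hg.1, runL_cons]

end WGate

/-! ### From gate lists to output probabilities -/

namespace OracleCircuit

/-- The oracle circuit on `W + 1` qubits described by a list of gates on numbered wires. -/
def ofWGates (a b W : ℕ) (L : List WGate) (o : ℕ) : OracleCircuit a b where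
  width := W + 1
  gates := L.map (WGate.toQGate a b W)
  out := Fin.ofNat (W + 1) o

variable {m a b W o : ℕ} {L : List WGate}

theorem code_ofWGates (hL : ∀ g ∈ L, g.Valid a b (W + 1)) (ho : o < W + 1) :
    (ofWGates a b W L o).code = (W + 1, o, L.map (WGate.code (a + b))) := by
  simp only [code, ofWGates, List.map_map]
  refine Prod.ext rfl (Prod.ext ?_ ?_)
  · simp [Nat.mod_eq_of_lt ho]
  · exact List.map_congr_left fun g hg => WGate.code_toQGate (hL g hg)

theorem size_ofWGates (hL : ∀ g ∈ L, g.Valid a b (W + 1)) :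
    (ofWGates a b W L o).size = (L.map WGate.cost).sum := by
  simp only [size, ofWGates, List.map_map]
  congr 1
  exact List.map_congr_left fun g hg => WGate.cost_toQGate (hL g hg)

open Classical in
/-- The initial state with all wires zero. -/
noncomputable def zeroState : WState := fun x => if x = (fun _ => false) then 1 else 0

theorem finalState_ofWGates (hL : ∀ g ∈ L, g.Valid a b (W + 1)) (X Y : Fin m → Fin b → Bool) :
    (ofWGates a b W L o).finalState X Y =
      fun x => WGate.semL a X Y L zeroState (extBits x) := by
  have h0 : (fun x : Fin (W + 1) → Bool => if x = (fun _ => false) then (1 : ℂ) else 0) =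
      fun x => zeroState (extBits x) := by
    funext x
    have : extBits (fun _ : Fin (W + 1) => false) = fun _ => false := by funext q; simp [extBits]
    simp only [zeroState, ← this, extBits_injective.eq_iff]
  have key : ∀ ψ : WState, (L.map (WGate.toQGate a b W)).foldl (fun ψ g => g.apply X Y ψ)
      (fun x => ψ (extBits x)) = fun x => WGate.semL a X Y L ψ (extBits x) := by
    clear h0
    induction L with
    | nil => intro ψ; rfl
    | cons g L ih =>
      intro ψ
      rw [List.map_cons, List.foldl_cons, WGate.apply_toQGate a X Y (hL g (by simp)),
        ih (fun g hg => hL g (by simp [hg])), WGate.semL_cons]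
  refine Eq.trans ?_ (key zeroState)
  rw [← h0]
  rfl

theorem outputProb_ofWGates (hL : ∀ g ∈ L, g.Valid a b (W + 1)) (ho : o < W + 1)
    (X Y : Fin m → Fin b → Bool) (v : Bool) :
    (ofWGates a b W L o).outputProb X Y v = ∑ x : Fin (W + 1) → Bool,
      if extBits x o = v then ‖WGate.semL a X Y L zeroState (extBits x)‖ ^ 2 else 0 := by
  simp only [outputProb, finalState_ofWGates hL, extBits_apply _ ho]
  rfl

theorem sum_norm_zeroState (W : ℕ) :
    ∑ x : Fin W → Bool, ‖zeroState (extBits x)‖ ^ 2 = 1 := by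
  have : ∀ x : Fin W → Bool, ‖zeroState (extBits x)‖ ^ 2 =
      if x = fun _ => false then (1 : ℝ) else 0 := by
    intro x
    have h0 : extBits (fun _ : Fin W => false) = fun _ => false := by funext q; simp [extBits]
    simp only [zeroState, ← h0, extBits_injective.eq_iff]
    by_cases hx : x = fun _ => false <;> simp [hx]
  simp [this]

/-- Lets a bound of `1/10` on the wrong answer be read as `9/10` for the right one. -/
theorem outputProb_add (hL : ∀ g ∈ L, g.Valid a b (W + 1)) (ho : o < W + 1)
    (X Y : Fin m → Fin b → Bool) :
    (ofWGates a b W L o).outputProb X Y true + (ofWGates a b W L o).outputProb X Y false = 1 := by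
  rw [outputProb_ofWGates hL ho, outputProb_ofWGates hL ho, ← sum_add_distrib,
    ← sum_norm_zeroState (W + 1), ← WGate.sum_norm_semL a X Y hL zeroState]
  refine sum_congr rfl fun x _ => ?_
  cases extBits x o <;> simp

end OracleCircuit

/-! ### The controlled Grover operator -/

theorem bsum_add {M : Type*} [AddCommMonoid M] (B k : ℕ) (f g : WBits → M) (x : WBits) :
    bsum B k (fun y => f y + g y) x = bsum B k f x + bsum B k g x := by
  induction k generalizing x with
  | zero => rfl
  | succ k ih => simp only [bsum, ih]; abel

/-- Set the `k` wires from `B` on to zero. -/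
def zeroOn (B k : ℕ) (x : WBits) : WBits := fun q => if B ≤ q ∧ q < B + k then false else x q

theorem zeroOn_update (B k : ℕ) (x : WBits) :
    zeroOn B k (Function.update x (B + k) false) = zeroOn B (k + 1) x := by
  funext q
  by_cases hq : q = B + k
  · subst hq; simp [zeroOn]
  · simp only [zeroOn, Function.update_of_ne hq]
    have : (B ≤ q ∧ q < B + k) ↔ (B ≤ q ∧ q < B + (k + 1)) := by omega
    simp only [this]

namespace WGate

variable {m b : ℕ} (a : ℕ) (X Y : Fin m → Fin b → Bool)

/-- Hadamard gates on the `k` wires from `B` on. -/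
def hads (B k : ℕ) : List WGate := (List.range k).map fun i => had (B + i)

theorem hads_succ (B k : ℕ) : hads B (k + 1) = hads B k ++ [had (B + k)] := by
  simp [hads, List.range_succ]

/-- Each Hadamard gate still finds its wire in the zero branch only, so the amplitude is spread
evenly, without signs. -/
theorem semL_hads_of_zero {B k : ℕ} {ψ : WState}
    (h : ∀ x i, i < k → x (B + i) = true → ψ x = 0) (x : WBits) :
    semL a X Y (hads B k) ψ x = ψ (zeroOn B k x) / (Real.sqrt 2 : ℂ) ^ k := by
  induction k generalizing x with
  | zero =>
    have : zeroOn B 0 x = x := by funext q; simp [zeroOn]; omega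
    simp [hads, semL, this]
  | succ k ih =>
    have ih := ih (fun x i hi => h x i (by omega))
    rw [hads_succ, semL_append, semL_cons, semL_nil, sem_had, ih, ih, zeroOn_update,
      h (zeroOn B k (Function.update x (B + k) true)) k (by omega) (by simp [zeroOn])]
    rw [pow_succ]
    simp [div_div]

/-- At an all-zero block every sign in the Hadamard transform is `+1`, so the amplitude there is the
normalized sum over the block: the overlap with the uniform superposition. -/
theorem semL_hads_reverse_at_zero {B k : ℕ} (ψ : WState) {x : WBits}
    (h : ∀ i < k, x (B + i) = false) :
    semL a X Y (hads B k).reverse ψ x = bsum B k ψ x / (Real.sqrt 2 : ℂ) ^ k := by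
  induction k generalizing ψ with
  | zero => simp [hads, semL, bsum]
  | succ k ih =>
    rw [hads_succ, List.reverse_append, semL_append, List.reverse_singleton, semL_cons, semL_nil,
      ih _ (fun i hi => h i (by omega))]
    have : bsum B k (sem a X Y (had (B + k)) ψ) x =
        bsum B k (fun y => (Real.sqrt 2 : ℂ)⁻¹ * (ψ (Function.update y (B + k) false) +
          ψ (Function.update y (B + k) true))) x := by
      refine bsum_congr fun y hy => ?_
      have hy : y (B + k) = false := by rw [hy _ (by omega), h k (by omega)]
      rw [sem_had, hy]
      simp [div_eq_inv_mul]
    rw [this, bsum_const_mul, bsum_add, bsum, bsum_update _ _ _ (by omega),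
      bsum_update _ _ _ (by omega), pow_succ]
    field_simp

theorem hads_valid {B k W : ℕ} (h : B + k ≤ W) : ∀ g ∈ hads B k, Valid a b W g ∧ g.1 ≠ 1 := by
  intro g hg
  obtain ⟨i, hi, rfl⟩ := List.mem_map.1 hg
  rw [List.mem_range] at hi
  exact ⟨show B + i < W by omega, by simp [had]⟩

/-- Hadamard gates on the wires outside a block do not spread a state into the block. -/
theorem semL_hads_reverse_support {B k : ℕ} {P : WBits → Prop}
    (hP : ∀ x q v, B ≤ q → q < B + k → (P (Function.update x q v) ↔ P x)) {ψ : WState}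
    (hψ : ∀ x, ¬ P x → ψ x = 0) {x : WBits} (hx : ¬ P x) :
    semL a X Y (hads B k).reverse ψ x = 0 := by
  induction k generalizing ψ with
  | zero => exact hψ x hx
  | succ k ih =>
    rw [hads_succ, List.reverse_append, semL_append, List.reverse_singleton, semL_cons, semL_nil]
    refine ih (fun x q v h1 h2 => hP x q v h1 (by omega)) fun x hx => ?_
    rw [sem_had, hψ _ (by rwa [hP _ _ _ (by omega) (by omega)]),
      hψ _ (by rwa [hP _ _ _ (by omega) (by omega)])]
    simp

/-- Write `w ∧ i` or `w ∨ i` to the clean wire `o`. -/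
def step (w i o : ℕ) (c : Bool) : List WGate :=
  (if c then [] else [cnot w o, cnot i o]) ++ [toffoli w i o]

/-- Compare the number on the `k` wires from `B` on with `s`, with a carry on the wire `C`; the
result is written to the wire `C + k`. -/
def chain (B C s k : ℕ) : List WGate :=
  (List.range k).flatMap fun i => step (B + i) (C + i) (C + i + 1) (decide (s / 2 ^ i % 2 = 1))

theorem runL_step {w i o : ℕ} (c : Bool) {x : WBits} (hw : w ≠ o) (hi : i ≠ o) (hx : x o = false) :
    runL a X Y (step w i o c) x =
      Function.update x o (if c then x w && x i else x w || x i) := by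
  cases c
  · simp only [step, Bool.false_eq_true, if_false, runL, List.foldl, List.cons_append,
      List.nil_append, act, cnot, toffoli]
    simp only [Function.update_self, Function.update_of_ne hw, Function.update_of_ne hi,
      Function.update_idem, hx]
    congr 1
    cases x w <;> cases x i <;> rfl
  · simp [step, runL, act, toffoli, hx]

theorem chain_succ (B C s k : ℕ) : chain B C s (k + 1) =
    chain B C s k ++ step (B + k) (C + k) (C + k + 1) (decide (s / 2 ^ k % 2 = 1)) := by
  simp [chain, List.range_succ]

/-- Ripple comparison from the least significant bit: the new carry is `bit ∧ carry` if the bit of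
`s` is 1 and `bit ∨ carry` if it is 0. With initial carry 0 this decides `s < value`; with `s = 0`
it is the disjunction of the initial carry and all bits, which serves for the difference and zero
tests. -/
theorem runL_chain {B C k : ℕ} (s : ℕ) {x : WBits} (hB : B + k ≤ C)
    (hx : ∀ i < k, x (C + i + 1) = false) :
    (∀ q, q ≤ C ∨ C + k < q → runL a X Y (chain B C s k) x q = x q) ∧
    runL a X Y (chain B C s k) x (C + k) =
      decide (s % 2 ^ k < wval B k x + (x C).toNat) := by
  induction k with
  | zero =>
    refine ⟨fun q _ => rfl, ?_⟩
    cases hC : x C <;> simp [chain, runL, wval, Nat.mod_one, hC]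
  | succ k ih =>
    obtain ⟨ih1, ih2⟩ := ih (by omega) (fun i hi => hx i (by omega))
    rw [chain_succ, runL_append, runL_step a X Y _ (by omega) (by omega)
      (by rw [ih1 _ (by omega)]; exact hx k (by omega))]
    refine ⟨fun q hq => ?_, ?_⟩
    · rw [Function.update_of_ne (by omega)]
      exact ih1 q (by omega)
    · rw [← add_assoc, Function.update_self, ih2, ih1 _ (by omega), wval_succ, Nat.mod_pow_succ]
      have h1 := wval_lt B k x
      have h2 : s % 2 ^ k < 2 ^ k := Nat.mod_lt _ (by positivity)
      have h3 : (x C).toNat ≤ 1 := Bool.toNat_le _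
      rcases Nat.mod_two_eq_zero_or_one (s / 2 ^ k) with h | h <;> rw [h] <;>
        cases hb : x (B + k) <;> simp <;> omega

theorem step_valid {w i o W : ℕ} (c : Bool) (h1 : w < W) (h2 : i < W) (h3 : o < W) (h4 : w ≠ i)
    (h5 : w ≠ o) (h6 : i ≠ o) : ∀ g ∈ step w i o c, Valid a b W g ∧ Classical g := by
  intro g hg
  cases c <;> simp [step] at hg
  · rcases hg with rfl | rfl | rfl
    · exact ⟨⟨h1, h3, h5⟩, by simp [Classical, cnot]⟩
    · exact ⟨⟨h2, h3, h6⟩, by simp [Classical, cnot]⟩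
    · exact ⟨⟨h1, h2, h3, h4, h5, h6⟩, by simp [Classical, toffoli]⟩
  · rcases hg with rfl
    exact ⟨⟨h1, h2, h3, h4, h5, h6⟩, by simp [Classical, toffoli]⟩

theorem chain_valid {B C s k W : ℕ} (hB : B + k ≤ C) (hW : C + k < W) :
    ∀ g ∈ chain B C s k, Valid a b W g ∧ Classical g := by
  intro g hg
  obtain ⟨i, hi, hg⟩ := List.mem_flatMap.1 hg
  rw [List.mem_range] at hi
  exact step_valid a _ (by omega) (by omega) (by omega) (by omega) (by omega) (by omega) g hg

/-- Compute on the wire `C + b` whether the control wire `c` is off or the data wires hold a nonzero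
word after both queries. -/
def diffTest (a b C c : ℕ) : List WGate :=
  [queryX, queryY, pauliX C, cnot c C] ++ chain a C 0 b

/-- Compute on the wire `C + a` whether the control wire `c` is off or the address is nonzero. -/
def zeroTest (a C c : ℕ) : List WGate :=
  [pauliX C, cnot c C] ++ chain 0 C 0 a

/-- The controlled Grover operator. -/
def grover (a b C c : ℕ) : List WGate :=
  (diffTest a b C c ++ [phase 1 (C + b)] ++ (diffTest a b C c).reverse) ++
    ((hads 0 a).reverse ++ ((zeroTest a C c ++ [phase 1 (C + a)] ++ (zeroTest a C c).reverse) ++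
      hads 0 a))

/-- All data and work wires are zero. -/
def Clean (a b n : ℕ) (x : WBits) : Prop :=
  ∀ q, (a ≤ q ∧ q < a + b) ∨ a + b + n ≤ q → x q = false

/-- The strings differ in position `i`. -/
def diffAt (i : ℕ) : Bool := decide (∃ h : i < m, X ⟨i, h⟩ ≠ Y ⟨i, h⟩)

theorem clean_update {a b n : ℕ} {x : WBits} {q : ℕ} (v : Bool) (hq : q < a) :
    Clean a b n (Function.update x q v) ↔ Clean a b n x := by
  unfold Clean
  refine forall_congr' fun p => imp_congr_right fun hp => ?_
  rw [Function.update_of_ne (by omega)]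

theorem diffTest_valid {n c W : ℕ} (hc : c < a + b + n) (hW : a + b + n + b < W) :
    ∀ g ∈ diffTest a b (a + b + n) c, Valid a b W g ∧ Classical g := by
  intro g hg
  rcases List.mem_append.1 hg with hg | hg
  · simp at hg
    rcases hg with rfl | rfl | rfl | rfl
    · exact ⟨show a + b ≤ W by omega, by simp [Classical, queryX]⟩
    · exact ⟨show a + b ≤ W by omega, by simp [Classical, queryY]⟩
    · exact ⟨show a + b + n < W by omega, by simp [Classical, pauliX]⟩
    · exact ⟨⟨by omega, by omega, by omega⟩, by simp [Classical, cnot]⟩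
  · exact chain_valid a (by omega) (by omega) g hg

theorem zeroTest_valid {n c W : ℕ} (hc : c < a + b + n) (hW : a + b + n + a < W) :
    ∀ g ∈ zeroTest a (a + b + n) c, Valid a b W g ∧ Classical g := by
  intro g hg
  rcases List.mem_append.1 hg with hg | hg
  · simp at hg
    rcases hg with rfl | rfl
    · exact ⟨show a + b + n < W by omega, by simp [Classical, pauliX]⟩
    · exact ⟨⟨by omega, by omega, by omega⟩, by simp [Classical, cnot]⟩
  · exact chain_valid a (by omega) (by omega) g hg

theorem phase_valid {r q W : ℕ} (h : q < W) : Valid a b W (phase r q) := h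

theorem grover_valid {n c W : ℕ} (hc : c < a + b + n) (hW : a + b + n + a + b < W) :
    ∀ g ∈ grover a b (a + b + n) c, Valid a b W g := by
  intro g hg
  simp only [grover, List.mem_append, List.mem_reverse, List.mem_singleton] at hg
  have h1 := diffTest_valid a (b := b) (W := W) hc (by omega) g
  have h2 := zeroTest_valid a (b := b) (W := W) hc (by omega) g
  have h3 := hads_valid a (b := b) (B := 0) (k := a) (W := W) (by omega) g
  rcases hg with ((hg | rfl) | hg) | hg | ((hg | rfl) | hg) | hg
  · exact (h1 hg).1
  · exact phase_valid a (by omega)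
  · exact (h1 hg).1
  · exact (h3 hg).1
  · exact (h2 hg).1
  · exact phase_valid a (by omega)
  · exact (h2 hg).1
  · exact (h3 hg).1

theorem queryMap_of_not {S : Fin m → Fin b → Bool} {x : WBits} {q : ℕ} (hq : q < a ∨ a + b ≤ q) :
    queryMap a S x q = x q := by
  have : ¬ ∃ h : wval 0 a x < m, ∃ j : Fin b, a + (j : ℕ) = q ∧ S ⟨wval 0 a x, h⟩ j = true := by
    rintro ⟨_, j, hj, _⟩; omega
  simp only [queryMap, this, decide_false, Bool.xor_false]

theorem queryMap_data {S : Fin m → Fin b → Bool} {x : WBits} (h : wval 0 a x < m) (j : Fin b) :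
    queryMap a S x (a + j) = xor (x (a + j)) (S ⟨_, h⟩ j) := by
  simp only [queryMap]
  congr 1
  rw [Bool.eq_iff_iff, decide_eq_true_iff]
  constructor
  · rintro ⟨_, i, hi, hS⟩
    have : i = j := Fin.ext (by omega)
    rwa [this] at hS
  · exact fun hS => ⟨h, j, rfl, hS⟩

theorem queryMap_of_le {S : Fin m → Fin b → Bool} {x : WBits} (h : m ≤ wval 0 a x) :
    queryMap a S x = x := by
  have : ¬ wval 0 a x < m := by omega
  funext q
  simp [queryMap, this]

theorem wval_queryMap {S : Fin m → Fin b → Bool} {x : WBits} :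
    wval 0 a (queryMap a S x) = wval 0 a x :=
  wval_congr fun i hi => queryMap_of_not a (by omega)

/-- The two queries leave `X i ⊕ Y i` on the clean data wires, which is nonzero exactly when the
symbols differ, and zero for an address beyond `m`. The negated control enters as the initial carry
of the disjunction. -/
theorem runL_diffTest {n c : ℕ} {x : WBits} (hx : Clean a b n x) (hc : a + b ≤ c)
    (hc' : c < a + b + n) : runL a X Y (diffTest a b (a + b + n) c) x (a + b + n + b) =
      (diffAt X Y (wval 0 a x) || !x c) := by
  set C := a + b + n with hC
  set x1 := queryMap a Y (queryMap a X x) with hx1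
  have hout : ∀ q, q < a ∨ a + b ≤ q → x1 q = x q := fun q hq => by
    rw [hx1, queryMap_of_not a hq, queryMap_of_not a hq]
  set x3 := Function.update x1 C (!x c) with hx3
  have hrun : runL a X Y (diffTest a b C c) x = runL a X Y (chain a C 0 b) x3 := by
    rw [diffTest, runL_append]
    congr 1
    simp only [runL, List.foldl, queryX, queryY, pauliX, cnot, act]
    rw [← hx1, Function.update_self, Function.update_of_ne (by omega), Function.update_idem,
      hout C (by omega), hout c (by omega), hx C (by omega)]
    simp [hx3]
  rw [hrun, (runL_chain a X Y 0 (by omega) ?_).2]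
  · have h3 : x3 C = !x c := by simp [hx3]
    have hw : wval a b x3 = wval a b x1 := wval_update _ _ (by omega)
    have hz : 0 < wval a b x1 ↔ diffAt X Y (wval 0 a x) = true := by
      rw [Nat.pos_iff_ne_zero, ne_eq, wval_eq_zero, diffAt, decide_eq_true_iff, not_iff_comm]
      by_cases hm : wval 0 a x < m
      · have hd : ∀ j : Fin b, x1 (a + j) = xor (X ⟨_, hm⟩ j) (Y ⟨_, hm⟩ j) := by
          intro j
          have h2 : wval 0 a (queryMap a X x) < m := by rwa [wval_queryMap]
          rw [hx1, queryMap_data a h2, queryMap_data a hm, hx _ (by omega), Bool.false_xor]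
          simp only [wval_queryMap]
        constructor
        · intro h i hi
          have hXY : X ⟨_, hm⟩ = Y ⟨_, hm⟩ := by
            by_contra hne; exact h ⟨hm, hne⟩
          have := hd ⟨i, hi⟩
          simpa [hXY] using this
        · rintro h ⟨_, hne⟩
          refine hne (funext fun j => ?_)
          have := hd j
          rw [h j j.2] at this
          revert this
          cases X ⟨_, hm⟩ j <;> cases Y ⟨_, hm⟩ j <;> simp
      · constructor
        · intro _ i hi
          rw [hx1, queryMap_of_le a (by rw [wval_queryMap]; omega), queryMap_of_le a (by omega)]
          exact hx _ (by omega)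
        · rintro _ ⟨h, _⟩
          exact hm h
    rw [h3, hw, Nat.zero_mod, Bool.eq_iff_iff, decide_eq_true_iff, Bool.or_eq_true, ← hz]
    cases x c <;> simp
  · intro i hi
    rw [hx3, Function.update_of_ne (by omega), hout _ (by omega), hx _ (by omega)]

theorem runL_zeroTest {n c : ℕ} {x : WBits} (hx : Clean a b n x) (hc : a + b ≤ c)
    (hc' : c < a + b + n) : runL a X Y (zeroTest a (a + b + n) c) x (a + b + n + a) =
      (decide (0 < wval 0 a x) || !x c) := by
  set C := a + b + n with hC
  set x3 := Function.update x C (!x c) with hx3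
  have hrun : runL a X Y (zeroTest a C c) x = runL a X Y (chain 0 C 0 a) x3 := by
    rw [zeroTest, runL_append]
    congr 1
    simp only [runL, List.foldl, pauliX, cnot, act]
    rw [Function.update_self, Function.update_of_ne (by omega), Function.update_idem,
      hx C (by omega)]
    simp [hx3]
  rw [hrun, (runL_chain a X Y 0 (by omega) ?_).2]
  · have h3 : x3 C = !x c := by simp [hx3]
    have hw : wval 0 a x3 = wval 0 a x := wval_update _ _ (by omega)
    rw [h3, hw, Nat.zero_mod, Bool.eq_iff_iff, decide_eq_true_iff, Bool.or_eq_true,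
      decide_eq_true_iff]
    cases x c <;> simp
  · intro i hi
    rw [hx3, Function.update_of_ne (by omega), hx _ (by omega)]

/-- The reflection part of the Grover operator. -/
theorem semL_diffusion {n c : ℕ} {ψ : WState} (hψ : ∀ x, ¬ Clean a b n x → ψ x = 0)
    (hc : a + b ≤ c) (hc' : c < a + b + n) :
    (∀ x, ¬ Clean a b n x → semL a X Y ((hads 0 a).reverse ++ ((zeroTest a (a + b + n) c ++
      [phase 1 (a + b + n + a)] ++ (zeroTest a (a + b + n) c).reverse) ++ hads 0 a)) ψ x = 0) ∧
    (∀ x, Clean a b n x → semL a X Y ((hads 0 a).reverse ++ ((zeroTest a (a + b + n) c ++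
      [phase 1 (a + b + n + a)] ++ (zeroTest a (a + b + n) c).reverse) ++ hads 0 a)) ψ x =
        - ψ x + if x c then 2 * (bsum 0 a ψ x / 2 ^ a) else 0) := by
  set φ := semL a X Y (hads 0 a).reverse ψ with hφ
  have hφ0 : ∀ x, ¬ Clean a b n x → φ x = 0 := fun x hx =>
    semL_hads_reverse_support a X Y (P := Clean a b n)
      (fun x q v _ h => clean_update v (by omega)) hψ hx
  -- `P` is the part of `φ` with control on and address zero. The phase flip is then `-1 + 2P`;
  -- conjugated by Hadamard gates it is `2|u⟩⟨u| - 1` (`u` uniform) when the control is on and `-1`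
  -- when it is off.
  set P : WState := fun x => if x c ∧ wval 0 a x = 0 then φ x else 0 with hP
  have hflip : semL a X Y (zeroTest a (a + b + n) c ++ [phase 1 (a + b + n + a)] ++
      (zeroTest a (a + b + n) c).reverse) φ = fun x => (-1) * φ x + 2 * P x := by
    funext x
    rw [semL_phase_conj a X Y (zeroTest_valid a (W := a + b + n + a + 1) hc' (by omega))]
    by_cases hx : Clean a b n x
    · rw [runL_zeroTest a X Y hx hc hc']
      by_cases h1 : wval 0 a x = 0
      · cases h2 : x c
        · simp [hP, h1, h2]
        · simp [hP, h1, h2]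
          ring
      · simp [hP, h1, Nat.pos_of_ne_zero h1]
    · have : P x = 0 := by simp [hP, hφ0 x hx]
      rw [hφ0 x hx, this]; simp
  have hback : semL a X Y (hads 0 a) φ = ψ := by
    have := semL_reverse a X Y (W := a + b) (L := (hads 0 a).reverse)
      (fun g hg => hads_valid a (by omega) g (List.mem_reverse.1 hg)) ψ
    rwa [List.reverse_reverse] at this
  have hPz : ∀ x i, i < a → x (0 + i) = true → P x = 0 := by
    intro x i hi hx
    have : wval 0 a x ≠ 0 := fun h => by
      rw [wval_eq_zero.1 h i hi] at hx; exact Bool.noConfusion hx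
    simp [hP, this]
  have hcz : ∀ x, zeroOn 0 a x c = x c := fun x => by
    simp only [zeroOn]; rw [if_neg (by omega)]
  have hcl : ∀ x, Clean a b n (zeroOn 0 a x) ↔ Clean a b n x := fun x => by
    unfold Clean
    refine forall_congr' fun q => imp_congr_right fun hq => ?_
    simp only [zeroOn]; rw [if_neg (by omega)]
  have hwz : ∀ x, wval 0 a (zeroOn 0 a x) = 0 := fun x =>
    wval_eq_zero.2 fun i hi => by simp [zeroOn, hi]
  have hmain : ∀ x, semL a X Y ((hads 0 a).reverse ++ ((zeroTest a (a + b + n) c ++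
      [phase 1 (a + b + n + a)] ++ (zeroTest a (a + b + n) c).reverse) ++ hads 0 a)) ψ x =
      -ψ x + 2 * (P (zeroOn 0 a x) / (Real.sqrt 2 : ℂ) ^ a) := by
    intro x
    rw [semL_append, semL_append, ← hφ, hflip, semL_lin, hback]
    simp only [semL_hads_of_zero a X Y hPz]
    ring
  refine ⟨fun x hx => ?_, fun x hx => ?_⟩
  · rw [hmain, hψ x hx]
    have : P (zeroOn 0 a x) = 0 := by
      simp only [hP, hφ0 _ (fun h => hx ((hcl x).1 h)), ite_self]
    simp [this]
  · rw [hmain]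
    congr 1
    have hφz : φ (zeroOn 0 a x) = bsum 0 a ψ x / (Real.sqrt 2 : ℂ) ^ a := by
      rw [hφ, semL_hads_reverse_at_zero a X Y ψ (fun i hi => by simp [zeroOn, hi])]
      congr 1
      refine bsum_congr_left fun q hq => ?_
      simp only [zeroOn]; rw [if_neg (by omega)]
    have h2 : (2 : ℂ) ^ a = (Real.sqrt 2 : ℂ) ^ a * (Real.sqrt 2 : ℂ) ^ a := by
      rw [← mul_pow, sqrt_two_mul_self]
    cases hxc : x c
    · simp [hP, hcz, hxc]
    · simp only [hP, hcz, hxc, hwz, and_self, if_true, hφz, h2, div_div]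

/-- The amplitudes of the marked and of the unmarked positions after `t` Grover iterations on the
uniform superposition, up to normalization; `p` is the fraction of marked positions. -/
noncomputable def groverAmp (p : ℝ) : ℕ → ℝ × ℝ
  | 0 => (1, 1)
  | t + 1 => (2 * ((1 - p) * (groverAmp p t).2 - p * (groverAmp p t).1) + (groverAmp p t).1,
      2 * ((1 - p) * (groverAmp p t).2 - p * (groverAmp p t).1) - (groverAmp p t).2)

/-- The amplitude at position `i` after `t` iterations, up to normalization. -/
noncomputable def posAmp (p : ℝ) (t i : ℕ) : ℝ :=
  if diffAt X Y i then (groverAmp p t).1 else (groverAmp p t).2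

/-- `ψ` vanishes unless the data and work wires are zero, and carries on the address wires the
result of `l` Grover iterations, where `l` depends on the other wires. -/
def IsGroverState (n : ℕ) (p : ℝ) (κ : ℂ) (l : WBits → ℕ) (ψ : WState) : Prop :=
  (∀ x, ¬ Clean a b n x → ψ x = 0) ∧
    ∀ x, Clean a b n x → ψ x = κ * posAmp X Y p (l x) (wval 0 a x)

/-- The `δ_H` marked addresses all lie below `m`, so among the `2 ^ a` addresses they have fraction
`δ_H / 2 ^ a`, whatever the padding. -/
theorem sum_diffAt {K : Type*} [Field K] [CharZero K] (u v : K) (hm : m ≤ 2 ^ a) :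
    ∑ i ∈ range (2 ^ a), (if diffAt X Y i then u else v) =
      2 ^ a * ((hammingDist X Y / 2 ^ a : K) * u + (1 - (hammingDist X Y / 2 ^ a : K)) * v) := by
  have hcard : ∑ i ∈ range (2 ^ a), (if diffAt X Y i then (1 : K) else 0) = hammingDist X Y := by
    have h1 : ∀ i ∈ range (2 ^ a), i ∉ range m → (if diffAt X Y i then (1 : K) else 0) = 0 := by
      intro i _ hi
      rw [if_neg]
      simp only [diffAt, decide_eq_true_iff]
      rintro ⟨h, _⟩
      exact hi (mem_range.2 h)
    rw [← sum_subset (range_subset_range.2 hm) h1, sum_range]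
    simp only [diffAt, hammingDist, card_filter, Nat.cast_sum]
    refine sum_congr rfl fun i _ => ?_
    by_cases h : X i = Y i <;> simp [h]
  have h2 : ∀ i, (if diffAt X Y i then u else v) =
      (if diffAt X Y i then (1 : K) else 0) * (u - v) + v := by
    intro i; split <;> ring
  simp only [h2]
  rw [sum_add_distrib, ← sum_mul, hcard]
  have : (2 : K) ^ a ≠ 0 := pow_ne_zero _ two_ne_zero
  simp
  field_simp
  ring

/-- With control off both reflections contribute `-1`, and the signs cancel. With control on, marked
amplitudes change sign and everything is then reflected about the mean, which is the recursion of
`groverAmp`. Since `l` ignores the address wires, the iteration count is constant in the sum that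
forms the mean. -/
theorem isGroverState_grover {n c : ℕ} {κ : ℂ} {l : WBits → ℕ} {ψ : WState} (hm : m ≤ 2 ^ a)
    (hl : ∀ x y : WBits, (∀ q, a ≤ q → x q = y q) → l x = l y)
    (h : IsGroverState a X Y n (hammingDist X Y / 2 ^ a) κ l ψ)
    (hc : a + b ≤ c) (hc' : c < a + b + n) :
    IsGroverState a X Y n (hammingDist X Y / 2 ^ a) κ (fun x => l x + (x c).toNat)
      (semL a X Y (grover a b (a + b + n) c) ψ) := by
  obtain ⟨h0, h1⟩ := h
  set p : ℝ := hammingDist X Y / 2 ^ a with hp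
  set φ := semL a X Y (diffTest a b (a + b + n) c ++ [phase 1 (a + b + n + b)] ++
    (diffTest a b (a + b + n) c).reverse) ψ with hφ
  have hφx : ∀ x, φ x = (if runL a X Y (diffTest a b (a + b + n) c) x (a + b + n + b)
      then -1 else 1) * ψ x := fun x =>
    semL_phase_conj a X Y (diffTest_valid a (W := a + b + n + b + 1) hc' (by omega)) _ _ _
  have hφ0 : ∀ x, ¬ Clean a b n x → φ x = 0 := fun x hx => by rw [hφx, h0 x hx, mul_zero]
  have hφ1 : ∀ x, Clean a b n x → φ x = (if diffAt X Y (wval 0 a x) || !x c then -1 else 1) *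
      (κ * posAmp X Y p (l x) (wval 0 a x)) := fun x hx => by
    rw [hφx, h1 x hx, runL_diffTest a X Y hx hc hc']
  obtain ⟨g0, g1⟩ := semL_diffusion a X Y hφ0 hc hc'
  rw [grover, semL_append, ← hφ]
  refine ⟨g0, fun x hx => ?_⟩
  rw [g1 x hx, hφ1 x hx]
  beta_reduce
  cases hxc : x c
  · simp
  · have hsum : bsum 0 a φ x = 2 ^ a * (κ * ((p : ℂ) * (-((groverAmp p (l x)).1 : ℂ)) +
        (1 - p) * (groverAmp p (l x)).2)) := by
      have : bsum 0 a φ x = bsum 0 a (fun y => κ * (if diffAt X Y (wval 0 a y) then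
          (-((groverAmp p (l x)).1 : ℂ)) else (groverAmp p (l x)).2)) x := by
        refine bsum_congr fun y hy => ?_
        have hy' : ∀ q, a ≤ q → y q = x q := fun q hq => hy q (by omega)
        have hyc : Clean a b n y := fun q hq => by rw [hy' q (by omega)]; exact hx q hq
        rw [hφ1 y hyc, hl y x hy', hy' c (by omega), hxc]
        cases hd : diffAt X Y (wval 0 a y) <;> simp [posAmp, hd]
      rw [this, bsum_const_mul, bsum_wval 0 a (fun v => if diffAt X Y v then
        (-((groverAmp p (l x)).1 : ℂ)) else (groverAmp p (l x)).2), sum_diffAt a X Y _ _ hm, hp]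
      push_cast
      ring
    have h2 : (2 : ℂ) ^ a ≠ 0 := pow_ne_zero _ two_ne_zero
    rw [hsum, if_pos rfl, mul_div_cancel_left₀ _ h2]
    simp only [Bool.not_true, Bool.or_false, Bool.toNat_true, posAmp]
    cases hd : diffAt X Y (wval 0 a x)
    · simp [groverAmp]; ring
    · simp [groverAmp]; ring

end WGate

/-! ### The iteration counter and the quantum Fourier transform -/

/-- The complex number `exp (2 π i r)`. -/
noncomputable def cis (r : ℝ) : ℂ := Complex.exp (2 * Real.pi * Complex.I * r)

theorem cis_add (r s : ℝ) : cis (r + s) = cis r * cis s := by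
  rw [cis, cis, cis, ← Complex.exp_add]; push_cast; congr 1; ring

theorem cis_natCast (n : ℕ) : cis n = 1 := by
  rw [cis, Complex.exp_eq_one_iff]; exact ⟨n, by push_cast; ring⟩

theorem cis_zero : cis 0 = 1 := by simpa using cis_natCast 0

theorem cis_one : cis 1 = 1 := by simpa using cis_natCast 1

theorem cis_half : cis (1 / 2) = -1 := by
  rw [cis, ← Complex.exp_pi_mul_I]; congr 1; push_cast; ring

theorem cis_neg_one : cis (-1) = 1 := by
  have := cis_add (-1) 1
  rwa [neg_add_cancel, cis_zero, cis_one, mul_one, eq_comm] at this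

/-- The number in binary on the `k` wires from `B` on, the most significant bit first. -/
def tval (B : ℕ) : ℕ → WBits → ℕ
  | 0, _ => 0
  | k + 1, x => 2 * tval B k x + (x (B + k)).toNat

theorem tval_congr {B k : ℕ} {x y : WBits} (h : ∀ i < k, x (B + i) = y (B + i)) :
    tval B k x = tval B k y := by
  induction k with
  | zero => rfl
  | succ k ih => simp only [tval]; rw [ih fun i hi => h i (by omega), h k (by omega)]

theorem bsum_tval {M : Type*} [AddCommMonoid M] (B k : ℕ) (g : ℕ → M) (x : WBits) :
    bsum B k (fun y => g (tval B k y)) x = ∑ v ∈ range (2 ^ k), g v := by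
  induction k generalizing g x with
  | zero => simp [bsum, tval]
  | succ k ih =>
    have h : ∀ v, bsum B k (fun y => g (tval B (k + 1) y)) (Function.update x (B + k) v) =
        ∑ t ∈ range (2 ^ k), g (2 * t + v.toNat) := by
      intro v
      rw [← ih (fun t => g (2 * t + v.toNat)) (Function.update x (B + k) v)]
      refine bsum_congr fun y hy => ?_
      rw [tval, hy (B + k) (by omega), Function.update_self]
    rw [bsum, h, h, pow_succ]
    have h2 : ∀ N, ∑ v ∈ range (N * 2), g v =
        ∑ t ∈ range N, g (2 * t + 0) + ∑ t ∈ range N, g (2 * t + 1) := by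
      intro N
      induction N with
      | zero => simp
      | succ N ihN =>
        rw [show (N + 1) * 2 = N * 2 + 1 + 1 by ring, sum_range_succ, sum_range_succ, ihN,
          sum_range_succ, sum_range_succ, mul_comm N 2]
        simp only [add_zero]
        abel
    exact (h2 _).symm

namespace WGate

variable {m b : ℕ} (a : ℕ) (X Y : Fin m → Fin b → Bool)

theorem sem_phase_cis (r q : ℕ) (ψ : WState) (x : WBits) : sem a X Y (phase r q) ψ x =
    (if x q then cis (1 / 2 ^ r) else 1) * ψ x := by
  rw [sem_phase, cis]; push_cast; rw [mul_one_div]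

/-- Grover iterations, their number being given in binary on the `n` wires from `a + b` on. -/
def groverPowers (a b n : ℕ) : List WGate :=
  (List.range n).flatMap fun i => (List.range (2 ^ (n - 1 - i))).flatMap fun _ =>
    grover a b (a + b + n) (a + b + i)

/-- Wire `a + b + i` controls `2 ^ (n - 1 - i)` iterations, its weight with the most significant bit
first. The count is thus `tval`, in the bit order that `qft` expects. -/
theorem isGroverState_groverPowers {n : ℕ} {κ : ℂ} {ψ : WState} (hm : m ≤ 2 ^ a)
    (h : IsGroverState a X Y n (hammingDist X Y / 2 ^ a) κ (fun _ => 0) ψ) :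
    IsGroverState a X Y n (hammingDist X Y / 2 ^ a) κ (tval (a + b) n)
      (semL a X Y (groverPowers a b n) ψ) := by
  have key : ∀ k ≤ n, IsGroverState a X Y n (hammingDist X Y / 2 ^ a) κ
      (fun x => 2 ^ (n - k) * tval (a + b) k x) (semL a X Y ((List.range k).flatMap fun i =>
        (List.range (2 ^ (n - 1 - i))).flatMap fun _ => grover a b (a + b + n) (a + b + i)) ψ) := by
    intro k
    induction k with
    | zero => intro _; simpa [semL, tval] using h
    | succ k ih =>
      intro hk
      rw [List.range_succ, List.flatMap_append, semL_append, List.flatMap_singleton]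
      have inner : ∀ j, IsGroverState a X Y n (hammingDist X Y / 2 ^ a) κ
          (fun x => 2 ^ (n - k) * tval (a + b) k x + j * (x (a + b + k)).toNat)
          (semL a X Y ((List.range j).flatMap fun _ => grover a b (a + b + n) (a + b + k))
            (semL a X Y ((List.range k).flatMap fun i => (List.range (2 ^ (n - 1 - i))).flatMap
              fun _ => grover a b (a + b + n) (a + b + i)) ψ)) := by
        intro j
        induction j with
        | zero => simpa [semL_nil] using ih (by omega)
        | succ j ihj =>
          rw [List.range_succ, List.flatMap_append, semL_append, List.flatMap_singleton]
          have := isGroverState_grover a X Y (c := a + b + k) hm (fun x y hxy => ?_) ihj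
            (by omega) (by omega)
          · simpa only [add_mul, one_mul, add_assoc] using this
          · rw [tval_congr fun i _ => hxy _ (by omega), hxy _ (by omega)]
      have := inner (2 ^ (n - 1 - k))
      convert this using 2 with x
      rw [tval, show n - k = (n - 1 - k) + 1 by omega, show n - (k + 1) = n - 1 - k by omega]
      ring
  simpa [groverPowers] using key n le_rfl

theorem groverPowers_valid {n W : ℕ} (hW : a + b + n + a + b < W) :
    ∀ g ∈ groverPowers a b n, Valid a b W g := by
  intro g hg
  obtain ⟨i, hi, hg⟩ := List.mem_flatMap.1 hg
  obtain ⟨_, _, hg⟩ := List.mem_flatMap.1 hg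
  rw [List.mem_range] at hi
  exact grover_valid a (by omega) hW g hg

theorem isGroverState_init (n : ℕ) (p : ℝ) : IsGroverState a X Y n p
    (1 / (Real.sqrt 2 : ℂ) ^ (a + n)) (fun _ => 0)
    (semL a X Y (hads 0 a ++ hads (a + b) n) OracleCircuit.zeroState) := by
  have h0 : ∀ x : WBits, x ≠ (fun _ => false) → OracleCircuit.zeroState x = 0 := fun x hx => by
    simp [OracleCircuit.zeroState, hx]
  have h1 : ∀ x, semL a X Y (hads 0 a) OracleCircuit.zeroState x =
      OracleCircuit.zeroState (zeroOn 0 a x) / (Real.sqrt 2 : ℂ) ^ a := fun x =>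
    semL_hads_of_zero a X Y (fun x i _ hx => h0 x fun h => by simp [h] at hx) x
  have h2 : ∀ x, semL a X Y (hads 0 a ++ hads (a + b) n) OracleCircuit.zeroState x =
      OracleCircuit.zeroState (zeroOn 0 a (zeroOn (a + b) n x)) /
        (Real.sqrt 2 : ℂ) ^ (a + n) := fun x => by
    rw [semL_append, semL_hads_of_zero a X Y, h1, div_div, pow_add]
    intro x i hi hx
    rw [h1, h0, zero_div]
    intro h
    have := congrFun h (a + b + i)
    simp only [zeroOn] at this
    rw [if_neg (by omega), hx] at this
    exact Bool.noConfusion this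
  have h3 : ∀ x, zeroOn 0 a (zeroOn (a + b) n x) = (fun _ => false) ↔ Clean a b n x := by
    intro x
    rw [funext_iff]
    refine forall_congr' fun q => ?_
    simp only [zeroOn]
    split_ifs with hq hq'
    · simp; omega
    · simp; omega
    · simp [show (a ≤ q ∧ q < a + b) ∨ a + b + n ≤ q by omega]
  refine ⟨fun x hx => ?_, fun x hx => ?_⟩
  · rw [h2, h0 _ fun h => hx ((h3 x).1 h), zero_div]
  · rw [h2, (h3 x).2 hx]
    simp [OracleCircuit.zeroState, posAmp, groverAmp]

/-- The controlled phase gate of angle `2 π / 2 ^ r`. -/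
def cphase (r c t : ℕ) : List WGate :=
  [phase (r + 1) c, phase (r + 1) t, cnot c t] ++
    ((List.range (r + 1)).map fun i => phase (i + 1) t) ++ [cnot c t]

/-- The gate set has no inverse phases for general `r`. Since `1/2 + ⋯ + 1/2 ^ k = 1 - 1/2 ^ k`, a
product of positive ones gives the inverse. -/
theorem semL_phases (k t : ℕ) (ψ : WState) (x : WBits) :
    semL a X Y ((List.range k).map fun i => phase (i + 1) t) ψ x =
      (if x t then cis (-(1 / 2 ^ k)) else 1) * ψ x := by
  induction k with
  | zero => simp [semL, cis_neg_one]
  | succ k ih =>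
    rw [List.range_succ, List.map_append, semL_append, List.map_singleton, semL_cons, semL_nil,
      sem_phase_cis, ih, ← mul_assoc]
    congr 1
    split
    · rw [← cis_add]; congr 1; rw [pow_succ]; field_simp; norm_num
    · simp

/-- Rests on `2 x y = x + y - (x ⊕ y)` for bits: each term carries the angle of `phase (r + 1)`, the
last one inverted and applied while `t` holds the parity. -/
theorem semL_cphase {r c t : ℕ} (h : c ≠ t) (ψ : WState) (x : WBits) :
    semL a X Y (cphase r c t) ψ x =
      (if x c && x t then cis (1 / 2 ^ r) else 1) * ψ x := by
  have hcn : ∀ (ψ : WState) (x : WBits), sem a X Y (cnot c t) ψ x =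
    ψ (Function.update x t (xor (x t) (x c))) := fun _ _ => rfl
  rw [cphase, semL_append, semL_append, semL_cons, semL_nil, hcn, semL_phases, semL_cons,
    semL_cons, semL_cons, semL_nil, hcn, sem_phase_cis, sem_phase_cis]
  have e1 : cis (1 / 2 ^ (r + 1)) * cis (1 / 2 ^ (r + 1)) = cis (1 / 2 ^ r) := by
    rw [← cis_add]; congr 1; rw [pow_succ]; field_simp; norm_num
  have e2 : cis (-(1 / 2 ^ (r + 1))) * cis (1 / 2 ^ (r + 1)) = 1 := by
    rw [← cis_add, neg_add_cancel, cis_zero]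
  simp only [Function.update_self, Function.update_of_ne h, Function.update_idem, Bool.xor_assoc,
    Bool.xor_self, Bool.xor_false, Function.update_eq_self]
  simp only [one_div] at e1 e2 ⊢
  cases x c <;> cases x t <;> simp
  · rw [← mul_assoc, e2, one_mul]
  · rw [← mul_assoc, e2, one_mul]
  · rw [← mul_assoc, e1]

theorem cphase_valid {r c t W : ℕ} (hc : c < W) (ht : t < W) (h : c ≠ t) :
    ∀ g ∈ cphase r c t, Valid a b W g := by
  intro g hg
  simp only [cphase, List.mem_append, List.mem_cons, List.mem_map, List.not_mem_nil,
    or_false] at hg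
  rcases hg with ((rfl | rfl | rfl) | ⟨i, _, rfl⟩) | rfl
  · exact hc
  · exact ht
  · exact ⟨hc, ht, h⟩
  · exact ht
  · exact ⟨hc, ht, h⟩

/-- The quantum Fourier transform. The input has its most significant bit, and the output its least
significant bit, on the wire `B`. -/
def qft (B n : ℕ) : List WGate :=
  (List.range n).flatMap fun i =>
    ((List.range i).flatMap fun l => cphase (i - l + 1) (B + l) (B + i)) ++ [had (B + i)]

theorem qft_valid {B n W : ℕ} (hW : B + n ≤ W) : ∀ g ∈ qft B n, Valid a b W g := by
  intro g hg
  obtain ⟨i, hi, hg⟩ := List.mem_flatMap.1 hg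
  rw [List.mem_range] at hi
  rcases List.mem_append.1 hg with hg | hg
  · obtain ⟨l, hl, hg⟩ := List.mem_flatMap.1 hg
    rw [List.mem_range] at hl
    exact cphase_valid a (by omega) (by omega) (by omega) g hg
  · rw [List.mem_singleton.1 hg]
    exact (show B + i < W by omega)

theorem semL_cphases (B i k : ℕ) (hk : k ≤ i) (ψ : WState) (x : WBits) :
    semL a X Y ((List.range k).flatMap fun l => cphase (i - l + 1) (B + l) (B + i)) ψ x =
      (if x (B + i) then cis (wval B k x / 2 ^ (i + 1)) else 1) * ψ x := by
  induction k with
  | zero => simp [semL, wval, cis_zero]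
  | succ k ih =>
    rw [List.range_succ, List.flatMap_append, semL_append, List.flatMap_singleton,
      semL_cphase a X Y (by omega), ih (by omega), ← mul_assoc, wval_succ]
    congr 1
    cases x (B + i) <;> cases x (B + k) <;> simp
    rw [← cis_add]
    congr 1
    rw [show i + 1 = (i - k + 1) + k by omega, pow_add]
    field_simp
    ring

/-- Induction on the last wire, which holds the least significant input bit and the most significant
output bit. Opposite bit orders for input and output remove the need for final swaps. -/
theorem semL_qft (B k : ℕ) (ψ : WState) (x : WBits) : semL a X Y (qft B k) ψ x =
    bsum B k (fun y => cis (tval B k y * wval B k x / 2 ^ k) * ψ y) x /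
      (Real.sqrt 2 : ℂ) ^ k := by
  induction k generalizing x with
  | zero => simp [qft, semL, bsum, tval, cis_zero]
  | succ k ih =>
    have hq : qft B (k + 1) = qft B k ++
        (((List.range k).flatMap fun l => cphase (k - l + 1) (B + l) (B + k)) ++
          [had (B + k)]) := by
      rw [qft, qft, List.range_succ, List.flatMap_append, List.flatMap_singleton]
    rw [hq, semL_append, semL_append, semL_cons, semL_nil, sem_had,
      semL_cphases a X Y B k k le_rfl, semL_cphases a X Y B k k le_rfl, ih, ih]
    have hw : ∀ v, wval B k (Function.update x (B + k) v) = wval B k x := fun v =>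
      wval_update _ _ (by omega)
    rw [hw, hw, Function.update_self, Function.update_self, bsum]
    have hF : ∀ v, bsum B k (fun y => cis (tval B (k + 1) y * wval B (k + 1) x / 2 ^ (k + 1)) * ψ y)
        (Function.update x (B + k) v) = cis (v.toNat * wval B (k + 1) x / 2 ^ (k + 1)) *
        bsum B k (fun y => cis (tval B k y * wval B k x / 2 ^ k) * ψ y)
          (Function.update x (B + k) v) := by
      intro v
      rw [← bsum_const_mul]
      refine bsum_congr fun y hy => ?_
      have hy : y (B + k) = v := by rw [hy _ (by omega), Function.update_self]
      rw [← mul_assoc, ← cis_add, tval, hy]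
      congr 1
      -- Expanding `(2T + v)(w + 2 ^ k x) / 2 ^ (k+1)` leaves the smaller transform, the phase of
      -- the new input bit, and the integer `T x`, on which `cis` is trivial.
      have : ((2 * tval B k y + v.toNat : ℕ) * wval B (k + 1) x / 2 ^ (k + 1) : ℝ) =
          v.toNat * wval B (k + 1) x / 2 ^ (k + 1) + tval B k y * wval B k x / 2 ^ k +
            (tval B k y * (x (B + k)).toNat : ℕ) := by
        rw [wval_succ]
        cases x (B + k) <;> push_cast <;> simp [pow_succ] <;> field_simp <;> ring
      rw [this, cis_add _ ((_ : ℕ) : ℝ), cis_natCast, mul_one]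
    rw [hF, hF]
    have hs : cis (wval B (k + 1) x / 2 ^ (k + 1)) =
        (if x (B + k) then -1 else 1) * cis (wval B k x / 2 ^ (k + 1)) := by
      rw [wval_succ]
      cases x (B + k)
      · simp
      · have : ((wval B k x + 2 ^ k : ℕ) / 2 ^ (k + 1) : ℝ) = 1 / 2 + wval B k x / 2 ^ (k + 1) := by
          push_cast; rw [pow_succ]; field_simp; ring
        simp only [if_true]
        rw [this, cis_add, cis_half]
    simp only [Bool.toNat_false, Bool.toNat_true, Nat.cast_zero, Nat.cast_one, zero_mul, zero_div,
      cis_zero, one_mul, Bool.false_eq_true, if_false, if_true, hs]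
    rw [pow_succ (Real.sqrt 2 : ℂ), ← div_div]
    congr 1
    ring

end WGate

/-! ### The decider and the distribution of its counter -/

theorem bsum_zero {M : Type*} [AddCommMonoid M] {B k : ℕ} {f : WBits → M} {x : WBits}
    (h : ∀ y, (∀ q, q < B ∨ B + k ≤ q → y q = x q) → f y = 0) : bsum B k f x = 0 := by
  have h0 : ∀ z : WBits, bsum B k (fun _ => (0 : M)) z = 0 := by
    intro z
    clear h
    induction k generalizing z with
    | zero => rfl
    | succ k ih => simp only [bsum, ih, add_zero]
  rw [bsum_congr (g := fun _ => 0) h, h0]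

namespace WGate

variable {m b : ℕ} (a : ℕ) (X Y : Fin m → Fin b → Bool)

/-- Write to the wire `C + 2 * n + 1` whether none or both of the thresholds `s`, `s'` are exceeded
by the number on the `n` wires from `B` on. -/
def windowTest (B C n s s' : ℕ) : List WGate :=
  chain B C s n ++ (chain B (C + n + 1) s' n ++
    [cnot (C + n) (C + 2 * n + 1), pauliX (C + 2 * n + 1)])

/-- None or both of the thresholds `s`, `s'` are exceeded. -/
def inWindow (n s s' y : ℕ) : Bool := !(xor (decide (s' % 2 ^ n < y)) (decide (s % 2 ^ n < y)))

theorem windowTest_valid {B C n s s' W : ℕ} (hB : B + n ≤ C) (hW : C + 2 * n + 1 < W) :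
    ∀ g ∈ windowTest B C n s s', Valid a b W g ∧ Classical g := by
  intro g hg
  simp only [windowTest, List.mem_append, List.mem_cons, List.not_mem_nil, or_false] at hg
  rcases hg with hg | hg | rfl | rfl
  · exact chain_valid a hB (by omega) g hg
  · exact chain_valid a (by omega) (by omega) g hg
  · exact ⟨⟨by omega, by omega, by omega⟩, by simp [Classical, cnot]⟩
  · exact ⟨show C + 2 * n + 1 < W by omega, by simp [Classical, pauliX]⟩

theorem runL_windowTest {B C n : ℕ} (s s' : ℕ) {x : WBits} (hB : B + n ≤ C)
    (hx : ∀ q, C ≤ q → x q = false) :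
    runL a X Y (windowTest B C n s s') x (C + 2 * n + 1) = inWindow n s s' (wval B n x) := by
  rw [windowTest, runL_append, runL_append]
  obtain ⟨h1, h2⟩ := runL_chain a X Y s (x := x) hB fun i _ => hx _ (by omega)
  set x1 := runL a X Y (chain B C s n) x
  obtain ⟨h3, h4⟩ := runL_chain a X Y s' (x := x1) (B := B) (C := C + n + 1) (k := n) (by omega)
    fun i hi => by rw [h1 _ (by omega)]; exact hx _ (by omega)
  set x2 := runL a X Y (chain B (C + n + 1) s' n) x1
  have hw : wval B n x1 = wval B n x := wval_congr fun i hi => h1 _ (by omega)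
  rw [hx C le_rfl] at h2
  rw [h1 _ (by omega), hx _ (by omega), hw, show C + n + 1 + n = C + 2 * n + 1 by ring] at h4
  simp only [runL, List.foldl, cnot, pauliX, act, Function.update_self]
  rw [h4, h3 _ (by omega), h2]
  simp [inWindow]

/-- The gates of the decider. -/
def deciderGates (a b n s s' : ℕ) : List WGate :=
  (((hads 0 a ++ hads (a + b) n) ++ groverPowers a b n) ++ qft (a + b) n) ++
    windowTest (a + b) (a + b + n) n s s'

/-- The number of qubits of the decider, minus one. -/
def deciderWidth (a b n : ℕ) : ℕ := (a + b + n) + 2 * n + 1 + a + b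

theorem deciderGates_valid (n s s' : ℕ) :
    ∀ g ∈ deciderGates a b n s s', Valid a b (deciderWidth a b n + 1) g := by
  intro g hg
  simp only [deciderGates, List.mem_append] at hg
  rcases hg with (((hg | hg) | hg) | hg) | hg
  · exact (hads_valid a (by simp only [deciderWidth]; omega) g hg).1
  · exact (hads_valid a (by simp only [deciderWidth]; omega) g hg).1
  · exact groverPowers_valid a (by simp only [deciderWidth]; omega) g hg
  · exact qft_valid a (by simp only [deciderWidth]; omega) g hg
  · exact (windowTest_valid a le_rfl (by simp only [deciderWidth]; omega) g hg).1

/-- The Fourier transform of a sequence of real amplitudes. -/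
noncomputable def fourierAmp (n y : ℕ) (f : ℕ → ℝ) : ℂ :=
  ∑ t ∈ range (2 ^ n), cis (t * y / 2 ^ n) * f t

theorem norm_sqrt_two_pow (k : ℕ) (z : ℂ) :
    ‖z / (Real.sqrt 2 : ℂ) ^ k‖ ^ 2 = ‖z‖ ^ 2 / 2 ^ k := by
  rw [norm_div, norm_pow, Complex.norm_real, Real.norm_eq_abs, abs_of_nonneg (Real.sqrt_nonneg 2),
    div_pow, ← pow_mul, mul_comm k 2, pow_mul, Real.sq_sqrt (by norm_num)]

/-- The state before the window test. -/
theorem norm_decider_state {n : ℕ} (hm : m ≤ 2 ^ a) :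
    let ψ := semL a X Y (((hads 0 a ++ hads (a + b) n) ++ groverPowers a b n) ++ qft (a + b) n)
      OracleCircuit.zeroState
    (∀ x, ¬ Clean a b n x → ψ x = 0) ∧ ∀ x, Clean a b n x → ‖ψ x‖ ^ 2 =
      ‖fourierAmp n (wval (a + b) n x)
        (fun t => posAmp X Y (hammingDist X Y / 2 ^ a) t (wval 0 a x))‖ ^ 2 / 2 ^ (a + n + n) := by
  intro ψ
  have hT : ∀ x y : WBits, (∀ q, q < a + b ∨ a + b + n ≤ q → y q = x q) →
      (Clean a b n y ↔ Clean a b n x) := fun x y hxy =>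
    forall_congr' fun q => imp_congr_right fun hq => by rw [hxy q (by omega)]
  obtain ⟨h0, h1⟩ := isGroverState_groverPowers a X Y hm
    (isGroverState_init a X Y n (hammingDist X Y / 2 ^ a))
  refine ⟨fun x hx => ?_, fun x hx => ?_⟩
  · simp only [ψ]
    rw [semL_append, semL_qft, bsum_zero, zero_div]
    intro y hy
    rw [semL_append, h0 y (fun h => hx ((hT x y hy).1 h)), mul_zero]
  · simp only [ψ]
    rw [semL_append, semL_qft, semL_append]
    have : bsum (a + b) n (fun y => cis (tval (a + b) n y * wval (a + b) n x / 2 ^ n) *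
        semL a X Y (groverPowers a b n)
          (semL a X Y (hads 0 a ++ hads (a + b) n) OracleCircuit.zeroState) y) x =
        fourierAmp n (wval (a + b) n x)
          (fun t => posAmp X Y (hammingDist X Y / 2 ^ a) t (wval 0 a x)) /
          (Real.sqrt 2 : ℂ) ^ (a + n) := by
      rw [fourierAmp, ← bsum_tval (a + b) n (fun t => cis (t * wval (a + b) n x / 2 ^ n) *
        (posAmp X Y (hammingDist X Y / 2 ^ a) t (wval 0 a x) : ℂ)) x, div_eq_inv_mul,
        ← bsum_const_mul]
      refine bsum_congr fun y hy => ?_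
      rw [h1 y ((hT x y hy).2 hx),
        wval_congr (B := 0) (k := a) (y := x) fun i hi => hy _ (by omega)]
      ring
    rw [this, div_div, ← pow_add, norm_sqrt_two_pow]

/-- The probability that the Fourier transformed iteration counter is `y`. -/
noncomputable def counterProb (p : ℝ) (n y : ℕ) : ℝ :=
  (p * ‖fourierAmp n y (fun t => (groverAmp p t).1)‖ ^ 2 +
    (1 - p) * ‖fourierAmp n y (fun t => (groverAmp p t).2)‖ ^ 2) / 2 ^ (n + n)

theorem sum_posAmp {n y : ℕ} (p : ℝ) (hm : m ≤ 2 ^ a) (hp : p = hammingDist X Y / 2 ^ a) :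
    ∑ i ∈ range (2 ^ a), ‖fourierAmp n y (fun t => posAmp X Y p t i)‖ ^ 2 / 2 ^ (a + n + n) =
      counterProb p n y := by
  have : ∀ i, ‖fourierAmp n y (fun t => posAmp X Y p t i)‖ ^ 2 / 2 ^ (a + n + n) =
      (if diffAt X Y i then ‖fourierAmp n y (fun t => (groverAmp p t).1)‖ ^ 2 / 2 ^ (a + n + n)
      else ‖fourierAmp n y (fun t => (groverAmp p t).2)‖ ^ 2 / 2 ^ (a + n + n)) := by
    intro i
    simp only [posAmp]
    split <;> rfl
  simp only [this]
  rw [sum_diffAt a X Y _ _ hm, counterProb, ← hp, add_assoc, pow_add 2 a]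
  have : (2 : ℝ) ^ a ≠ 0 := by positivity
  field_simp

end WGate

open WGate in
-- The window test is classical, so measuring its result amounts to testing the counter beforehand.
-- At that point data and work wires are zero with certainty, and summing over addresses leaves the
-- marginal law of the counter.
theorem OracleCircuit.outputProb_decider {m a b : ℕ} (X Y : Fin m → Fin b → Bool) (n s s' : ℕ)
    (hm : m ≤ 2 ^ a) (v : Bool) :
    (ofWGates a b (deciderWidth a b n) (deciderGates a b n s s')
      (a + b + n + 2 * n + 1)).outputProb X Y v =
    ∑ y ∈ range (2 ^ n), if inWindow n s s' y = v then
      counterProb (hammingDist X Y / 2 ^ a) n y else 0 := by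
  rw [outputProb_ofWGates (deciderGates_valid a n s s') (by simp only [deciderWidth]; omega),
    deciderGates]
  simp only [semL_append a X Y _ (windowTest _ _ _ _ _)]
  rw [sum_norm_runL a X Y (windowTest_valid a le_rfl (by simp only [deciderWidth]; omega)) _
    (fun x => x (a + b + n + 2 * n + 1) = v)]
  obtain ⟨h0, h1⟩ := norm_decider_state a X Y (n := n) hm
  set ψ := semL a X Y (((hads 0 a ++ hads (a + b) n) ++ groverPowers a b n) ++ qft (a + b) n)
      zeroState
  set p : ℝ := hammingDist X Y / 2 ^ a with hp
  set f : WBits → ℝ := fun x => if runL a X Y (windowTest (a + b) (a + b + n) n s s') x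
    (a + b + n + 2 * n + 1) = v then ‖ψ x‖ ^ 2 else 0 with hf
  have hf0 : ∀ x, ¬ Clean a b n x → f x = 0 := fun x hx => by simp [hf, h0 x hx]
  have hf1 : ∀ x, Clean a b n x → f x = if inWindow n s s' (wval (a + b) n x) = v then
      ‖fourierAmp n (wval (a + b) n x) (fun t => posAmp X Y p t (wval 0 a x))‖ ^ 2 /
        2 ^ (a + n + n) else 0 := fun x hx => by
    rw [hf]
    beta_reduce
    rw [runL_windowTest a X Y s s' le_rfl fun q hq => hx q (Or.inr hq), h1 x hx]
  rw [sum_extBits (deciderWidth a b n + 1) f,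
    show deciderWidth a b n + 1 = a + b + n + (2 * n + 1 + a + b + 1) by
      simp only [deciderWidth]; ring,
    bsum_append, bsum_eq_single, bsum_append, zero_add]
  · rw [← bsum_wval (a + b) n (fun y => if inWindow n s s' y = v then counterProb p n y else 0)
      (fun _ => false)]
    refine bsum_congr fun y hy => ?_
    have hyc : Clean a b n y := fun q hq => by rw [hy q (by omega)]
    rw [bsum_append, zero_add, bsum_eq_single]
    · rw [← sum_posAmp a X Y p hm hp, ← bsum_wval 0 a (fun i => ‖fourierAmp n (wval (a + b) n y)
        (fun t => posAmp X Y p t i)‖ ^ 2 / 2 ^ (a + n + n)) y]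
      have hz : ∀ z : WBits, (∀ q, q < 0 ∨ 0 + a ≤ q → z q = y q) → f z =
          if inWindow n s s' (wval (a + b) n y) = v then
            ‖fourierAmp n (wval (a + b) n y) (fun t => posAmp X Y p t (wval 0 a z))‖ ^ 2 /
              2 ^ (a + n + n) else 0 := fun z hz => by
        rw [hf1 z fun q hq => by rw [hz q (by omega)]; exact hyc q hq,
          wval_congr (B := a + b) (k := n) (y := y) fun i hi => hz _ (by omega)]
      rw [bsum_congr hz]
      split
      · rfl
      · exact bsum_zero fun _ _ => rfl
    · intro z i hi hzi
      refine bsum_zero fun w hw => hf0 w fun h => ?_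
      have := h (a + i) (by omega)
      rw [hw _ (by omega), hzi] at this
      exact Bool.noConfusion this
    · intro i hi
      exact hyc _ (by omega)
  · intro z i hi hzi
    refine bsum_zero fun w hw => hf0 w fun h => ?_
    have := h (a + b + n + i) (by omega)
    rw [hw _ (by omega)] at this
    rw [zero_add] at hzi
    rw [hzi] at this
    exact Bool.noConfusion this
  · intros; rfl

/-! ### Concentration of the counter -/

theorem norm_cis (r : ℝ) : ‖cis r‖ = 1 := by
  rw [cis, show (2 * Real.pi * Complex.I * r : ℂ) = ((2 * Real.pi * r : ℝ) : ℂ) * Complex.I by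
    push_cast; ring]
  exact Complex.norm_exp_ofReal_mul_I _

theorem cis_nat_mul (t : ℕ) (r : ℝ) : cis (t * r) = cis r ^ t := by
  rw [cis, cis, ← Complex.exp_nat_mul]; push_cast; congr 1; ring

theorem norm_cis_sub_one (r : ℝ) : ‖cis r - 1‖ = 2 * |Real.sin (Real.pi * r)| := by
  rw [cis, show (2 * Real.pi * Complex.I * r : ℂ) = Complex.I * ((2 * Real.pi * r : ℝ) : ℂ) by
    push_cast; ring, Complex.norm_exp_I_mul_ofReal_sub_one, norm_mul, Real.norm_eq_abs,
    Real.norm_eq_abs, abs_of_pos (by norm_num : (0 : ℝ) < 2)]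
  congr 3
  ring

/-- The squared modulus of a normalized geometric sum. -/
noncomputable def kern (N : ℕ) (γ : ℝ) : ℝ := ‖∑ t ∈ range N, cis (t * γ / N)‖ ^ 2 / N ^ 2

theorem kern_add_period {N : ℕ} (hN : 0 < N) (γ : ℝ) : kern N (γ + N) = kern N γ := by
  have : ∀ t : ℕ, cis (t * (γ + N) / N) = cis (t * γ / N) := by
    intro t
    have hN' : (N : ℝ) ≠ 0 := by positivity
    rw [show (t * (γ + N) / N : ℝ) = t * γ / N + t by field_simp, cis_add, cis_natCast, mul_one]
  simp only [kern, this]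

/-- The geometric sum is at most `1 / sin (π γ / N)`, and `sin (π v) ≥ 2 v` for `v ≤ 1/2`. Taking
for `N v` the smaller of `γ` and `N - γ` gives one of the two terms; keeping both avoids a case
split later. -/
theorem kern_le {N : ℕ} {γ : ℝ} (h0 : 0 < γ) (h1 : γ < N) :
    kern N γ ≤ 1 / 4 * (1 / γ ^ 2) + 1 / 4 * (1 / (N - γ) ^ 2) := by
  have hN : (0 : ℝ) < N := h0.trans h1
  set u := γ / N with hu
  have hu0 : 0 < u := div_pos h0 hN
  have hu1 : u < 1 := (div_lt_one hN).2 h1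
  have hγ : γ = N * u := by rw [hu]; field_simp
  have hsin : 0 < Real.sin (Real.pi * u) :=
    Real.sin_pos_of_pos_of_lt_pi (by positivity) (by nlinarith [Real.pi_pos])
  have hne : cis u ≠ 1 := by
    intro h
    have := norm_cis_sub_one u
    rw [h, sub_self, norm_zero, abs_of_pos hsin] at this
    linarith
  have hgeom : ‖∑ t ∈ range N, cis (t * γ / N)‖ ≤ 1 / Real.sin (Real.pi * u) := by
    have : ∀ t ∈ range N, cis (t * γ / N) = cis u ^ t := fun t _ => by
      rw [← cis_nat_mul, hu, mul_div_assoc]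
    rw [sum_congr rfl this, geom_sum_eq hne, norm_div, norm_cis_sub_one, abs_of_pos hsin,
      div_le_div_iff₀ (by positivity) hsin]
    have : ‖cis u ^ N - 1‖ ≤ 2 := by
      refine (norm_sub_le _ _).trans ?_
      rw [norm_pow, norm_cis, one_pow, norm_one]; norm_num
    nlinarith
  have hk : kern N γ ≤ 1 / (N * Real.sin (Real.pi * u)) ^ 2 := by
    rw [kern, mul_pow, mul_comm ((N : ℝ) ^ 2), ← div_div]
    gcongr
    calc ‖∑ t ∈ range N, cis (t * γ / N)‖ ^ 2 ≤ (1 / Real.sin (Real.pi * u)) ^ 2 := by gcongr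
      _ = _ := by rw [div_pow, one_pow]
  have key : ∀ v : ℝ, 0 < v → v ≤ 1 / 2 → Real.sin (Real.pi * u) = Real.sin (Real.pi * v) →
      kern N γ ≤ 1 / 4 * (1 / (N * v) ^ 2) := by
    intro v hv0 hv1 hv
    have h2 : 2 * v ≤ Real.sin (Real.pi * u) := by
      rw [hv]
      have := Real.mul_le_sin (x := Real.pi * v) (by positivity) (by nlinarith [Real.pi_pos])
      have e : 2 / Real.pi * (Real.pi * v) = 2 * v := by field_simp
      rwa [e] at this
    refine hk.trans ?_
    rw [show 1 / 4 * (1 / (N * v) ^ 2) = 1 / (N * (2 * v)) ^ 2 by field_simp; norm_num]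
    gcongr
  have hp1 : 0 ≤ 1 / 4 * (1 / γ ^ 2) := by positivity
  have hp2 : 0 ≤ 1 / 4 * (1 / (N - γ) ^ 2) := by positivity
  rcases le_total u (1 / 2) with h | h
  · have := key u hu0 h rfl
    rw [← hγ] at this
    linarith
  · have := key (1 - u) (by linarith) (by linarith) (by
      rw [mul_sub, mul_one, Real.sin_pi_sub])
    rw [mul_sub, mul_one, ← hγ] at this
    linarith

/-- Telescoping, from `1 / x² ≤ 1 / (x - 1) - 1 / x`. -/
theorem sum_inv_sq_le {g : ℝ} (hg : 1 < g) {γ : ℝ} (hγ : g ≤ γ) (c : ℕ) :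
    ∑ i ∈ range c, 1 / (γ + i) ^ 2 ≤ 1 / (g - 1) := by
  have key : ∑ i ∈ range c, 1 / (γ + i) ^ 2 ≤ 1 / (γ - 1) - 1 / (γ + c - 1) := by
    induction c with
    | zero => simp
    | succ c ih =>
      rw [sum_range_succ]
      have hc : (0 : ℝ) ≤ c := Nat.cast_nonneg c
      have h1 : 0 < γ + c - 1 := by linarith
      have h2 : 0 < γ + c := by linarith
      have : 1 / (γ + c) ^ 2 ≤ 1 / (γ + c - 1) - 1 / (γ + (c + 1 : ℕ) - 1) := by
        push_cast
        rw [show γ + (c + 1 : ℝ) - 1 = γ + c by ring, div_sub_div _ _ h1.ne' h2.ne',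
          div_le_div_iff₀ (by positivity) (by positivity)]
        nlinarith
      linarith
  have h1 : 0 ≤ 1 / (γ + c - 1) := by
    have hc : (0 : ℝ) ≤ c := Nat.cast_nonneg c
    apply one_div_nonneg.2; linarith
  have h2 : 1 / (γ - 1) ≤ 1 / (g - 1) := one_div_le_one_div_of_le (by linarith) (by linarith)
  linarith

/-- The hypotheses place all points of the progression at distance at least `g` from both `0` and
`N`. The second tail is summed from the far end. -/
theorem sum_kern_le {N c : ℕ} {g γ : ℝ} (hg : 1 < g) (h1 : g ≤ γ) (h2 : γ + c + g ≤ N + 1) :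
    ∑ i ∈ range c, kern N (γ + i) ≤ 1 / 2 * (1 / (g - 1)) := by
  have hk : ∀ i ∈ range c, kern N (γ + i) ≤
      1 / 4 * (1 / (γ + i) ^ 2) + 1 / 4 * (1 / (N - (γ + i)) ^ 2) := by
    intro i hi
    have : (i : ℝ) + 1 ≤ c := by exact_mod_cast mem_range.1 hi
    have hi0 : (0 : ℝ) ≤ i := Nat.cast_nonneg i
    exact kern_le (by linarith) (by linarith)
  refine (sum_le_sum hk).trans ?_
  rw [sum_add_distrib, ← mul_sum, ← mul_sum]
  have e1 := sum_inv_sq_le hg h1 c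
  have e2 := sum_inv_sq_le hg (γ := N - γ - c + 1) (by linarith) c
  have e3 : ∑ i ∈ range c, 1 / ((N : ℝ) - (γ + i)) ^ 2 =
      ∑ i ∈ range c, 1 / (N - γ - c + 1 + i) ^ 2 := by
    rw [← sum_range_reflect]
    refine sum_congr rfl fun i hi => ?_
    have := mem_range.1 hi
    rw [show c - 1 - i = c - (i + 1) by omega, Nat.cast_sub (by omega)]
    push_cast
    congr 2
    ring
  rw [e3]
  linarith

namespace WGate

/-- Addition formulas for a rotation by `2θ`. Stated without division, so that `sin θ = 0` and `cos
θ = 0` need no separate treatment. -/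
theorem groverAmp_trig (θ : ℝ) (t : ℕ) :
    Real.sin θ * (groverAmp (Real.sin θ ^ 2) t).1 = Real.sin ((2 * t + 1) * θ) ∧
    Real.cos θ * (groverAmp (Real.sin θ ^ 2) t).2 = Real.cos ((2 * t + 1) * θ) := by
  induction t with
  | zero => simp [groverAmp]
  | succ t ih =>
    obtain ⟨h1, h2⟩ := ih
    have e : ((2 * (t + 1 : ℕ) + 1 : ℝ) * θ) = (2 * t + 1) * θ + 2 * θ := by push_cast; ring
    rw [e, Real.sin_add, Real.cos_add, ← h1, ← h2, Real.sin_two_mul, Real.cos_two_mul', groverAmp]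
    have hc : 1 - Real.sin θ ^ 2 = Real.cos θ ^ 2 := by linarith [Real.sin_sq_add_cos_sq θ]
    simp only [hc]
    generalize (groverAmp (Real.sin θ ^ 2) t).1 = u
    generalize (groverAmp (Real.sin θ ^ 2) t).2 = v
    constructor
    · linear_combination (-(Real.sin θ) * u) * Real.sin_sq_add_cos_sq θ
    · linear_combination ( (Real.cos θ) * v) * Real.sin_sq_add_cos_sq θ

theorem norm_smul_fourierAmp (n y : ℕ) (c : ℝ) (f : ℕ → ℝ) :
    c ^ 2 * ‖fourierAmp n y f‖ ^ 2 = ‖fourierAmp n y (fun t => c * f t)‖ ^ 2 := by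
  have : fourierAmp n y (fun t => c * f t) = c * fourierAmp n y f := by
    rw [fourierAmp, fourierAmp, mul_sum]
    refine sum_congr rfl fun t _ => ?_
    push_cast; ring
  rw [this, norm_mul, mul_pow, Complex.norm_real, Real.norm_eq_abs, sq_abs]

/-- The weights `p` and `1 - p` absorb the factors `sin θ` and `cos θ`. Sine and cosine are
combinations of the waves `A θ` and `A (-θ)`, and adding the two squared norms removes the cross
terms by the parallelogram law; each wave is a geometric sum shifted by `±2 ^ n θ / π`. -/
theorem counterProb_eq_kern (θ : ℝ) (n y : ℕ) : counterProb (Real.sin θ ^ 2) n y =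
    (kern (2 ^ n) (y + 2 ^ n * θ / Real.pi) + kern (2 ^ n) (y - 2 ^ n * θ / Real.pi)) / 2 := by
  have hc : 1 - Real.sin θ ^ 2 = Real.cos θ ^ 2 := by linarith [Real.sin_sq_add_cos_sq θ]
  rw [counterProb, norm_smul_fourierAmp, hc, norm_smul_fourierAmp]
  simp only [(groverAmp_trig θ _).1, (groverAmp_trig θ _).2]
  set A : ℝ → ℂ := fun ϑ => Complex.exp (ϑ * Complex.I) *
    ∑ t ∈ range (2 ^ n), cis (t * (y + 2 ^ n * ϑ / Real.pi) / (2 ^ n : ℕ)) with hA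
  have hAt : ∀ ϑ : ℝ, A ϑ = ∑ t ∈ range (2 ^ n), cis (t * y / 2 ^ n) *
      Complex.exp (((2 * t + 1) * ϑ : ℝ) * Complex.I) := by
    intro ϑ
    rw [hA]
    simp only [mul_sum]
    refine sum_congr rfl fun t _ => ?_
    have : (t * (y + 2 ^ n * ϑ / Real.pi) / (2 ^ n : ℕ) : ℝ) =
        t * y / 2 ^ n + t * ϑ / Real.pi := by push_cast; field_simp
    rw [this, cis_add, mul_left_comm]
    congr 1
    rw [cis, ← Complex.exp_add]
    congr 1
    have hpi : (Real.pi : ℂ) ≠ 0 := by exact_mod_cast Real.pi_ne_zero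
    push_cast
    field_simp
    ring
  have hnorm : ∀ ϑ : ℝ, ‖A ϑ‖ ^ 2 =
      kern (2 ^ n) (y + 2 ^ n * ϑ / Real.pi) * 2 ^ (n + n) := by
    intro ϑ
    rw [hA]
    simp only [norm_mul, Complex.norm_exp_ofReal_mul_I, one_mul, kern]
    rw [Nat.cast_pow, Nat.cast_ofNat, pow_add, ← sq,
      div_mul_cancel₀ _ (by positivity : ((2 : ℝ) ^ n) ^ 2 ≠ 0)]
  have hs : fourierAmp n y (fun t => Real.sin ((2 * t + 1) * θ)) =
      (A θ - A (-θ)) * (-Complex.I / 2) := by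
    rw [hAt, hAt, fourierAmp, ← sum_sub_distrib, sum_mul]
    refine sum_congr rfl fun t _ => ?_
    rw [Complex.ofReal_sin, Complex.sin, mul_neg, Complex.ofReal_neg]
    ring
  have hcs : fourierAmp n y (fun t => Real.cos ((2 * t + 1) * θ)) = (A θ + A (-θ)) * (1 / 2) := by
    rw [hAt, hAt, fourierAmp, ← sum_add_distrib, sum_mul]
    refine sum_congr rfl fun t _ => ?_
    rw [Complex.ofReal_cos, Complex.cos, mul_neg, Complex.ofReal_neg]
    ring
  have hpar := parallelogram_law_with_norm ℝ (A θ) (A (-θ))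
  have e1 : ‖(-Complex.I / 2 : ℂ)‖ = 1 / 2 := by simp
  have e2 : ‖(1 / 2 : ℂ)‖ = 1 / 2 := by simp
  rw [hs, hcs, norm_mul, norm_mul, e1, e2]
  have e3 : kern (2 ^ n) (y - 2 ^ n * θ / Real.pi) * 2 ^ (n + n) = ‖A (-θ)‖ ^ 2 := by
    rw [hnorm]; congr 2; ring
  have e4 := hnorm θ
  have : (0 : ℝ) < 2 ^ (n + n) := by positivity
  rw [div_eq_iff this.ne']
  nlinarith

end WGate

open WGate

/-- Splitting a sum over `range (2 ^ n)` according to `inWindow`. -/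
theorem sum_inWindow {n s : ℕ} (hs : 2 * s + 1 ≤ 2 ^ n) (f : ℕ → ℝ) :
    (∑ y ∈ range (2 ^ n), if inWindow n s (2 ^ n - 1 - s) y = true then f y else 0) =
      ∑ y ∈ range (s + 1), f y + ∑ i ∈ range s, f (2 ^ n - s + i) ∧
    (∑ y ∈ range (2 ^ n), if inWindow n s (2 ^ n - 1 - s) y = false then f y else 0) =
      ∑ i ∈ range (2 ^ n - 2 * s - 1), f (s + 1 + i) := by
  have h1 : s % 2 ^ n = s := Nat.mod_eq_of_lt (by omega)
  have h2 : (2 ^ n - 1 - s) % 2 ^ n = 2 ^ n - 1 - s := Nat.mod_eq_of_lt (by omega)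
  have hw : ∀ y, inWindow n s (2 ^ n - 1 - s) y = true ↔ (y ≤ s ∨ 2 ^ n - s ≤ y) := by
    intro y
    simp only [inWindow, h1, h2]
    by_cases e1 : 2 ^ n - 1 - s < y <;> by_cases e2 : s < y <;> simp [e1, e2] <;> omega
  have hN : 2 ^ n = s + 1 + (2 ^ n - 2 * s - 1) + s := by omega
  have hsplit : ∀ g : ℕ → ℝ, ∑ y ∈ range (2 ^ n), g y = ∑ y ∈ range (s + 1), g y +
      ∑ i ∈ range (2 ^ n - 2 * s - 1), g (s + 1 + i) + ∑ i ∈ range s, g (2 ^ n - s + i) := by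
    intro g
    conv_lhs => rw [hN]
    rw [sum_range_add, sum_range_add]
    congr 1
    refine sum_congr rfl fun i _ => ?_
    congr 1
    omega
  have hwin1 : ∀ y ∈ range (s + 1), inWindow n s (2 ^ n - 1 - s) y = true := fun y hy =>
    (hw y).2 (Or.inl (by have := mem_range.1 hy; omega))
  have hwin2 : ∀ i ∈ range s, inWindow n s (2 ^ n - 1 - s) (2 ^ n - s + i) = true := fun i hi =>
    (hw _).2 (Or.inr (by omega))
  have hwin3 : ∀ i ∈ range (2 ^ n - 2 * s - 1),
      inWindow n s (2 ^ n - 1 - s) (s + 1 + i) = false := fun i hi => by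
    rw [← Bool.not_eq_true, hw]
    have := mem_range.1 hi
    omega
  constructor
  · rw [hsplit]
    rw [sum_congr rfl fun y hy => if_pos (hwin1 y hy), sum_congr rfl fun y hy => if_pos (hwin2 y hy),
      sum_eq_zero (s := range (2 ^ n - 2 * s - 1)) fun y hy => if_neg (by simp [hwin3 y hy]),
      add_zero]
  · rw [hsplit]
    rw [sum_congr rfl fun y hy => if_pos (hwin3 y hy),
      sum_eq_zero (s := range (s + 1)) fun y hy => if_neg (by simp [hwin1 y hy]),
      sum_eq_zero (s := range s) fun y hy => if_neg (by simp [hwin2 y hy]), zero_add, add_zero]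

/-- Two ends of the window and two centres give four progressions, moved into `[0, 2 ^ n]` by
periodicity. Each has mass at most `1/2 · 1/(11 - 1) = 1/20`, and the factor `1/2` of the mean
brings the total to `1/10`. -/
theorem sum_counterProb_window_le {n s : ℕ} {θ : ℝ} (h1 : (s : ℝ) + 11 ≤ 2 ^ n * θ / Real.pi)
    (h2 : 2 ^ n * θ / Real.pi ≤ 2 ^ n / 2) :
    (∑ y ∈ range (2 ^ n), if inWindow n s (2 ^ n - 1 - s) y = true then
      counterProb (Real.sin θ ^ 2) n y else 0) ≤ 1 / 10 := by
  have hs0 : (0 : ℝ) ≤ s := Nat.cast_nonneg s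
  have hs : 2 * s + 1 ≤ 2 ^ n := by
    have : (2 * s + 1 : ℝ) ≤ 2 ^ n := by linarith
    exact_mod_cast this
  rw [(sum_inWindow hs _).1]
  simp only [counterProb_eq_kern]
  set β := 2 ^ n * θ / Real.pi with hβ
  have hper : ∀ γ, kern (2 ^ n) γ = kern (2 ^ n) (γ + 2 ^ n) := fun γ => by
    have := kern_add_period (N := 2 ^ n) (by positivity) γ
    push_cast at this
    exact this.symm
  have hg : (1 : ℝ) < 11 := by norm_num
  have e1 := sum_kern_le (N := 2 ^ n) (c := s + 1) (γ := β) hg (by linarith)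
    (by push_cast; linarith)
  have e2 := sum_kern_le (N := 2 ^ n) (c := s + 1) (γ := 2 ^ n - β) hg (by linarith)
    (by push_cast; linarith)
  have e3 := sum_kern_le (N := 2 ^ n) (c := s) (γ := β - s) hg (by linarith)
    (by push_cast; linarith)
  have e4 := sum_kern_le (N := 2 ^ n) (c := s) (γ := 2 ^ n - s - β) hg (by linarith)
    (by push_cast; linarith)
  have f1 : ∀ y : ℕ, kern (2 ^ n) (y + β) = kern (2 ^ n) (β + y) := fun y => by rw [add_comm]
  have f2 : ∀ y : ℕ, kern (2 ^ n) (y - β) = kern (2 ^ n) (2 ^ n - β + y) := fun y => by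
    rw [hper]; congr 1; ring
  have hcast : ∀ i : ℕ, ((2 ^ n - s + i : ℕ) : ℝ) = 2 ^ n - s + i := fun i => by
    rw [Nat.cast_add, Nat.cast_sub (by omega)]; push_cast; ring
  have f3 : ∀ i : ℕ, kern (2 ^ n) ((2 ^ n - s + i : ℕ) + β) = kern (2 ^ n) (β - s + i) :=
    fun i => by rw [hper (β - s + i), hcast]; congr 1; ring
  have f4 : ∀ i : ℕ, kern (2 ^ n) ((2 ^ n - s + i : ℕ) - β) = kern (2 ^ n) (2 ^ n - s - β + i) :=
    fun i => by rw [hcast]; congr 1; ring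
  simp only [f3, f4, f1, f2]
  rw [← sum_div, ← sum_div, sum_add_distrib, sum_add_distrib]
  norm_num at e1 e2 e3 e4 ⊢
  linarith

/-- The complement of the window is one interval, so there are only two progressions, one for each
centre. -/
theorem sum_counterProb_outside_le {n s : ℕ} {θ : ℝ} (h0 : 0 ≤ θ)
    (h1 : 2 ^ n * θ / Real.pi + 11 ≤ s) (hs : 2 * s + 1 ≤ 2 ^ n) :
    (∑ y ∈ range (2 ^ n), if inWindow n s (2 ^ n - 1 - s) y = false then
      counterProb (Real.sin θ ^ 2) n y else 0) ≤ 1 / 10 := by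
  rw [(sum_inWindow hs _).2]
  simp only [counterProb_eq_kern]
  set β := 2 ^ n * θ / Real.pi with hβ
  have hβ0 : 0 ≤ β := by have := Real.pi_pos; positivity
  have hg : (1 : ℝ) < 11 := by norm_num
  have hc : ((2 ^ n - 2 * s - 1 : ℕ) : ℝ) = 2 ^ n - 2 * s - 1 := by
    rw [Nat.sub_sub, Nat.cast_sub hs]; push_cast; ring
  have e1 := sum_kern_le (N := 2 ^ n) (c := 2 ^ n - 2 * s - 1) (γ := s + 1 + β) hg (by linarith)
    (by rw [hc]; push_cast; linarith)
  have e2 := sum_kern_le (N := 2 ^ n) (c := 2 ^ n - 2 * s - 1) (γ := s + 1 - β) hg (by linarith)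
    (by rw [hc]; push_cast; linarith)
  have f1 : ∀ i : ℕ, kern (2 ^ n) ((s + 1 + i : ℕ) + β) = kern (2 ^ n) (s + 1 + β + i) :=
    fun i => by congr 1; push_cast; ring
  have f2 : ∀ i : ℕ, kern (2 ^ n) ((s + 1 + i : ℕ) - β) = kern (2 ^ n) (s + 1 - β + i) :=
    fun i => by congr 1; push_cast; ring
  simp only [f1, f2]
  rw [← sum_div, sum_add_distrib]
  norm_num at e1 e2 ⊢
  linarith

/-! ### Computing the threshold by the tent map -/

/-- The logistic map on fractions `p.1 / p.2`. -/
def logistic (p : ℕ × ℕ) : ℕ × ℕ := (4 * p.1 * (p.2 - p.1), p.2 * p.2)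

/-- The leading bits of `2 θ / π`, as a natural number, where `sin² θ` is the fraction `p`. The bits
are found by iterating the tent map, which is conjugate to the logistic map. -/
def tent (n : ℕ) (p : ℕ × ℕ) (i : ℕ) : ℕ :=
  Nat.rec 0 (fun i T => if 2 * (logistic^[n - 1 - i] p).1 ≤ (logistic^[n - 1 - i] p).2 then T
    else 2 ^ (i + 1) - T) i

theorem logistic_le {p : ℕ × ℕ} (h : p.1 ≤ p.2) : (logistic p).1 ≤ (logistic p).2 := by
  obtain ⟨u, v⟩ := p
  simp only [logistic] at *
  zify [h]
  nlinarith [sq_nonneg (2 * (u : ℤ) - v)]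

theorem logistic_pos {p : ℕ × ℕ} (h : 0 < p.2) : 0 < (logistic p).2 := Nat.mul_pos h h

theorem iterate_logistic {p : ℕ × ℕ} (h : p.1 ≤ p.2) (h0 : 0 < p.2) (i : ℕ) :
    (logistic^[i] p).1 ≤ (logistic^[i] p).2 ∧ 0 < (logistic^[i] p).2 := by
  induction i with
  | zero => exact ⟨h, h0⟩
  | succ i ih =>
    rw [Function.iterate_succ_apply']
    exact ⟨logistic_le ih.1, logistic_pos ih.2⟩

theorem tent_le (n : ℕ) (p : ℕ × ℕ) (i : ℕ) : tent n p i ≤ 2 ^ i := by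
  induction i with
  | zero => simp [tent]
  | succ i ih =>
    change (if _ then tent n p i else 2 ^ (i + 1) - tent n p i) ≤ _
    split
    · exact ih.trans (Nat.pow_le_pow_right (by norm_num) (by omega))
    · exact Nat.sub_le _ _

/-- If `sin² θ = x` then `sin² (2θ) = 4x(1 - x)`, and `x ≤ 1/2` decides whether `2θ` or `π - 2θ` is
the angle in `[0, π/2]`. Each step either keeps the approximation or reflects it at `2 ^ (i+1)`;
both are isometries, so the initial error of at most 1 never grows. -/
theorem abs_tent_sub_le {n : ℕ} {p : ℕ × ℕ} (h : p.1 ≤ p.2) (h0 : 0 < p.2) {i : ℕ} (hi : i ≤ n)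
    {θ : ℝ} (hθ0 : 0 ≤ θ) (hθ1 : θ ≤ Real.pi / 2)
    (hθ : Real.sin θ ^ 2 = ((logistic^[n - i] p).1 : ℝ) / (logistic^[n - i] p).2) :
    |(tent n p i : ℝ) - 2 ^ i * (2 * θ / Real.pi)| ≤ 1 := by
  have hpi := Real.pi_pos
  induction i generalizing θ with
  | zero =>
    have h1 : 2 * θ / Real.pi ≤ 1 := by rw [div_le_one hpi]; linarith
    have h2 : 0 ≤ 2 * θ / Real.pi := by positivity
    have h3 : tent n p 0 = 0 := rfl
    rw [h3, abs_le, pow_zero, one_mul, Nat.cast_zero]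
    constructor <;> linarith
  | succ i ih =>
    obtain ⟨hq, hq0⟩ := iterate_logistic h h0 (n - (i + 1))
    have hstep : logistic^[n - i] p = logistic (logistic^[n - (i + 1)] p) := by
      rw [show n - i = (n - (i + 1)) + 1 by omega, Function.iterate_succ_apply']
    have htent : tent n p (i + 1) =
        if 2 * (logistic^[n - (i + 1)] p).1 ≤ (logistic^[n - (i + 1)] p).2 then tent n p i
        else 2 ^ (i + 1) - tent n p i := by
      rw [show n - (i + 1) = n - 1 - i by omega]; rfl
    rw [htent]
    generalize logistic^[n - (i + 1)] p = q at *
    obtain ⟨u, v⟩ := q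
    simp only at hq hq0 hθ ⊢
    have hv : (0 : ℝ) < v := by exact_mod_cast hq0
    have hx : ((logistic (u, v)).1 : ℝ) / (logistic (u, v)).2 = 4 * (u / v) * (1 - u / v) := by
      simp only [logistic]
      rw [Nat.cast_mul, Nat.cast_mul, Nat.cast_mul, Nat.cast_sub hq]
      push_cast
      field_simp
    have hsin : Real.sin (2 * θ) ^ 2 =
        ((logistic^[n - i] p).1 : ℝ) / (logistic^[n - i] p).2 := by
      rw [hstep, hx, ← hθ, Real.sin_two_mul]
      have := Real.sin_sq_add_cos_sq θ
      rw [show 1 - Real.sin θ ^ 2 = Real.cos θ ^ 2 by linarith]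
      ring
    have hcos : Real.cos (2 * θ) = 1 - 2 * (u / v) := by
      rw [← hθ, Real.cos_two_mul, Real.cos_sq']; ring
    split_ifs with hc
    · have hc' : (u : ℝ) / v ≤ 1 / 2 := by
        rw [div_le_div_iff₀ hv (by norm_num)]
        have : (2 * u : ℝ) ≤ v := by exact_mod_cast hc
        linarith
      have hle : 2 * θ ≤ Real.pi / 2 := by
        by_contra hlt
        have := Real.cos_neg_of_pi_div_two_lt_of_lt (x := 2 * θ) (by linarith) (by linarith)
        linarith
      have := ih (by omega) (θ := 2 * θ) (by linarith) hle hsin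
      rw [pow_succ]
      convert this using 3
      ring
    · have hc' : 1 / 2 < (u : ℝ) / v := by
        rw [div_lt_div_iff₀ (by norm_num) hv]
        have : (v : ℝ) < 2 * u := by exact_mod_cast (by omega : v < 2 * u)
        linarith
      have hge : Real.pi / 2 ≤ 2 * θ := by
        by_contra hlt
        have := Real.cos_nonneg_of_neg_pi_div_two_le_of_le (x := 2 * θ) (by linarith)
          (by linarith)
        linarith
      have := ih (by omega) (θ := Real.pi - 2 * θ) (by linarith) (by linarith)
        (by rw [Real.sin_pi_sub, hsin])
      rw [Nat.cast_sub ((tent_le n p i).trans (Nat.pow_le_pow_right (by norm_num) (by omega))),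
        ← abs_neg]
      convert this using 2
      push_cast
      rw [pow_succ]
      field_simp
      ring

/-! ### Separation of the angles and choice of precision -/

theorem sub_le_of_sin_sub {x y d : ℝ} (hd : 0 < d) (h : Real.sin x + d ≤ Real.sin y)
    (hx : |x| ≤ Real.pi / 2) (hy : |y| ≤ Real.pi / 2) : x + d ≤ y := by
  have h1 : x ≤ y := by
    by_contra hlt
    have := Real.sin_le_sin_of_le_of_le_pi_div_two (neg_le_of_abs_le hy) (le_of_abs_le hx)
      (le_of_not_ge hlt)
    linarith
  have h2 := Real.lipschitzWith_sin.dist_le_mul y x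
  rw [Real.dist_eq, Real.dist_eq, abs_of_nonneg (by linarith), abs_of_nonneg (by linarith)] at h2
  simp at h2
  linarith

/-- The angle whose squared sine is `p`. -/
noncomputable def angle (p : ℝ) : ℝ := Real.arcsin (Real.sqrt p)

theorem sin_angle {p : ℝ} (h1 : p ≤ 1) : Real.sin (angle p) = Real.sqrt p :=
  Real.sin_arcsin (by have := Real.sqrt_nonneg p; linarith) (Real.sqrt_le_one.2 h1)

theorem angle_nonneg (p : ℝ) : 0 ≤ angle p := Real.arcsin_nonneg.2 (Real.sqrt_nonneg p)

theorem angle_le (p : ℝ) : angle p ≤ Real.pi / 2 := Real.arcsin_le_pi_div_two _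

theorem abs_angle_le (p : ℝ) : |angle p| ≤ Real.pi / 2 := by
  rw [abs_of_nonneg (angle_nonneg p)]; exact angle_le p

/-- Angles of probabilities on either side of a gap are well separated. -/
theorem angle_gap {p q d N : ℝ} (hp1 : p ≤ 1) (hq1 : q ≤ 1) (hd : 0 < d) (hN : 0 < N)
    (h : Real.sqrt p + d ≤ Real.sqrt q) (hNd : 12 * Real.pi ≤ N * d) :
    N * angle p / Real.pi + 12 ≤ N * angle q / Real.pi := by
  have hpi := Real.pi_pos
  have := sub_le_of_sin_sub hd (by rw [sin_angle hp1, sin_angle hq1]; exact h)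
    (abs_angle_le p) (abs_angle_le q)
  rw [div_add' _ _ _ hpi.ne', div_le_div_iff_of_pos_right hpi]
  nlinarith

/-- The constant comes from `(1 + 3E/20)² ≤ 1 + E/2` for `E ≤ 1`. On the other side of the gap, `√(1
+ E/2) ≤ 1 + E/4` and `1 + 2E/5 ≤ √(1 + E)`, with `2/5 - 1/4 = 3/20` again. -/
theorem sqrt_gap_below {r E p : ℝ} (hr : 0 < r) (hE : 0 < E) (hE1 : E ≤ 1) (hp : p ≤ r ^ 2) :
    Real.sqrt p + 3 / 20 * (r * E) ≤ Real.sqrt (r ^ 2 * (1 + E / 2)) := by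
  have h1 : Real.sqrt p ≤ r := Real.sqrt_le_iff.2 ⟨hr.le, hp⟩
  have h2 : r * (1 + 3 / 20 * E) ≤ Real.sqrt (r ^ 2 * (1 + E / 2)) := by
    apply Real.le_sqrt_of_sq_le
    rw [mul_pow]
    gcongr
    nlinarith
  nlinarith

theorem sqrt_gap_above {r E p : ℝ} (hr : 0 < r) (hE : 0 < E) (hE1 : E ≤ 1)
    (hp : r ^ 2 * (1 + E) ≤ p) :
    Real.sqrt (r ^ 2 * (1 + E / 2)) + 3 / 20 * (r * E) ≤ Real.sqrt p := by
  have h1 : Real.sqrt (r ^ 2 * (1 + E / 2)) ≤ r * (1 + E / 4) := by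
    rw [Real.sqrt_le_iff]
    refine ⟨by positivity, ?_⟩
    rw [mul_pow]
    gcongr
    nlinarith
  have h2 : r * (1 + 2 / 5 * E) ≤ Real.sqrt p := by
    apply Real.le_sqrt_of_sq_le
    refine le_trans ?_ hp
    rw [mul_pow]
    gcongr
    nlinarith
  nlinarith

/-- Half the number of extra bits of precision needed for `k` out of `2 ^ a` positions. -/
def extraBits (a k : ℕ) : ℕ := Nat.clog 4 (2 ^ a / k + 1)

/-- The number of bits of the iteration counter, minus one. -/
def counterBits (a k j : ℕ) : ℕ := j + 7 + extraBits a k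

/-- The threshold for the transformed counter. -/
def threshold (a k j : ℕ) : ℕ :=
  tent (counterBits a k j) (k * (2 ^ (j + 1) + 1), 2 ^ (j + 1 + a)) (counterBits a k j)

theorem one_le_extraBits {a k : ℕ} (hk : 0 < k) :
    1 ≤ (2 : ℝ) ^ extraBits a k * Real.sqrt (k / 2 ^ a) := by
  have h : 2 ^ a / k + 1 ≤ 4 ^ extraBits a k := Nat.le_pow_clog (by norm_num) _
  have h1 : 2 ^ a < 4 ^ extraBits a k * k := (Nat.div_lt_iff_lt_mul hk).1 h
  have h2 : (2 : ℝ) ^ a ≤ 4 ^ extraBits a k * k := by exact_mod_cast h1.le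
  have h3 : (2 : ℝ) ^ extraBits a k = Real.sqrt (4 ^ extraBits a k) := by
    rw [show (4 : ℝ) = 2 ^ 2 by norm_num, ← pow_mul, mul_comm, pow_mul, Real.sqrt_sq (by positivity)]
  rw [h3, ← Real.sqrt_mul (by positivity), Real.one_le_sqrt, ← mul_div_assoc,
    one_le_div (by positivity)]
  exact h2

/-- The 8 fixed bits are chosen here: `256 · 3/20 = 38.4` exceeds `12 π`, while the `j` bits cancel
`2⁻ʲ` and `extraBits` compensates `√(k / 2 ^ a)`. -/
theorem counter_gap {a k : ℕ} (hk : 0 < k) (j : ℕ) :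
    12 * Real.pi ≤ 2 ^ (counterBits a k j + 1) *
      (3 / 20 * (Real.sqrt (k / 2 ^ a) * (1 / 2 ^ j))) := by
  have h := one_le_extraBits (a := a) hk
  have e : (2 : ℝ) ^ (counterBits a k j + 1) * (3 / 20 * (Real.sqrt (k / 2 ^ a) * (1 / 2 ^ j))) =
      256 * (3 / 20) * (2 ^ extraBits a k * Real.sqrt (k / 2 ^ a)) := by
    rw [counterBits, show j + 7 + extraBits a k + 1 = j + 8 + extraBits a k by ring, pow_add,
      pow_add]
    field_simp
    norm_num
  rw [e]
  have := Real.pi_lt_d2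
  nlinarith

/-- The threshold separates the two cases. -/
theorem threshold_spec {a k j : ℕ} (hk : 0 < k) (h : k * (2 ^ j + 1) < 2 ^ a * 2 ^ j) :
    2 * threshold a k j + 1 ≤ 2 ^ (counterBits a k j + 1) ∧
    (∀ p : ℝ, p ≤ 1 → p ≤ k / 2 ^ a →
      2 ^ (counterBits a k j + 1) * angle p / Real.pi + 11 ≤ threshold a k j) ∧
    (∀ p : ℝ, p ≤ 1 → (1 + 1 / 2 ^ j) * k / 2 ^ a ≤ p →
      threshold a k j + 11 ≤ 2 ^ (counterBits a k j + 1) * angle p / Real.pi) := by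
  set N : ℝ := 2 ^ (counterBits a k j + 1) with hN
  set E : ℝ := 1 / 2 ^ j with hE
  set r : ℝ := Real.sqrt (k / 2 ^ a) with hr
  have hpi := Real.pi_pos
  have hk' : (0 : ℝ) < k := by exact_mod_cast hk
  have hr0 : 0 < r := Real.sqrt_pos.2 (by positivity)
  have hr2 : r ^ 2 = k / 2 ^ a := Real.sq_sqrt (by positivity)
  have hE0 : 0 < E := by positivity
  have hE1 : E ≤ 1 := by
    rw [hE, div_le_one (by positivity)]; exact one_le_pow₀ (by norm_num)
  have hgap : 12 * Real.pi ≤ N * (3 / 20 * (r * E)) := counter_gap hk j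
  have hN0 : 0 < N := by positivity
  have hd : 0 < 3 / 20 * (r * E) := by positivity
  -- This is where the exclusion of the trivial case enters: the smallest fraction to be rejected is
  -- a genuine probability and has an angle.
  have hx1 : r ^ 2 * (1 + E) < 1 := by
    rw [hr2, hE]
    have h' : (k : ℝ) * (2 ^ j + 1) < 2 ^ a * 2 ^ j := by exact_mod_cast h
    rw [show (k : ℝ) / 2 ^ a * (1 + 1 / 2 ^ j) = k * (2 ^ j + 1) / (2 ^ a * 2 ^ j) by field_simp,
      div_lt_one (by positivity)]
    exact h'
  have hxs : r ^ 2 * (1 + E / 2) ≤ 1 := by nlinarith [mul_pos (pow_pos hr0 2) hE0]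
  set β := N * angle (r ^ 2 * (1 + E / 2)) / Real.pi with hβ
  have hlow : ∀ p : ℝ, p ≤ 1 → p ≤ k / 2 ^ a → N * angle p / Real.pi + 12 ≤ β := fun p hp hpk =>
    angle_gap hp hxs hd hN0 (sqrt_gap_below hr0 hE0 hE1 (by rwa [hr2])) hgap
  have hhigh : ∀ p : ℝ, p ≤ 1 → r ^ 2 * (1 + E) ≤ p → β + 12 ≤ N * angle p / Real.pi :=
    fun p hp hpk => angle_gap hxs hp hd hN0 (sqrt_gap_above hr0 hE0 hE1 hpk) hgap
  -- Rounding costs 1 of the gap of 12, which leaves the 11 required by the tail bounds.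
  have hs : |(threshold a k j : ℝ) - β| ≤ 1 := by
    have hle : k * (2 ^ (j + 1) + 1) ≤ 2 ^ (j + 1 + a) := by
      have e1 : 2 ^ (j + 1 + a) = 2 * (2 ^ a * 2 ^ j) := by ring
      have e2 : k * (2 ^ (j + 1) + 1) + k = 2 * (k * (2 ^ j + 1)) := by ring
      omega
    have := abs_tent_sub_le (n := counterBits a k j) (i := counterBits a k j)
      (p := (k * (2 ^ (j + 1) + 1), 2 ^ (j + 1 + a))) hle (by positivity) le_rfl
      (angle_nonneg (r ^ 2 * (1 + E / 2))) (angle_le _) ?_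
    · convert this using 2
      rw [hβ, hN, pow_succ]
      simp only [threshold]
      ring
    · rw [sin_angle hxs, Real.sq_sqrt (by positivity), Nat.sub_self, Function.iterate_zero, id, hr2,
        hE]
      push_cast
      rw [pow_add, pow_succ]
      field_simp
      ring
  obtain ⟨hs1, hs2⟩ := abs_le.1 hs
  refine ⟨?_, fun p hp hpk => ?_, fun p hp hpk => ?_⟩
  -- Even the smallest fraction to be rejected has its centre at most `N / 2`, so the threshold
  -- stays well below `N / 2` and the two ends of the window are disjoint.
  · have h1 := hhigh _ hx1.le le_rfl
    have h2 : N * angle (r ^ 2 * (1 + E)) / Real.pi ≤ N / 2 := by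
      rw [div_le_iff₀ hpi]
      nlinarith [angle_le (r ^ 2 * (1 + E))]
    have : (2 * threshold a k j + 1 : ℝ) ≤ 2 ^ (counterBits a k j + 1) := by
      rw [← hN]; linarith
    exact_mod_cast this
  · have := hlow p hp hpk
    linarith
  · have := hhigh p hp (by rw [hr2]; convert hpk using 1; ring)
    linarith

/-! ### The decider circuit and its correctness -/

/-- The precision for which `2⁻ʲ` approximates `ε` from below. -/
noncomputable def precisionBits (ε : ℝ) : ℕ := Nat.clog 2 ⌈1 / ε⌉₊

theorem precisionBits_le {ε : ℝ} (hε : 0 < ε) : 1 / 2 ^ precisionBits ε ≤ ε := by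
  have h1 : 1 / ε ≤ ⌈1 / ε⌉₊ := Nat.le_ceil _
  have h2 : ⌈1 / ε⌉₊ ≤ 2 ^ precisionBits ε := Nat.le_pow_clog (by norm_num) _
  have h3 : (⌈1 / ε⌉₊ : ℝ) ≤ 2 ^ precisionBits ε := by exact_mod_cast h2
  exact (one_div_le (by positivity) hε).2 (h1.trans h3)

/-- No input of this size is far enough from the threshold to be rejected. -/
def NothingToReject (m k j : ℕ) : Prop := m * 2 ^ j ≤ k * (2 ^ j + 1)

instance (m k j : ℕ) : Decidable (NothingToReject m k j) :=
  inferInstanceAs (Decidable (_ ≤ _))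

/-- The circuit that compares the Hamming distance with `k`, with relative precision `2⁻ʲ`. -/
def deciderCircuit (m b k j : ℕ) : OracleCircuit (Nat.clog 2 m) b :=
  if NothingToReject m k j then .ofWGates _ _ 0 [WGate.pauliX 0] 0
  else .ofWGates _ _ (WGate.deciderWidth (Nat.clog 2 m) b (counterBits (Nat.clog 2 m) k j + 1))
    (WGate.deciderGates (Nat.clog 2 m) b (counterBits (Nat.clog 2 m) k j + 1)
      (threshold (Nat.clog 2 m) k j)
      (2 ^ (counterBits (Nat.clog 2 m) k j + 1) - 1 - threshold (Nat.clog 2 m) k j))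
    (Nat.clog 2 m + b + (counterBits (Nat.clog 2 m) k j + 1) +
      2 * (counterBits (Nat.clog 2 m) k j + 1) + 1)

theorem outputProb_pauliX {a m b : ℕ} (X Y : Fin m → Fin b → Bool) :
    (OracleCircuit.ofWGates a b 0 [WGate.pauliX 0] 0).outputProb X Y true = 1 := by
  rw [OracleCircuit.outputProb_ofWGates (by simp [WGate.pauliX, WGate.Valid]) (by norm_num),
    sum_extBits (0 + 1) (fun x => if x 0 = true then
      ‖WGate.semL a X Y [WGate.pauliX 0] OracleCircuit.zeroState x‖ ^ 2 else 0)]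
  simp [bsum, WGate.semL, WGate.sem, WGate.act, WGate.pauliX, OracleCircuit.zeroState]

theorem hammingDist_le {m b : ℕ} (X Y : Fin m → Fin b → Bool) : hammingDist X Y ≤ m := by
  simpa using hammingDist_le_card_fintype (x := X) (y := Y)

theorem deciderCircuit_spec {m b k j : ℕ} (hk : 0 < k) (X Y : Fin m → Fin b → Bool) :
    (hammingDist X Y ≤ k → 9 / 10 ≤ (deciderCircuit m b k j).outputProb X Y true) ∧
    ((1 + 1 / 2 ^ j) * (k : ℝ) < hammingDist X Y →
      9 / 10 ≤ (deciderCircuit m b k j).outputProb X Y false) := by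
  have hδ : (hammingDist X Y : ℝ) ≤ m := by exact_mod_cast hammingDist_le X Y
  by_cases hc : NothingToReject m k j
  · rw [deciderCircuit, if_pos hc, outputProb_pauliX]
    -- The constant circuit always says YES; a distance above `(1 + 2⁻ʲ) k` would exceed the length
    -- `m`.
    refine ⟨fun _ => by norm_num, fun h => absurd h (not_lt.2 (hδ.trans ?_))⟩
    have h1 : (m : ℝ) * 2 ^ j ≤ k * (2 ^ j + 1) := by exact_mod_cast hc
    rw [show (1 + 1 / 2 ^ j) * (k : ℝ) = k * (2 ^ j + 1) / 2 ^ j by field_simp,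
      le_div_iff₀ (by positivity)]
    exact h1
  · rw [deciderCircuit, if_neg hc]
    rw [NothingToReject, not_le] at hc
    have hm : m ≤ 2 ^ Nat.clog 2 m := Nat.le_pow_clog (by norm_num) m
    generalize Nat.clog 2 m = a at *
    obtain ⟨h1, h2, h3⟩ := threshold_spec (a := a) (j := j) hk
      (hc.trans_le (Nat.mul_le_mul_right _ hm))
    set n := counterBits a k j + 1
    set s := threshold a k j
    set p : ℝ := hammingDist X Y / 2 ^ a with hp
    have hm' : (m : ℝ) ≤ 2 ^ a := by exact_mod_cast hm
    have hp1 : p ≤ 1 := by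
      rw [hp, div_le_one (by positivity)]; linarith
    have hsin : Real.sin (angle p) ^ 2 = p := by
      rw [sin_angle hp1, Real.sq_sqrt (by positivity)]
    have hadd := OracleCircuit.outputProb_add (o := a + b + n + 2 * n + 1)
      (WGate.deciderGates_valid (b := b) a n s (2 ^ n - 1 - s))
      (by simp only [WGate.deciderWidth]; omega) X Y
    have hpi := Real.pi_pos
    refine ⟨fun h => ?_, fun h => ?_⟩
    · have hb := sum_counterProb_outside_le (angle_nonneg p)
        (h2 p hp1 (by rw [hp]; gcongr)) h1
      rw [hsin, hp, ← OracleCircuit.outputProb_decider X Y n s _ hm] at hb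
      linarith
    · have hb := sum_counterProb_window_le
        (h3 p hp1 (by rw [hp]; gcongr)) (by
          rw [div_le_iff₀ hpi]
          have : (0 : ℝ) < 2 ^ n := by positivity
          nlinarith [angle_le p])
      rw [hsin, hp, ← OracleCircuit.outputProb_decider X Y n s _ hm] at hb
      linarith

/-! ### Uniformity: the circuits are primitive recursive -/

theorem Primrec.natPow {α : Type*} [Primcodable α] {f g : α → ℕ} (hf : Primrec f)
    (hg : Primrec g) : Primrec fun x => f x ^ g x :=
  (Primrec₂.unpaired'.1 Nat.Primrec.pow).comp hf hg

theorem Primrec.natAdd {α : Type*} [Primcodable α] {f g : α → ℕ} (hf : Primrec f)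
    (hg : Primrec g) : Primrec fun x => f x + g x := Primrec.nat_add.comp hf hg

theorem Primrec.natSub {α : Type*} [Primcodable α] {f g : α → ℕ} (hf : Primrec f)
    (hg : Primrec g) : Primrec fun x => f x - g x := Primrec.nat_sub.comp hf hg

theorem Primrec.natMul {α : Type*} [Primcodable α] {f g : α → ℕ} (hf : Primrec f)
    (hg : Primrec g) : Primrec fun x => f x * g x := Primrec.nat_mul.comp hf hg

theorem Primrec.natDiv {α : Type*} [Primcodable α] {f g : α → ℕ} (hf : Primrec f)
    (hg : Primrec g) : Primrec fun x => f x / g x := Primrec.nat_div.comp hf hg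

theorem Primrec.append {α β : Type*} [Primcodable α] [Primcodable β] {f g : α → List β}
    (hf : Primrec f) (hg : Primrec g) : Primrec fun x => f x ++ g x :=
  Primrec.list_append.comp hf hg

theorem Primrec.cons {α β : Type*} [Primcodable α] [Primcodable β] {f : α → β} {g : α → List β}
    (hf : Primrec f) (hg : Primrec g) : Primrec fun x => f x :: g x :=
  Primrec.list_cons.comp hf hg

theorem Primrec.reverse {α β : Type*} [Primcodable α] [Primcodable β] {f : α → List β}
    (hf : Primrec f) : Primrec fun x => (f x).reverse :=
  Primrec.list_reverse.comp hf

/-- Concatenation of a primitive recursive family of lists over a range. -/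
theorem Primrec.flatMap_range {α β : Type*} [Primcodable α] [Primcodable β] {k : α → ℕ}
    {f : α → ℕ → List β} (hk : Primrec k) (hf : Primrec fun x : α × ℕ => f x.1 x.2) :
    Primrec fun x => (List.range (k x)).flatMap (f x) :=
  Primrec.list_flatMap (Primrec.list_range.comp hk) hf

theorem Primrec.map_range {α β : Type*} [Primcodable α] [Primcodable β] {k : α → ℕ}
    {f : α → ℕ → β} (hk : Primrec k) (hf : Primrec fun x : α × ℕ => f x.1 x.2) :
    Primrec fun x => (List.range (k x)).map (f x) :=
  Primrec.list_map (Primrec.list_range.comp hk) hf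

/-- Bounded search for the first exponent `i` with `n ≤ B ^ i`; the range suffices because `Nat.clog
B n ≤ n`. -/
theorem Primrec.natClog {α : Type*} [Primcodable α] {B : ℕ} (hB : 1 < B) {f : α → ℕ}
    (hf : Primrec f) : Primrec fun x => Nat.clog B (f x) := by
  have h : ∀ n, Nat.clog B n = (List.range (n + 1)).findIdx fun i => decide (n ≤ B ^ i) := by
    intro n
    have hle : Nat.clog B n ≤ n := Nat.clog_le_of_le_pow (Nat.lt_pow_self hB).le
    symm
    rw [List.findIdx_eq (by simpa using Nat.lt_succ_of_le hle)]
    simp only [List.getElem_range, decide_eq_true_iff, decide_eq_false_iff_not, not_le]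
    exact ⟨Nat.le_pow_clog hB n, fun i hi => (Nat.lt_clog_iff_pow_lt hB).1 hi⟩
  simp only [h]
  refine Primrec.list_findIdx
    (Primrec.list_range.comp (hf.natAdd (Primrec.const 1))) ?_
  exact primrecPred_iff_primrec_decide.1
    (Primrec.nat_le.comp (hf.comp Primrec.fst) ((Primrec.const B).natPow Primrec.snd))

section Gates

variable {α : Type*} [Primcodable α]

namespace WGate

theorem primrec_had {q : α → ℕ} (hq : Primrec q) : Primrec fun x => had (q x) :=
  (Primrec.const 0).pair (hq.pair ((Primrec.const 0).pair (Primrec.const 0)))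

theorem primrec_phase {r q : α → ℕ} (hr : Primrec r) (hq : Primrec q) :
    Primrec fun x => phase (r x) (q x) :=
  (Primrec.const 1).pair (hr.pair (hq.pair (Primrec.const 0)))

theorem primrec_pauliX {q : α → ℕ} (hq : Primrec q) : Primrec fun x => pauliX (q x) :=
  (Primrec.const 2).pair (hq.pair ((Primrec.const 0).pair (Primrec.const 0)))

theorem primrec_cnot {c t : α → ℕ} (hc : Primrec c) (ht : Primrec t) :
    Primrec fun x => cnot (c x) (t x) :=
  (Primrec.const 3).pair (hc.pair (ht.pair (Primrec.const 0)))

theorem primrec_toffoli {c d t : α → ℕ} (hc : Primrec c) (hd : Primrec d) (ht : Primrec t) :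
    Primrec fun x => toffoli (c x) (d x) (t x) :=
  (Primrec.const 4).pair (hc.pair (hd.pair ht))

theorem code_eq (n : ℕ) (g : WGate) : code n g =
    if g.1 = 0 then [0, g.2.1] else if g.1 = 1 then [1, g.2.1, g.2.2.1] else
    if g.1 = 2 then [2, g.2.1] else if g.1 = 3 then [3, g.2.1, g.2.2.1] else
    if g.1 = 4 then [4, g.2.1, g.2.2.1, g.2.2.2] else
    if g.1 = 5 then 5 :: List.range n else if g.1 = 6 then 6 :: List.range n else [] := by
  obtain ⟨k, p, q, r⟩ := g
  match k with
  | 0 | 1 | 2 | 3 | 4 | 5 | 6 => rfl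
  | k + 7 => simp [code]

theorem primrec_code {n : α → ℕ} {g : α → WGate} (hn : Primrec n) (hg : Primrec g) :
    Primrec fun x => code (n x) (g x) := by
  have h1 : Primrec fun x => (g x).2.1 := Primrec.fst.comp (Primrec.snd.comp hg)
  have h2 : Primrec fun x => (g x).2.2.1 :=
    Primrec.fst.comp (Primrec.snd.comp (Primrec.snd.comp hg))
  have h3 : Primrec fun x => (g x).2.2.2 :=
    Primrec.snd.comp (Primrec.snd.comp (Primrec.snd.comp hg))
  have hk : ∀ i : ℕ, PrimrecPred fun x => (g x).1 = i := fun i =>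
    Primrec.eq.comp (Primrec.fst.comp hg) (Primrec.const i)
  have hr : Primrec fun x => List.range (n x) := Primrec.list_range.comp hn
  simp only [code_eq]
  exact Primrec.ite (hk 0) ((Primrec.const 0).cons (h1.cons (Primrec.const []))) <|
    Primrec.ite (hk 1) ((Primrec.const 1).cons (h1.cons (h2.cons (Primrec.const [])))) <|
    Primrec.ite (hk 2) ((Primrec.const 2).cons (h1.cons (Primrec.const []))) <|
    Primrec.ite (hk 3) ((Primrec.const 3).cons (h1.cons (h2.cons (Primrec.const [])))) <|
    Primrec.ite (hk 4)
      ((Primrec.const 4).cons (h1.cons (h2.cons (h3.cons (Primrec.const []))))) <|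
    Primrec.ite (hk 5) ((Primrec.const 5).cons hr) <|
    Primrec.ite (hk 6) ((Primrec.const 6).cons hr) (Primrec.const [])

theorem primrec_hads {B k : α → ℕ} (hB : Primrec B) (hk : Primrec k) :
    Primrec fun x => hads (B x) (k x) :=
  Primrec.map_range hk (primrec_had ((hB.comp Primrec.fst).natAdd Primrec.snd))

theorem primrec_step {w i o : α → ℕ} {c : α → Prop} [DecidablePred c] (hw : Primrec w)
    (hi : Primrec i) (ho : Primrec o) (hc : PrimrecPred c) :
    Primrec fun x => step (w x) (i x) (o x) (decide (c x)) := by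
  have : Primrec fun x => (if c x then [] else [cnot (w x) (o x), cnot (i x) (o x)]) ++
      [toffoli (w x) (i x) (o x)] :=
    (Primrec.ite hc (Primrec.const []) ((primrec_cnot hw ho).cons
      ((primrec_cnot hi ho).cons (Primrec.const [])))).append
      ((primrec_toffoli hw hi ho).cons (Primrec.const []))
  refine this.of_eq fun x => ?_
  by_cases h : c x <;> simp [step, h]

theorem primrec_chain {B C s k : α → ℕ} (hB : Primrec B) (hC : Primrec C) (hs : Primrec s)
    (hk : Primrec k) : Primrec fun x => chain (B x) (C x) (s x) (k x) := by
  have hC' := (hC.comp (Primrec.fst (β := ℕ))).natAdd Primrec.snd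
  refine Primrec.flatMap_range hk (primrec_step ((hB.comp Primrec.fst).natAdd Primrec.snd)
    hC' (hC'.natAdd (Primrec.const 1)) ?_)
  exact Primrec.eq.comp (Primrec.nat_mod.comp ((hs.comp Primrec.fst).natDiv
    ((Primrec.const 2).natPow Primrec.snd)) (Primrec.const 2)) (Primrec.const 1)

theorem primrec_diffTest {a b C c : α → ℕ} (ha : Primrec a) (hb : Primrec b) (hC : Primrec C)
    (hc : Primrec c) : Primrec fun x => diffTest (a x) (b x) (C x) (c x) :=
  ((Primrec.const queryX).cons ((Primrec.const queryY).cons ((primrec_pauliX hC).cons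
    ((primrec_cnot hc hC).cons (Primrec.const []))))).append
    (primrec_chain ha hC (Primrec.const 0) hb)

theorem primrec_zeroTest {a C c : α → ℕ} (ha : Primrec a) (hC : Primrec C)
    (hc : Primrec c) : Primrec fun x => zeroTest (a x) (C x) (c x) :=
  ((primrec_pauliX hC).cons ((primrec_cnot hc hC).cons (Primrec.const []))).append
    (primrec_chain (Primrec.const 0) hC (Primrec.const 0) ha)

theorem primrec_phase_conj {L : α → List WGate} {o : α → ℕ} (hL : Primrec L) (ho : Primrec o) :
    Primrec fun x => L x ++ [phase 1 (o x)] ++ (L x).reverse :=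
  (hL.append ((primrec_phase (Primrec.const 1) ho).cons (Primrec.const []))).append hL.reverse

theorem primrec_grover {a b C c : α → ℕ} (ha : Primrec a) (hb : Primrec b) (hC : Primrec C)
    (hc : Primrec c) : Primrec fun x => grover (a x) (b x) (C x) (c x) := by
  have hh := primrec_hads (Primrec.const (α := α) 0) ha
  exact (primrec_phase_conj (primrec_diffTest ha hb hC hc) (hC.natAdd hb)).append
    (hh.reverse.append ((primrec_phase_conj (primrec_zeroTest ha hC hc) (hC.natAdd ha)).append hh))

theorem primrec_groverPowers {a b n : α → ℕ} (ha : Primrec a) (hb : Primrec b) (hn : Primrec n) :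
    Primrec fun x => groverPowers (a x) (b x) (n x) := by
  refine Primrec.flatMap_range hn (Primrec.flatMap_range ?_ ?_)
  · exact (Primrec.const 2).natPow
      (((hn.comp Primrec.fst).natSub (Primrec.const 1)).natSub Primrec.snd)
  · have h1 : Primrec fun x : (α × ℕ) × ℕ => x.1.1 := Primrec.fst.comp Primrec.fst
    have ha' := ha.comp h1
    have hb' := hb.comp h1
    exact primrec_grover ha' hb' ((ha'.natAdd hb').natAdd (hn.comp h1))
      ((ha'.natAdd hb').natAdd (Primrec.snd.comp Primrec.fst))

theorem primrec_cphase {r c t : α → ℕ} (hr : Primrec r) (hc : Primrec c) (ht : Primrec t) :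
    Primrec fun x => cphase (r x) (c x) (t x) := by
  have hr1 := hr.natAdd (Primrec.const 1)
  have hcn := primrec_cnot hc ht
  exact (((primrec_phase hr1 hc).cons ((primrec_phase hr1 ht).cons (hcn.cons
    (Primrec.const [])))).append (Primrec.map_range hr1
      (primrec_phase (Primrec.snd.natAdd (Primrec.const 1)) (ht.comp Primrec.fst)))).append
    (hcn.cons (Primrec.const []))

theorem primrec_qft {B n : α → ℕ} (hB : Primrec B) (hn : Primrec n) :
    Primrec fun x => qft (B x) (n x) := by
  have hB' := hB.comp (Primrec.fst (β := ℕ))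
  refine Primrec.flatMap_range hn ((Primrec.flatMap_range Primrec.snd (primrec_cphase
    (((Primrec.snd.comp Primrec.fst).natSub Primrec.snd).natAdd (Primrec.const 1))
    ((hB'.comp Primrec.fst).natAdd Primrec.snd)
    ((hB'.comp Primrec.fst).natAdd (Primrec.snd.comp Primrec.fst)))).append
    ((primrec_had (hB'.natAdd Primrec.snd)).cons (Primrec.const [])))

theorem primrec_windowTest {B C n s s' : α → ℕ} (hB : Primrec B) (hC : Primrec C) (hn : Primrec n)
    (hs : Primrec s) (hs' : Primrec s') :
    Primrec fun x => windowTest (B x) (C x) (n x) (s x) (s' x) := by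
  have ho := (hC.natAdd ((Primrec.const 2).natMul hn)).natAdd (Primrec.const 1)
  exact (primrec_chain hB hC hs hn).append ((primrec_chain hB
    ((hC.natAdd hn).natAdd (Primrec.const 1)) hs' hn).append
    ((primrec_cnot (hC.natAdd hn) ho).cons ((primrec_pauliX ho).cons (Primrec.const []))))

theorem primrec_deciderGates {a b n s s' : α → ℕ} (ha : Primrec a) (hb : Primrec b)
    (hn : Primrec n) (hs : Primrec s) (hs' : Primrec s') :
    Primrec fun x => deciderGates (a x) (b x) (n x) (s x) (s' x) := by
  have hab := ha.natAdd hb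
  exact ((((primrec_hads (Primrec.const 0) ha).append (primrec_hads hab hn)).append
    (primrec_groverPowers ha hb hn)).append (primrec_qft hab hn)).append
    (primrec_windowTest hab (hab.natAdd hn) hn hs hs')

end WGate

theorem primrec_logistic : Primrec logistic := by
  have h1 := Primrec.fst (α := ℕ) (β := ℕ)
  have h2 := Primrec.snd (α := ℕ) (β := ℕ)
  exact (((Primrec.const 4).natMul h1).natMul (h2.natSub h1)).pair (h2.natMul h2)

theorem primrec_tent {n i : α → ℕ} {p : α → ℕ × ℕ} (hn : Primrec n) (hp : Primrec p)
    (hi : Primrec i) : Primrec fun x => tent (n x) (p x) (i x) := by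
  have h1 : Primrec fun x : α × ℕ × ℕ => x.2.1 := Primrec.fst.comp Primrec.snd
  have h2 : Primrec fun x : α × ℕ × ℕ => x.2.2 := Primrec.snd.comp Primrec.snd
  have hq : Primrec fun x : α × ℕ × ℕ => logistic^[n x.1 - 1 - x.2.1] (p x.1) :=
    Primrec.nat_iterate (((hn.comp Primrec.fst).natSub (Primrec.const 1)).natSub h1)
      (hp.comp Primrec.fst) (primrec_logistic.comp Primrec.snd)
  have hstep : Primrec₂ fun (x : α) (r : ℕ × ℕ) =>
      if 2 * (logistic^[n x - 1 - r.1] (p x)).1 ≤ (logistic^[n x - 1 - r.1] (p x)).2 then r.2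
      else 2 ^ (r.1 + 1) - r.2 := Primrec.ite
    (Primrec.nat_le.comp ((Primrec.const 2).natMul (Primrec.fst.comp hq)) (Primrec.snd.comp hq))
    h2 (((Primrec.const 2).natPow (h1.natAdd (Primrec.const 1))).natSub h2)
  exact Primrec.nat_rec' hi (Primrec.const 0) hstep

theorem primrec_counterBits {a k j : α → ℕ} (ha : Primrec a) (hk : Primrec k) (hj : Primrec j) :
    Primrec fun x => counterBits (a x) (k x) (j x) :=
  (hj.natAdd (Primrec.const 7)).natAdd (Primrec.natClog (by norm_num)
    ((((Primrec.const 2).natPow ha).natDiv hk).natAdd (Primrec.const 1)))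

theorem primrec_threshold {a k j : α → ℕ} (ha : Primrec a) (hk : Primrec k) (hj : Primrec j) :
    Primrec fun x => threshold (a x) (k x) (j x) := by
  have hc := primrec_counterBits ha hk hj
  have hj1 := hj.natAdd (Primrec.const 1)
  exact primrec_tent hc ((hk.natMul (((Primrec.const 2).natPow hj1).natAdd (Primrec.const 1))).pair
    ((Primrec.const 2).natPow (hj1.natAdd ha))) hc

theorem code_deciderCircuit (m b k j : ℕ) : (deciderCircuit m b k j).code =
    if NothingToReject m k j then (1, 0, [[2, 0]]) else
    (WGate.deciderWidth (Nat.clog 2 m) b (counterBits (Nat.clog 2 m) k j + 1) + 1,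
      Nat.clog 2 m + b + (counterBits (Nat.clog 2 m) k j + 1) +
        2 * (counterBits (Nat.clog 2 m) k j + 1) + 1,
      (WGate.deciderGates (Nat.clog 2 m) b (counterBits (Nat.clog 2 m) k j + 1)
        (threshold (Nat.clog 2 m) k j) (2 ^ (counterBits (Nat.clog 2 m) k j + 1) - 1 -
          threshold (Nat.clog 2 m) k j)).map (WGate.code (Nat.clog 2 m + b))) := by
  rw [deciderCircuit]
  split
  · rw [OracleCircuit.code_ofWGates (by simp [WGate.pauliX, WGate.Valid]) (by norm_num)]
    rfl
  · rw [OracleCircuit.code_ofWGates (WGate.deciderGates_valid _ _ _ _)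
      (by simp only [WGate.deciderWidth]; omega)]

theorem primrec_code_deciderCircuit {m b k j : α → ℕ} (hm : Primrec m) (hb : Primrec b)
    (hk : Primrec k) (hj : Primrec j) :
    Primrec fun x => (deciderCircuit (m x) (b x) (k x) (j x)).code := by
  have ha : Primrec fun x => Nat.clog 2 (m x) := Primrec.natClog (by norm_num) hm
  have hn := (primrec_counterBits ha hk hj).natAdd (Primrec.const 1)
  have hs := primrec_threshold ha hk hj
  have hab := ha.natAdd hb
  have h2j := (Primrec.const 2).natPow hj
  have ho := ((hab.natAdd hn).natAdd ((Primrec.const 2).natMul hn)).natAdd (Primrec.const 1)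
  simp only [code_deciderCircuit]
  refine Primrec.ite (Primrec.nat_le.comp (hm.natMul h2j)
    (hk.natMul (h2j.natAdd (Primrec.const 1)))) (Primrec.const _)
    ((((ho.natAdd ha).natAdd hb).natAdd (Primrec.const 1)).pair (ho.pair
      (Primrec.list_map (WGate.primrec_deciderGates ha hb hn hs
        ((((Primrec.const 2).natPow hn).natSub (Primrec.const 1)).natSub hs))
        (WGate.primrec_code (hab.comp Primrec.fst) Primrec.snd))))

end Gates

/-- Eliminates real arithmetic for rational `ε`: the ceiling of `q / p` is a natural division. For
`p = 0` both sides use division by zero with value zero and agree. -/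
theorem precisionBits_div (p q : ℕ) :
    precisionBits ((p : ℝ) / q) = Nat.clog 2 ((q + p - 1) / p) := by
  rw [precisionBits, one_div_div]
  congr 1
  rcases Nat.eq_zero_or_pos p with rfl | hp
  · simp
  · refine eq_of_forall_ge_iff fun c => ?_
    have hp' : (0 : ℝ) < p := by exact_mod_cast hp
    rw [Nat.ceil_le, div_le_iff₀ hp', Nat.div_le_iff_le_mul_add_pred hp]
    constructor
    · intro h
      have : q ≤ c * p := by exact_mod_cast h
      rw [mul_comm] at this
      omega
    · intro h
      have : q ≤ c * p := by rw [mul_comm]; omega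
      exact_mod_cast this

/-- The decider, as a uniform family of circuits. -/
noncomputable def hammingDecider : QuantumStringAlgorithm where
  circuit m b k ε := deciderCircuit m b k (precisionBits ε)
  uniform := by
    simp only [precisionBits_div]
    have h2 := Primrec.snd (α := ℕ) (β := ℕ × ℕ × ℕ × ℕ)
    have h3 := Primrec.snd.comp h2
    have h4 := Primrec.snd.comp h3
    have hp := Primrec.fst.comp h4
    have hq := Primrec.snd.comp h4
    exact (primrec_code_deciderCircuit Primrec.fst (Primrec.fst.comp h2) (Primrec.fst.comp h3)
      (Primrec.natClog (by norm_num)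
        (((hq.natAdd hp).natSub (Primrec.const 1)).natDiv hp))).to_comp

/-! ### Size of the circuits -/

namespace WGate

/-- The total cost of a list of gates. -/
def lcost (L : List WGate) : ℕ := (L.map cost).sum

theorem lcost_append (L L' : List WGate) : lcost (L ++ L') = lcost L + lcost L' := by
  simp [lcost]

theorem lcost_cons (g : WGate) (L : List WGate) : lcost (g :: L) = cost g + lcost L := by
  simp [lcost]

theorem lcost_nil : lcost [] = 0 := rfl

theorem lcost_reverse (L : List WGate) : lcost L.reverse = lcost L := by
  simp [lcost]

theorem lcost_flatMap_range_le {k c : ℕ} {f : ℕ → List WGate} (h : ∀ i < k, lcost (f i) ≤ c) :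
    lcost ((List.range k).flatMap f) ≤ k * c := by
  induction k with
  | zero => simp [lcost]
  | succ k ih =>
    rw [List.range_succ, List.flatMap_append, lcost_append, List.flatMap_singleton]
    have h1 := ih fun i hi => h i (by omega)
    have h2 := h k (by omega)
    rw [add_mul, one_mul]
    omega

theorem cost_had (q : ℕ) : cost (had q) = 1 := rfl
theorem cost_phase (r q : ℕ) : cost (phase r q) = r + 1 := rfl
theorem cost_pauliX (q : ℕ) : cost (pauliX q) = 1 := rfl
theorem cost_cnot (c t : ℕ) : cost (cnot c t) = 1 := rfl
theorem cost_toffoli (c d t : ℕ) : cost (toffoli c d t) = 1 := rfl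
theorem cost_queryX : cost queryX = 1 := rfl
theorem cost_queryY : cost queryY = 1 := rfl

theorem lcost_hads (B k : ℕ) : lcost (hads B k) = k := by
  induction k with
  | zero => rfl
  | succ k ih => rw [hads_succ, lcost_append, ih, lcost_cons, lcost_nil, cost_had]

theorem lcost_step_le (w i o : ℕ) (c : Bool) : lcost (step w i o c) ≤ 3 := by
  cases c <;> simp [step, lcost, cost_cnot, cost_toffoli]

theorem lcost_chain_le (B C s k : ℕ) : lcost (chain B C s k) ≤ k * 3 :=
  lcost_flatMap_range_le fun _ _ => lcost_step_le _ _ _ _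

theorem lcost_grover_le (a b C c : ℕ) : lcost (grover a b C c) ≤ 16 * (a + b + 1) := by
  have h1 := lcost_chain_le a C 0 b
  have h2 := lcost_chain_le 0 C 0 a
  simp only [grover, diffTest, zeroTest, lcost_append, lcost_reverse, lcost_cons, lcost_nil,
    cost_queryX, cost_queryY, cost_pauliX, cost_cnot, cost_phase, lcost_hads]
  omega

theorem lcost_groverPowers_le (a b n : ℕ) :
    lcost (groverPowers a b n) ≤ n * (2 ^ n * (16 * (a + b + 1))) :=
  lcost_flatMap_range_le fun i _ =>
    (lcost_flatMap_range_le fun _ _ => lcost_grover_le _ _ _ _).trans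
      (Nat.mul_le_mul_right _ (Nat.pow_le_pow_right (by norm_num) (by omega)))

/-- Phase gates are charged for their precision, so the inverse phase built from `r + 1` gates costs
quadratically. Over the pairs of wires in `qft` this produces the fourth power in the final bound.
-/
theorem lcost_cphase_le {r n : ℕ} (c t : ℕ) (hr : r ≤ n) :
    lcost (cphase r c t) ≤ 8 * (n + 1) ^ 2 := by
  have h : lcost ((List.range (r + 1)).map fun i => phase (i + 1) t) ≤ (r + 1) * (n + 2) := by
    rw [List.map_eq_flatMap]
    refine lcost_flatMap_range_le fun i hi => ?_
    rw [lcost_cons, lcost_nil, cost_phase]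
    omega
  have h' : (r + 1) * (n + 2) ≤ (n + 1) * (n + 2) := Nat.mul_le_mul_right _ (by omega)
  simp only [cphase, lcost_append, lcost_cons, lcost_nil, cost_phase, cost_cnot]
  nlinarith

theorem lcost_qft_le (B n : ℕ) : lcost (qft B n) ≤ n * (n * (8 * (n + 1) ^ 2) + 1) := by
  refine lcost_flatMap_range_le fun i hi => ?_
  rw [lcost_append, lcost_cons, lcost_nil, cost_had]
  have h : lcost ((List.range i).flatMap fun l => cphase (i - l + 1) (B + l) (B + i)) ≤
      i * (8 * (n + 1) ^ 2) :=
    lcost_flatMap_range_le fun l _ => lcost_cphase_le _ _ (by omega)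
  have h' : i * (8 * (n + 1) ^ 2) ≤ n * (8 * (n + 1) ^ 2) := Nat.mul_le_mul_right _ hi.le
  omega

/-- The Grover powers contribute `16 · 2 ^ n R²` and the Fourier transform `8 R⁴`; the remaining
terms are linear in `R` and fit into the rest of the constant 35. -/
theorem lcost_deciderGates_le (a b n s s' : ℕ) :
    lcost (deciderGates a b n s s') ≤ 35 * 2 ^ n * (a + b + n + 1) ^ 4 := by
  have h1 := lcost_groverPowers_le a b n
  have h2 := lcost_qft_le (a + b) n
  have h3 := lcost_chain_le (a + b) (a + b + n) s n
  have h4 := lcost_chain_le (a + b) (a + b + n + n + 1) s' n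
  simp only [deciderGates, windowTest, lcost_append, lcost_cons, lcost_nil, lcost_hads, cost_cnot,
    cost_pauliX]
  set R := a + b + n + 1 with hR
  have hR1 : 1 ≤ R := by omega
  have hp : 1 ≤ 2 ^ n := Nat.one_le_two_pow
  have e1 : n * (2 ^ n * (16 * (a + b + 1))) ≤ R * (2 ^ n * (16 * R)) := by gcongr <;> omega
  have e2 : n * (n * (8 * (n + 1) ^ 2) + 1) ≤ R * (R * (8 * R ^ 2) + 1) := by gcongr <;> omega
  have f1 : R ≤ R ^ 4 := Nat.le_self_pow (by norm_num) R
  have f2 : R ^ 2 ≤ R ^ 4 := Nat.pow_le_pow_right hR1 (by norm_num)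
  have f3 : R ^ 4 ≤ 2 ^ n * R ^ 4 := Nat.le_mul_of_pos_left _ hp
  have f4 : 2 ^ n * R ^ 2 ≤ 2 ^ n * R ^ 4 := Nat.mul_le_mul_left _ f2
  have g1 : R * (2 ^ n * (16 * R)) = 16 * (2 ^ n * R ^ 2) := by ring
  have g2 : R * (R * (8 * R ^ 2) + 1) = 8 * R ^ 4 + R := by ring
  rw [g1] at e1
  rw [g2] at e2
  rw [mul_assoc]
  omega

end WGate

theorem two_pow_clog_le {B x : ℕ} (hB : 1 < B) (hx : 1 ≤ x) : B ^ Nat.clog B x ≤ B * x := by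
  rcases hx.eq_or_lt with rfl | h
  · simp; omega
  · have h1 := Nat.pow_pred_clog_lt_self hB h
    have h2 := Nat.clog_pos hB h
    calc B ^ Nat.clog B x = B * B ^ (Nat.clog B x).pred := by
          rw [← pow_succ', Nat.pred_eq_sub_one, Nat.sub_add_cancel h2]
      _ ≤ B * x := Nat.mul_le_mul_left _ h1.le

/-- Take logarithms and use `log 2 > 1/2`. -/
theorem le_of_two_pow_le {e c : ℕ} {x : ℝ} (hx : 1 ≤ x) (h : (2 : ℝ) ^ e ≤ 2 ^ c * x) :
    (e : ℝ) ≤ c + 2 * Real.log x := by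
  have h1 := Real.log_le_log (by positivity) h
  rw [Real.log_mul (by positivity) (by positivity), Real.log_pow, Real.log_pow] at h1
  have h2 := Real.log_two_gt_d9
  have h3 := Real.log_nonneg hx
  have h4 : (e - c : ℝ) * Real.log 2 ≤ Real.log x := by linarith
  by_contra hlt
  push Not at hlt
  nlinarith

theorem two_pow_precisionBits_le {ε : ℝ} (h0 : 0 < ε) (h1 : ε ≤ 1) :
    (2 : ℝ) ^ precisionBits ε ≤ 4 * ε⁻¹ := by
  have hinv : 1 ≤ 1 / ε := by rwa [le_div_iff₀ h0, one_mul]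
  have hc : 1 ≤ ⌈1 / ε⌉₊ := Nat.one_le_iff_ne_zero.2 (by
    have := Nat.ceil_pos.2 (zero_lt_one.trans_le hinv); omega)
  have h2 : (2 : ℝ) ^ precisionBits ε ≤ 2 * ⌈1 / ε⌉₊ := by
    exact_mod_cast two_pow_clog_le (B := 2) (by norm_num) hc
  have h3 := Nat.ceil_lt_add_one (zero_le_one.trans hinv)
  rw [one_div] at *
  linarith

/-- After squaring: `4 ^ extraBits ≤ 4 (2m/k + 1) ≤ 16 m/k`, where `k ≤ m` absorbs the additive 1.
-/
theorem two_pow_extraBits_le {m k : ℕ} (hk : 0 < k) (hkm : k ≤ m) :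
    (2 : ℝ) ^ extraBits (Nat.clog 2 m) k ≤ 4 * Real.sqrt (m / k) := by
  have hk' : (0 : ℝ) < k := by exact_mod_cast hk
  have h1 : (2 : ℝ) ^ Nat.clog 2 m ≤ 2 * m := by
    exact_mod_cast two_pow_clog_le (B := 2) (by norm_num) (hk.trans_le hkm)
  have h2 : (4 : ℝ) ^ extraBits (Nat.clog 2 m) k ≤ 4 * ((2 ^ Nat.clog 2 m / k : ℕ) + 1) := by
    exact_mod_cast two_pow_clog_le (B := 4) (x := 2 ^ Nat.clog 2 m / k + 1) (by norm_num)
      (Nat.le_add_left 1 _)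
  have h3 : ((2 ^ Nat.clog 2 m / k : ℕ) : ℝ) ≤ 2 * m / k := by
    refine Nat.cast_div_le.trans ?_
    push_cast
    gcongr
  have h4 : (1 : ℝ) ≤ m / k := by
    rw [le_div_iff₀ hk', one_mul]; exact_mod_cast hkm
  rw [← pow_le_pow_iff_left₀ (by positivity) (by positivity) two_ne_zero]
  rw [mul_pow, Real.sq_sqrt (by positivity), ← pow_mul, mul_comm _ 2, pow_mul]
  norm_num
  rw [mul_div_assoc] at h3
  linarith

theorem size_deciderCircuit_le {m b k : ℕ} {ε : ℝ} (hk : 0 < k) (h0 : 0 < ε) (h1 : ε ≤ 1) :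
    ((deciderCircuit m b k (precisionBits ε)).size : ℝ) ≤
      35 * 4096 * 14 ^ 4 * (1 + ε⁻¹ * Real.sqrt ((m : ℝ) / (k : ℝ))) *
        (1 + (b : ℝ) + Real.log (1 + (m : ℝ) / ε)) ^ 4 := by
  set j := precisionBits ε with hj
  set ℓ := Real.log (1 + (m : ℝ) / ε) with hℓ
  set S := ε⁻¹ * Real.sqrt ((m : ℝ) / (k : ℝ)) with hS
  have hS0 : 0 ≤ S := by positivity
  have hx : (1 : ℝ) ≤ 1 + m / ε := by
    have : (0 : ℝ) ≤ m / ε := by positivity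
    linarith
  have hℓ0 : 0 ≤ ℓ := Real.log_nonneg hx
  have hb0 : (0 : ℝ) ≤ b := Nat.cast_nonneg b
  have hL : (1 : ℝ) ≤ 1 + b + ℓ := by linarith
  by_cases hc : NothingToReject m k j
  · have hsize : (deciderCircuit m b k j).size = 1 := by
      rw [deciderCircuit, if_pos hc,
        OracleCircuit.size_ofWGates (by simp [WGate.pauliX, WGate.Valid])]
      rfl
    rw [hsize]
    have : (1 : ℝ) ≤ (1 + b + ℓ) ^ 4 := one_le_pow₀ hL
    push_cast
    nlinarith
  · have hsize : (deciderCircuit m b k j).size ≤ 35 * 2 ^ (counterBits (Nat.clog 2 m) k j + 1) *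
        (Nat.clog 2 m + b + (counterBits (Nat.clog 2 m) k j + 1) + 1) ^ 4 := by
      rw [deciderCircuit, if_neg hc,
        OracleCircuit.size_ofWGates (WGate.deciderGates_valid _ _ _ _)]
      exact WGate.lcost_deciderGates_le _ _ _ _ _
    rw [NothingToReject, not_le] at hc
    have hkm : k ≤ m := by
      by_contra hlt
      have := Nat.mul_le_mul_right (2 ^ j) (Nat.le_of_lt (not_le.1 hlt))
      nlinarith
    have hm1 : (1 : ℝ) ≤ m := by exact_mod_cast (Nat.succ_le_of_lt hk).trans hkm
    have hk1 : (1 : ℝ) ≤ k := by exact_mod_cast hk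
    set n := counterBits (Nat.clog 2 m) k j + 1 with hn
    set a := Nat.clog 2 m with ha
    -- `4096 = 256 · 4 · 4`: the fixed 8 bits, and a rounding factor 4 each for `ε⁻¹` and `√(m/k)`.
    have hn2 : (2 : ℝ) ^ n ≤ 4096 * S := by
      have e1 := two_pow_precisionBits_le h0 h1
      have e2 := two_pow_extraBits_le hk hkm
      have e3 : (2 : ℝ) ^ n = 256 * (2 ^ j * 2 ^ extraBits a k) := by
        rw [hn, counterBits, show j + 7 + extraBits a k + 1 = 8 + (j + extraBits a k) by ring,
          pow_add, pow_add]
        norm_num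
      rw [e3, hS]
      have : (2 : ℝ) ^ j * 2 ^ extraBits a k ≤ (4 * ε⁻¹) * (4 * Real.sqrt (m / k)) := by gcongr
      linarith
    have ha2 : (2 : ℝ) ^ a ≤ 2 * m := by
      exact_mod_cast two_pow_clog_le (B := 2) (by norm_num) (hk.trans_le hkm)
    have hmε : (m : ℝ) ≤ m / ε := by
      rw [le_div_iff₀ h0]; nlinarith
    have hSx : S ≤ 1 + m / ε := by
      have : Real.sqrt ((m : ℝ) / k) ≤ m := by
        rw [Real.sqrt_le_iff]
        refine ⟨by linarith, ?_⟩
        rw [div_le_iff₀ (by linarith)]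
        nlinarith [mul_le_mul hm1 hk1 zero_le_one (by linarith : (0 : ℝ) ≤ m)]
      calc S ≤ ε⁻¹ * m := by rw [hS]; gcongr
        _ = m / ε := by rw [div_eq_inv_mul]
        _ ≤ _ := by linarith
    have ha3 := le_of_two_pow_le (e := a) (c := 1) hx (by rw [pow_one]; linarith)
    have hn3 := le_of_two_pow_le (e := n) (c := 12) hx (by norm_num; linarith)
    -- From `a ≤ 1 + 2ℓ` and `n ≤ 12 + 2ℓ` the sum is at most `14 + b + 4ℓ`.
    have hR : (a + b + n + 1 : ℝ) ≤ 14 * (1 + b + ℓ) := by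
      push_cast at ha3 hn3
      linarith
    calc ((deciderCircuit m b k j).size : ℝ) ≤ 35 * 2 ^ n * (a + b + n + 1) ^ 4 := by
          exact_mod_cast hsize
      _ ≤ 35 * (4096 * S) * (14 * (1 + b + ℓ)) ^ 4 := by gcongr
      _ = 35 * 4096 * 14 ^ 4 * S * (1 + b + ℓ) ^ 4 := by ring
      _ ≤ _ := by gcongr; linarith

theorem mainTheorem2 :
    ∃ A : QuantumStringAlgorithm,
      (∀ (m b k : ℕ) (ε : ℝ), 0 < k → 0 < ε → ε ≤ 1 →
        ∀ X Y : Fin m → Fin b → Bool,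
          (hammingDist X Y ≤ k →
            9 / 10 ≤ (A.circuit m b k ε).outputProb X Y true) ∧
          ((1 + ε) * (k : ℝ) < (hammingDist X Y : ℝ) →
            9 / 10 ≤ (A.circuit m b k ε).outputProb X Y false)) ∧
      (∃ (C : ℝ) (d : ℕ), ∀ (m b k : ℕ) (ε : ℝ), 0 < k → 0 < ε → ε ≤ 1 →
        ((A.circuit m b k ε).size : ℝ) ≤
          C * (1 + ε⁻¹ * Real.sqrt ((m : ℝ) / (k : ℝ))) *
            (1 + (b : ℝ) + Real.log (1 + (m : ℝ) / ε)) ^ d) := by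
  refine ⟨hammingDecider, fun m b k ε hk h0 _ X Y => ?_, 35 * 4096 * 14 ^ 4, 4,
    fun m b k ε hk h0 h1 => size_deciderCircuit_le hk h0 h1⟩
  obtain ⟨hyes, hno⟩ := deciderCircuit_spec (j := precisionBits ε) hk X Y
  -- The circuit works with the smaller precision `2⁻ʲ ≤ ε`, so its rejection range contains the
  -- required one.
  refine ⟨hyes, fun h => hno (lt_of_le_of_lt ?_ h)⟩
  gcongr
  exact precisionBits_le h0
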